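/- Let $n\ge 1$. Consider a convex $(n+3)$-gon, and call a triangulation of it a \emph{path triangulation} if its dual tree (nodes: the triangles; edges: pairs of triangles sharing a diagonal) is a path. Given a triangulation $T_0$ with inner diagonals $\delta_1,\dots,\delta_n$ (the \emph{seed triangulation}) and a basis $\alpha_1,\dots,\alpha_n$ of a real vector space $V$, associate with each inner diagonal $d$ of the polygon the vector $v_d=-\alpha_i$ if $d=\delta_i$, and $v_d=\sum_{i:\, d\text{ crosses }\delta_i}\alpha_i$ if $d\notin T_0$. Let $\mathcal F_{T_0}$ be the collection of the cones $\mathbb R_{\ge 0}\{v_d: d\in T\}$, for all triangulations $T$ of the polygon, and of all their faces $\mathbb R_{\ge 0}\{v_d: d\in S\}$, $S\subseteq T$. Write $\mathrm{Ass}^{II}(T_0)$ for any polytope $P\subset V^*$ whose normal fan is $\mathcal F_{T_0}$. Two polytopes are \emph{normally isomorphic} if a linear isomorphism carries the cones of the normal fan of one to the cones of the normal fan of the other. Take $V=\{x\in\mathbb R^{n+1}:\sum_k x_k=0\}$ and $\alpha_i=e_{i+1}-e_i$ for $1\le i\le n$. Then: (i) Let $T_0$ be a path triangulation, with its diagonals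 $\delta_1,\dots,\delta_n$ numbered in the order in which they appear along the dual path. Then polytopes $\mathrm{Ass}^{II}(T_0)$ exist, the set of the vectors $v_d$ (over all inner diagonals $d$) is equal to the set of almost positive roots of the root system $A_n=\{e_i-e_j : i\ne j\}$ with respect to the simple roots $\alpha_1,\dots,\alpha_n$, that is, to $$\{\alpha_i+\alpha_{i+1}+\dots+\alpha_j : 1\le i\le j\le n\}\cup\{-\alpha_1,\dots,-\alpha_n\},$$ and for every polytope $P=\mathrm{Ass}^{II}(T_0)$ the set of outer normal vectors to the facets of $P$ (one for each facet) is this set: sending an almost positive root $\beta$ to the face of $P$ on which $\beta$ is maximized is a bijection from the set of almost positive roots to the set of facets of $P$. (ii) The number of normal isomorphism classes of the polytopes $\mathrm{Ass}^{II}(T_0)$, where $T_0$ runs over all path triangulations of the $(n+3)$-gon with diagonals numbered as in (i), is equal to the number of sign sequences in $\{+,-\}^{n-1}$ modulo reflection (change of all signs) and reversal (of the order of the entries). -/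

import Mathlib

/-! Polytopes and their normal fans, diagonals and triangulations of a convex polygon,
the associahedra built from a seed triangulation, and the root system of type `A`. -/

namespace SantosAssociahedron

section Polytopes

variable {V W : Type*} [AddCommGroup V] [Module ℝ V] [AddCommGroup W] [Module ℝ W]

/-- A polytope living in the dual space `V*`, so that its normal vectors live in `V`. -/
def IsPolytope (P : Set (Module.Dual ℝ V)) : Prop :=
  ∃ s : Set (Module.Dual ℝ V), s.Finite ∧ P = convexHull ℝ s

/-- The face of `P` at which the vector `u` is maximized. -/
def face (P : Set (Module.Dual ℝ V)) (u : V) : Set (Module.Dual ℝ V) :=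
  {x ∈ P | ∀ y ∈ P, y u ≤ x u}

/-- The nonempty faces of `P` (including `P = face P 0`). -/
def faces (P : Set (Module.Dual ℝ V)) : Set (Set (Module.Dual ℝ V)) :=
  {F | F.Nonempty ∧ ∃ u : V, F = face P u}

/-- The facets of `P`: the inclusion-maximal faces among those different from `P`. -/
def facets (P : Set (Module.Dual ℝ V)) : Set (Set (Module.Dual ℝ V)) :=
  {F | Maximal (fun G => G ∈ faces P ∧ G ≠ P) F}

/-- The (outer) normal cone of a face `F` of `P`: the vectors maximized over `P` at every point
of `F`. -/
def normalCone (P F : Set (Module.Dual ℝ V)) : Set V :=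
  {u | F ⊆ face P u}

/-- The normal fan of `P`: the set of the normal cones of its nonempty faces. -/
def normalFan (P : Set (Module.Dual ℝ V)) : Set (Set V) :=
  normalCone P '' faces P

/-- Two polytopes are normally isomorphic if some linear isomorphism carries the cones of one
normal fan to the cones of the other. -/
def NormallyIsomorphic (P : Set (Module.Dual ℝ V)) (Q : Set (Module.Dual ℝ W)) : Prop :=
  ∃ f : V ≃ₗ[ℝ] W, (fun C : Set V => f '' C) '' normalFan P = normalFan Q

end Polytopes

section Polygon

/-- The inner diagonals of a convex `(n+3)`-gon with vertices `0, 1, …, n+2` in cyclic order: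
pairs `p < q` of non-adjacent vertices. -/
abbrev Diagonal (n : ℕ) : Type :=
  {d : Fin (n + 3) × Fin (n + 3) //
    d.1.val + 2 ≤ d.2.val ∧ ¬ (d.1.val = 0 ∧ d.2.val = n + 2)}

/-- Two diagonals cross (in their relative interiors) if their endpoints strictly alternate. -/
def Crosses {n : ℕ} (d e : Diagonal n) : Prop :=
  (d.1.1 < e.1.1 ∧ e.1.1 < d.1.2 ∧ d.1.2 < e.1.2) ∨
    (e.1.1 < d.1.1 ∧ d.1.1 < e.1.2 ∧ e.1.2 < d.1.2)

instance {n : ℕ} (d e : Diagonal n) : Decidable (Crosses d e) := by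
  unfold Crosses; infer_instance

/-- A triangulation of the `(n+3)`-gon, given by its inner diagonals: a maximal set of pairwise
non-crossing diagonals. -/
def IsTriangulation {n : ℕ} (T : Finset (Diagonal n)) : Prop :=
  Maximal (fun S : Finset (Diagonal n) => ∀ d ∈ S, ∀ e ∈ S, ¬ Crosses d e) T

/-- `t` is the vertex set of a triangle of the triangulation `T`: three vertices, any two of which
are joined by a side of the polygon or by a diagonal of `T`. -/
def IsTriangle {n : ℕ} (T : Finset (Diagonal n)) (t : Finset (Fin (n + 3))) : Prop :=
  t.card = 3 ∧ ∀ a ∈ t, ∀ b ∈ t, a < b →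
    (a.val + 1 = b.val ∨ (a.val = 0 ∧ b.val = n + 2)) ∨ ∃ d ∈ T, d.1 = (a, b)

/-- `d` is an edge of the triangle `t`. -/
def IsEdgeOf {n : ℕ} (d : Diagonal n) (t : Finset (Fin (n + 3))) : Prop :=
  d.1.1 ∈ t ∧ d.1.2 ∈ t

/-- The dual tree of a triangulation: its nodes are the triangles, and two triangles are adjacent
if they share a diagonal of the triangulation. -/
def dualTree {n : ℕ} (T : Finset (Diagonal n)) :
    SimpleGraph {t : Finset (Fin (n + 3)) // IsTriangle T t} where
  Adj t t' := t ≠ t' ∧ ∃ d ∈ T, IsEdgeOf d t.1 ∧ IsEdgeOf d t'.1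
  symm := ⟨fun _ _ h => ⟨h.1.symm, h.2.imp fun _ hd => ⟨hd.1, hd.2.2, hd.2.1⟩⟩⟩
  loopless := ⟨fun _ h => h.1 rfl⟩

/-- `T` is a path triangulation (its dual tree is a path with `n + 1` nodes), and `δ` lists its
diagonals in the order in which they appear along the path: `δ i` is shared by the `i`-th and the
`(i+1)`-st triangle. -/
def IsPathNumbering {n : ℕ} (T : Finset (Diagonal n)) (δ : Fin n → Diagonal n) : Prop :=
  IsTriangulation T ∧
    ∃ φ : SimpleGraph.pathGraph (n + 1) ≃g dualTree T,
      ∀ i : Fin n, δ i ∈ T ∧ IsEdgeOf (δ i) (φ i.castSucc).1 ∧ IsEdgeOf (δ i) (φ i.succ).1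

end Polygon

section Construction

variable {V : Type*} [AddCommGroup V] [Module ℝ V]

/-- The vector associated with a diagonal `d`, for a seed triangulation with diagonals
`δ 0, …, δ (n-1)` and a basis `α`: it is `-α i` if `d = δ i`, and otherwise the sum of the `α i`
over all `i` such that `d` crosses `δ i`. (A diagonal `δ i` crosses no other `δ j`.) -/
def diagonalVector {n : ℕ} (δ : Fin n → Diagonal n) (α : Fin n → V) (d : Diagonal n) : V :=
  ∑ i, if d = δ i then -α i else if Crosses d (δ i) then α i else 0

/-- The fan of the seed triangulation: its maximal cones are spanned by the (vectors of the)
triangulations of the polygon, and its cones are all the faces of these, that is, the cones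
spanned by the subsets of triangulations. -/
def seedFan {n : ℕ} (δ : Fin n → Diagonal n) (α : Fin n → V) : Set (Set V) :=
  {C | ∃ T : Finset (Diagonal n), IsTriangulation T ∧ ∃ S ⊆ T,
    C = (PointedCone.hull ℝ (diagonalVector δ α '' (S : Set (Diagonal n))) : Set V)}

/-- `P` is an associahedron of the seed triangulation `δ`: a polytope whose normal fan is the
fan of the seed triangulation. -/
def IsSeedAssociahedron {n : ℕ} (δ : Fin n → Diagonal n) (α : Fin n → V)
    (P : Set (Module.Dual ℝ V)) : Prop :=
  IsPolytope P ∧ normalFan P = seedFan δ α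

end Construction

section RootSystem

/-- The space `{x ∈ ℝ^{n+1} : x₁ + ⋯ + x_{n+1} = 0}`. -/
def rootSpace (n : ℕ) : Submodule ℝ (Fin (n + 1) → ℝ) where
  carrier := {x | ∑ i, x i = 0}
  add_mem' {x y} hx hy := by
    simp only [Set.mem_ofPred_eq, Pi.add_apply, Finset.sum_add_distrib] at *
    rw [hx, hy, add_zero]
  zero_mem' := by simp
  smul_mem' c x hx := by
    simp only [Set.mem_ofPred_eq, Pi.smul_apply, smul_eq_mul, ← Finset.mul_sum] at *
    rw [hx, mul_zero]

/-- The root system of type `A_n`: the vectors `e_i - e_j` with `i ≠ j`. -/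
def rootSystem (n : ℕ) : Set (rootSpace n) :=
  {β | ∃ i j : Fin (n + 1), i ≠ j ∧ β.1 = Pi.single i 1 - Pi.single j 1}

/-- The simple roots `α_i = e_{i+1} - e_i`. -/
def simpleRoot (n : ℕ) (i : Fin n) : rootSpace n :=
  ⟨Pi.single i.succ 1 - Pi.single i.castSucc 1, by
    change ∑ j, (Pi.single i.succ 1 - Pi.single i.castSucc 1 : Fin (n + 1) → ℝ) j = 0
    simp [Finset.sum_sub_distrib]⟩

/-- The almost positive roots of type `A_n` for the simple roots `α_i`: the roots that are sums
of simple roots, and the negatives of the simple roots. -/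
def almostPositiveRoots (n : ℕ) : Set (rootSpace n) :=
  {β ∈ rootSystem n | β ∈ AddSubmonoid.closure (Set.range (simpleRoot n))} ∪
    Set.range fun i => -simpleRoot n i

/-- The associahedra obtained from all the path triangulations of the `(n+3)`-gon. -/
abbrev PathAssociahedron (n : ℕ) : Type :=
  {P : Set (Module.Dual ℝ (rootSpace n)) //
    ∃ (T : Finset (Diagonal n)) (δ : Fin n → Diagonal n),
      IsPathNumbering T δ ∧ IsSeedAssociahedron δ (simpleRoot n) P}

end RootSystem

/-- Sign sequences of length `m` related by a reflection (change of all the signs) or by a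
reversal; `Quot` passes to the equivalence relation generated by it. -/
def ReflectionOrReversal {m : ℕ} (c c' : Fin m → ℤˣ) : Prop :=
  c' = -c ∨ c' = c ∘ Fin.rev

end SantosAssociahedron

open SantosAssociahedron

/-! Path triangulations are encoded by signs. Up to rotation, the seed diagonals are the successive
chords of a sweep over the polygon in which one endpoint moves by one side at each step, and `s k`
records which endpoint moves between `δ (k - 1)` and `δ k`. Every other diagonal crosses a block of
consecutive seed diagonals, and each block `[i, j]` occurs exactly once: its diagonal joins the
vertex lost on entering the block to the vertex gained on leaving it. Hence the vectors are always
the almost positive roots, and the seed matters only through the crossing relation. `RootCross s`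
expresses that relation by comparing signs at the gaps `1, …, n - 1`
(`hasRootIndexing_sweepDiagonal`, `IsPathNumbering.exists_hasRootIndexing`).

Polytopality rests on two facts about such a family. Nonnegative combinations with noncrossing
support are determined by their values (`isFanFamily_rootVector`, a sweep through the coordinates).
There are also positive heights for which the sum of two crossing vectors can be rewritten at
smaller cost (`isExchangeHeight_rootHeight`). Minimizing the cost among all nonnegative
representations of a vector then yields the noncrossing one, so the minimal cost is a sublinear
function that is linear on each cone of the fan. Supporting functionals obtained from Hahn–Banach
are the vertices of a polytope with the required normal fan (`exists_polytope_normalFan`). The facet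
normals can be read off any polytope with this fan (`IsFanFamily.bijOn_facets`).

For the count, changing all signs leaves the crossing relation unchanged, and reversing the sequence
is realized by `α i ↦ α (n - 1 - i)`. Conversely, an isomorphism of two fans permutes rays and
respects crossings. Opposite rays occur only as the pairs `± α k`, and the crossings among simple
roots form a path, so for `n ≥ 2` the isomorphism scales the simple roots, up to reversal. It then
fixes the rays of `α g + α (g + 1)`, and two consecutive such rays cross exactly when two
consecutive signs agree. This recovers the sequence up to a global sign
(`sign_eq_of_image_noncrossingFan`). Every sign sequence is attained by a sweep
(`isPathNumbering_sweepDiagonal`). -/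

namespace SantosAssociahedron

/-! ### Polytopality of fans from heights with an exchange property -/

section ExchangeFans

variable {D V : Type*} [AddCommGroup V] [Module ℝ V]

/-- No two elements of `S` cross. -/
def IsNoncrossing (cross : D → D → Prop) (S : Set D) : Prop :=
  ∀ d ∈ S, ∀ e ∈ S, ¬ cross d e

/-- The cones spanned by the images of the noncrossing sets. -/
def noncrossingFan (v : D → V) (cross : D → D → Prop) : Set (Set V) :=
  {C | ∃ S : Set D, IsNoncrossing cross S ∧ C = (PointedCone.hull ℝ (v '' S) : Set V)}

theorem IsNoncrossing.mono {cross : D → D → Prop} {S S' : Set D} (hS : IsNoncrossing cross S')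
    (hss : S ⊆ S') : IsNoncrossing cross S :=
  fun d hd e he => hS d (hss hd) e (hss he)

variable [Fintype D]

theorem mem_hull_image_iff (v : D → V) (S : Set D) (u : V) :
    u ∈ PointedCone.hull ℝ (v '' S) ↔
      ∃ a : D → ℝ, 0 ≤ a ∧ (∀ d, d ∉ S → a d = 0) ∧ Fintype.linearCombination ℝ v a = u := by
  classical
  constructor
  · intro h
    refine Submodule.span_induction (p := fun u _ => ∃ a : D → ℝ, 0 ≤ a ∧ (∀ d, d ∉ S → a d = 0) ∧
      Fintype.linearCombination ℝ v a = u) ?_ ?_ ?_ ?_ h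
    · rintro _ ⟨d, hd, rfl⟩
      refine ⟨Pi.single d 1, ?_, ?_, ?_⟩
      · exact Pi.single_nonneg.2 zero_le_one
      · intro e he
        exact Pi.single_eq_of_ne (by rintro rfl; exact he hd) _
      · simp [Fintype.linearCombination_apply_single]
    · exact ⟨0, le_rfl, fun _ _ => rfl, map_zero _⟩
    · rintro x y - - ⟨a, ha, ha', rfl⟩ ⟨b, hb, hb', rfl⟩
      exact ⟨a + b, add_nonneg ha hb, fun d hd => by simp [ha' d hd, hb' d hd], map_add _ _ _⟩
    · rintro c x - ⟨a, ha, ha', rfl⟩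
      exact ⟨(c : ℝ) • a, smul_nonneg c.2 ha, fun d hd => by simp [ha' d hd], map_smul _ _ _⟩
  · rintro ⟨a, ha, ha', rfl⟩
    rw [Fintype.linearCombination_apply]
    refine Submodule.sum_mem _ fun d _ => ?_
    by_cases hd : d ∈ S
    · exact Submodule.smul_mem _ (⟨a d, ha d⟩ : {c : ℝ // 0 ≤ c})
        (Submodule.subset_span ⟨d, hd, rfl⟩)
    · rw [ha' d hd, zero_smul]
      exact Submodule.zero_mem _

/-- The family `v` positively spans `V`, no element crosses itself, and the coefficients of a
nonnegative combination of the vectors of a noncrossing set are determined by its value. -/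
structure IsFanFamily (v : D → V) (cross : D → D → Prop) : Prop where
  irrefl : ∀ d, ¬ cross d d
  spans : ∀ u, ∃ a : D → ℝ, 0 ≤ a ∧ Fintype.linearCombination ℝ v a = u
  unique : ∀ a b : D → ℝ, 0 ≤ a → 0 ≤ b → IsNoncrossing cross (Function.support a) →
    IsNoncrossing cross (Function.support b) →
    Fintype.linearCombination ℝ v a = Fintype.linearCombination ℝ v b → a = b

/-- Every sum of two crossing vectors is a nonnegative combination of smaller height. -/
structure IsExchangeHeight (v : D → V) (cross : D → D → Prop) (h : D → ℝ) : Prop where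
  pos : ∀ d, 0 < h d
  exchange : ∀ d e, cross d e → ∃ m : D → ℝ, 0 ≤ m ∧
    Fintype.linearCombination ℝ v m = v d + v e ∧ m ⬝ᵥ h < h d + h e

variable {v : D → V} {cross : D → D → Prop} {h : D → ℝ}

/-- Positive heights turn a bound on the cost into a bound on every coefficient, so the
representations no more expensive than a given one form a compact set. -/
theorem exists_minimal_cost (hv : IsFanFamily v cross) (hh : ∀ d, 0 < h d) (u : V) :
    ∃ a : D → ℝ, 0 ≤ a ∧ Fintype.linearCombination ℝ v a = u ∧
      ∀ b : D → ℝ, 0 ≤ b → Fintype.linearCombination ℝ v b = u → a ⬝ᵥ h ≤ b ⬝ᵥ h := by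
  obtain ⟨a₀, ha₀, hu⟩ := hv.spans u
  set L := Fintype.linearCombination ℝ v with hL
  let K : Set (D → ℝ) := {a | 0 ≤ a ∧ L a = u ∧ a ⬝ᵥ h ≤ a₀ ⬝ᵥ h}
  have hcont : Continuous fun a : D → ℝ => a ⬝ᵥ h :=
    continuous_finsetSum _ fun d _ => (continuous_apply d).mul continuous_const
  have hclosed : IsClosed K := by
    have h1 : IsClosed {a : D → ℝ | L a = u} := by
      have h2 : {a : D → ℝ | L a = u} = (fun a => a - a₀) ⁻¹' (LinearMap.ker L : Set (D → ℝ)) := by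
        ext a
        simp [sub_eq_zero, hu]
      rw [h2]
      exact (Submodule.closed_of_finiteDimensional _).preimage (continuous_id.sub continuous_const)
    exact (isClosed_Ici (a := (0 : D → ℝ))).inter (h1.inter (isClosed_le hcont continuous_const))
  have hcompact : IsCompact K := by
    refine (isCompact_Icc (a := (0 : D → ℝ)) (b := fun d => (a₀ ⬝ᵥ h) / h d)).of_isClosed_subset
      hclosed ?_
    rintro a ⟨ha, -, hc⟩
    refine ⟨ha, fun d => ?_⟩
    rw [le_div_iff₀ (hh d)]
    exact (Finset.single_le_sum (f := fun d => a d * h d)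
      (fun e _ => mul_nonneg (ha e) (hh e).le) (Finset.mem_univ d)).trans hc
  obtain ⟨a, haK, hmin⟩ := hcompact.exists_isMinOn ⟨a₀, ha₀, hu, le_rfl⟩ hcont.continuousOn
  refine ⟨a, haK.1, haK.2.1, fun b hb hbu => ?_⟩
  by_cases hbc : b ⬝ᵥ h ≤ a₀ ⬝ᵥ h
  · exact hmin (show b ∈ K from ⟨hb, hbu, hbc⟩)
  · exact haK.2.2.trans (not_le.1 hbc).le

/-- If two crossing elements both had positive coefficients, exchanging a small multiple of their
sum would lower the cost. -/
theorem isNoncrossing_support_of_minimal_cost (hh : IsExchangeHeight v cross h)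
    {a : D → ℝ} (ha : 0 ≤ a)
    (hmin : ∀ b : D → ℝ, 0 ≤ b →
      Fintype.linearCombination ℝ v b = Fintype.linearCombination ℝ v a → a ⬝ᵥ h ≤ b ⬝ᵥ h) :
    IsNoncrossing cross (Function.support a) := by
  classical
  intro d hd e he hde
  obtain ⟨m, hm, hmv, hmh⟩ := hh.exchange d e hde
  have hd' : 0 < a d := lt_of_le_of_ne (ha d) (Ne.symm hd)
  have he' : 0 < a e := lt_of_le_of_ne (ha e) (Ne.symm he)
  -- The factor one half keeps the coefficients nonnegative even if `d = e`, which is not excluded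
  -- here.
  set t := min (a d) (a e) / 2 with ht
  have ht0 : 0 < t := by positivity
  have h1 : t ≤ a d / 2 := by rw [ht]; gcongr; exact min_le_left _ _
  have h2 : t ≤ a e / 2 := by rw [ht]; gcongr; exact min_le_right _ _
  have key := hmin (a - t • (Pi.single d 1 + Pi.single e 1) + t • m) ?_ ?_
  · simp only [add_dotProduct, sub_dotProduct, smul_dotProduct, single_dotProduct, smul_eq_mul,
      one_mul] at key
    nlinarith
  · refine add_nonneg ?_ (smul_nonneg ht0.le hm)
    intro c
    have hc := ha c
    simp only [Pi.zero_apply, Pi.sub_apply, Pi.smul_apply, Pi.add_apply, smul_eq_mul,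
      Pi.single_apply] at hc ⊢
    split_ifs with h3 h4 h4 <;> subst_vars <;> linarith
  · simp only [map_add, map_sub, map_smul, Fintype.linearCombination_apply_single, hmv, one_smul]
    abel

/-- A cheapest representation has noncrossing support, and by uniqueness there is only one such
representation. -/
theorem noncrossing_representation_minimal (hv : IsFanFamily v cross)
    (hh : IsExchangeHeight v cross h) {a : D → ℝ} (ha : 0 ≤ a)
    (hnc : IsNoncrossing cross (Function.support a)) {b : D → ℝ} (hb : 0 ≤ b)
    (hab : Fintype.linearCombination ℝ v b = Fintype.linearCombination ℝ v a) :
    a ⬝ᵥ h ≤ b ⬝ᵥ h := by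
  obtain ⟨c, hc, hcu, hmin⟩ := exists_minimal_cost hv hh.pos (Fintype.linearCombination ℝ v a)
  have := isNoncrossing_support_of_minimal_cost hh hc fun b hb hbc => hmin b hb (hbc.trans hcu)
  rw [hv.unique a c ha hc hnc this hcu.symm]
  exact hmin b hb hab

theorem exists_noncrossing_representation (hv : IsFanFamily v cross)
    (hh : IsExchangeHeight v cross h) (u : V) :
    ∃ a : D → ℝ, 0 ≤ a ∧ IsNoncrossing cross (Function.support a) ∧
      Fintype.linearCombination ℝ v a = u := by
  obtain ⟨c, hc, hcu, hmin⟩ := exists_minimal_cost hv hh.pos u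
  exact ⟨c, hc, isNoncrossing_support_of_minimal_cost hh hc
    fun b hb hbc => hmin b hb (hbc.trans hcu), hcu⟩

theorem apply_linearCombination (x : Module.Dual ℝ V) (a : D → ℝ) :
    x (Fintype.linearCombination ℝ v a) = a ⬝ᵥ fun d => x (v d) := by
  simp [Fintype.linearCombination_apply, dotProduct]

/-- A noncrossing set is tight for some point of the polyhedron `{x | x (v d) ≤ h d}`. -/
theorem exists_dual_tight (hv : IsFanFamily v cross) (hh : IsExchangeHeight v cross h)
    {S : Set D} (hS : IsNoncrossing cross S) :
    ∃ x : Module.Dual ℝ V, (∀ d, x (v d) ≤ h d) ∧ ∀ d ∈ S, x (v d) = h d := by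
  classical
  -- The function `u ↦ a u ⬝ᵥ h` is the minimal cost of `u`. It is nonnegative, positively
  -- homogeneous and subadditive, hence can serve as the majorant in the Hahn–Banach theorem.
  choose a ha hnc hau using exists_noncrossing_representation hv hh
  have hmin : ∀ u (b : D → ℝ), 0 ≤ b → Fintype.linearCombination ℝ v b = u →
      a u ⬝ᵥ h ≤ b ⬝ᵥ h := fun u b hb hbu =>
    noncrossing_representation_minimal hv hh (ha u) (hnc u) hb (hbu.trans (hau u).symm)
  have hg0 : ∀ u, 0 ≤ a u ⬝ᵥ h := fun u =>
    Finset.sum_nonneg fun d _ => mul_nonneg (ha u d) (hh.pos d).le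
  have hgz : a 0 ⬝ᵥ h = 0 :=
    le_antisymm (by simpa using hmin 0 0 le_rfl (map_zero _)) (hg0 0)
  have hle : ∀ (c : ℝ), 0 < c → ∀ u, a (c • u) ⬝ᵥ h ≤ c * (a u ⬝ᵥ h) := fun c hc u => by
    have := hmin (c • u) (c • a u) (smul_nonneg hc.le (ha u)) (by rw [map_smul, hau])
    simpa using this
  have hhom : ∀ (c : ℝ), 0 < c → ∀ u, a (c • u) ⬝ᵥ h = c * (a u ⬝ᵥ h) := fun c hc u => by
    refine le_antisymm (hle c hc u) ?_
    have := hle c⁻¹ (inv_pos.2 hc) (c • u)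
    rw [inv_smul_smul₀ hc.ne'] at this
    calc c * (a u ⬝ᵥ h) ≤ c * (c⁻¹ * (a (c • u) ⬝ᵥ h)) := by gcongr
      _ = _ := by field_simp
  set b : D → ℝ := S.indicator 1 with hb
  have hb0 : 0 ≤ b := Set.indicator_nonneg fun _ _ => zero_le_one
  set u₀ := Fintype.linearCombination ℝ v b with hu₀
  have hgu : a u₀ ⬝ᵥ h = b ⬝ᵥ h := by
    refine le_antisymm (hmin _ _ hb0 rfl) ?_
    exact noncrossing_representation_minimal hv hh hb0 (hS.mono Set.support_indicator_subset)
      (ha _) (hau _)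
  have hH : ∀ c : ℝ, c • u₀ = 0 → (RingHom.id ℝ) c • (a u₀ ⬝ᵥ h) = 0 := by
    intro c hc
    rcases smul_eq_zero.1 hc with rfl | h0
    · simp
    · rw [h0, hgz, smul_zero]
  -- Hahn–Banach extends the functional from the line through `u₀`, the sum of the vectors of `S`.
  -- Since `x (v d) ≤ h d` for every `d` while the sum over `S` is attained at `u₀`, each inequality
  -- indexed by `S` must be an equality.
  obtain ⟨x, hx, hxg⟩ := exists_extension_of_le_sublinear
    (LinearPMap.mkSpanSingleton' u₀ (a u₀ ⬝ᵥ h) hH) (fun u => a u ⬝ᵥ h)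
    (fun c hc u => hhom c hc u)
    (fun u w => by
      rw [← add_dotProduct]
      exact hmin _ _ (add_nonneg (ha u) (ha w)) (by rw [map_add, hau, hau]))
    (by
      rintro ⟨w, hw⟩
      obtain ⟨c, rfl⟩ := Submodule.mem_span_singleton.1 hw
      rw [LinearPMap.mkSpanSingleton'_apply]
      change c * (a u₀ ⬝ᵥ h) ≤ a (c • u₀) ⬝ᵥ h
      rcases le_or_gt c 0 with hc | hc
      · exact (mul_nonpos_of_nonpos_of_nonneg hc (hg0 _)).trans (hg0 _)
      · exact (hhom c hc u₀).ge)
  have hxh : ∀ d, x (v d) ≤ h d := fun d => by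
    refine (hxg (v d)).trans ?_
    have := hmin (v d) (Pi.single d 1) (Pi.single_nonneg.2 zero_le_one)
      (by simp [Fintype.linearCombination_apply_single])
    simpa using this
  have hxu : x u₀ = b ⬝ᵥ h := by
    rw [← hgu]
    have := hx ⟨u₀, Submodule.mem_span_singleton_self u₀⟩
    exact this.trans (LinearPMap.mkSpanSingleton'_apply_self _ _ _ _)
  refine ⟨x, hxh, fun d hd => ?_⟩
  rw [hu₀, apply_linearCombination] at hxu
  have := (Finset.sum_eq_sum_iff_of_le (s := Finset.univ) (f := fun d => b d * x (v d))
    (g := fun d => b d * h d) fun d _ => mul_le_mul_of_nonneg_left (hxh d) (hb0 d)).1 hxu d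
    (Finset.mem_univ d)
  simpa [hb, hd] using this

/-- Lowering the height slightly outside of a given set keeps the exchange inequalities. -/
theorem IsExchangeHeight.exists_lower (hh : IsExchangeHeight v cross h) (S : Set D) :
    ∃ h' : D → ℝ, IsExchangeHeight v cross h' ∧ (∀ d ∈ S, h' d = h d) ∧ ∀ d ∉ S, h' d < h d := by
  classical
  choose m hm hmv hmh using hh.exchange
  -- Lowering heights by at most `ε` can only cheapen the exchanged combination and takes at most `2
  -- * ε` off `h d + h e`; finitely many strict inequalities leave room for one `ε`.
  have hex : ∃ ε > 0, (∀ d, ε < h d) ∧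
      ∀ p : D × D, ∀ hp : cross p.1 p.2, 2 * ε < h p.1 + h p.2 - m p.1 p.2 hp ⬝ᵥ h := by
    have h1 : ∀ᶠ ε : ℝ in nhdsWithin 0 (Set.Ioi 0), ∀ d, ε < h d :=
      Filter.eventually_all.2 fun d => nhdsWithin_le_nhds (eventually_lt_nhds (hh.pos d))
    have h2 : ∀ᶠ ε : ℝ in nhdsWithin 0 (Set.Ioi 0), ∀ p : D × D, ∀ hp : cross p.1 p.2,
        2 * ε < h p.1 + h p.2 - m p.1 p.2 hp ⬝ᵥ h := by
      refine Filter.eventually_all.2 fun p => ?_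
      by_cases hp : cross p.1 p.2
      · have h3 := hmh p.1 p.2 hp
        have h4 : (0 : ℝ) < (h p.1 + h p.2 - m p.1 p.2 hp ⬝ᵥ h) / 2 := by linarith
        filter_upwards [nhdsWithin_le_nhds (eventually_lt_nhds h4)] with ε hε _
        linarith
      · exact Filter.Eventually.of_forall fun ε hp' => absurd hp' hp
    obtain ⟨ε, ⟨h3, h4⟩, h5⟩ := ((h1.and h2).and self_mem_nhdsWithin).exists
    exact ⟨ε, h5, h3, h4⟩
  obtain ⟨ε, hε, hpos, hexc⟩ := hex
  refine ⟨fun d => if d ∈ S then h d else h d - ε, ⟨fun d => ?_, fun d e hde => ?_⟩,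
    fun d hd => if_pos hd, fun d hd => ?_⟩
  · split_ifs
    exacts [hh.pos d, sub_pos.2 (hpos d)]
  · refine ⟨m d e hde, hm d e hde, hmv d e hde, ?_⟩
    have h1 : m d e hde ⬝ᵥ (fun d => if d ∈ S then h d else h d - ε) ≤ m d e hde ⬝ᵥ h := by
      refine Finset.sum_le_sum fun c _ => mul_le_mul_of_nonneg_left ?_ (hm d e hde c)
      dsimp only
      split_ifs <;> linarith
    have h2 := hexc (d, e) hde
    dsimp only at h2 ⊢
    split_ifs <;> linarith
  · dsimp only
    rw [if_neg hd]
    linarith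

/-- A functional that is tight on `S` for the lowered height is automatically strict for `h` outside
`S`. -/
theorem exists_dual_tight_strict (hv : IsFanFamily v cross) (hh : IsExchangeHeight v cross h)
    {S : Set D} (hS : IsNoncrossing cross S) :
    ∃ x : Module.Dual ℝ V, (∀ d ∈ S, x (v d) = h d) ∧ ∀ d ∉ S, x (v d) < h d := by
  obtain ⟨h', hh', h1, h2⟩ := hh.exists_lower S
  obtain ⟨x, hx, hxS⟩ := exists_dual_tight hv hh' hS
  exact ⟨x, fun d hd => (hxS d hd).trans (h1 d hd), fun d hd => (hx d).trans_lt (h2 d hd)⟩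

/-- A family with an exchange height spans the normal fan of a polytope. -/
theorem exists_polytope_normalFan (hv : IsFanFamily v cross) (hh : IsExchangeHeight v cross h) :
    ∃ P : Set (Module.Dual ℝ V), IsPolytope P ∧ normalFan P = noncrossingFan v cross := by
  classical
  -- One point is taken for every noncrossing set, not only for the maximal ones. The superfluous
  -- points are harmless in the convex hull, and strictness outside `S` makes them relative interior
  -- witnesses of the faces.
  choose x hxS hxlt using fun S : {S : Set D // IsNoncrossing cross S} =>
    exists_dual_tight_strict hv hh S.2
  have hxle : ∀ S d, x S (v d) ≤ h d := fun S d => by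
    by_cases hd : d ∈ S.1
    exacts [(hxS S d hd).le, (hxlt S d hd).le]
  set P := convexHull ℝ (Set.range x) with hP
  have hxP : ∀ S, x S ∈ P := fun S => subset_convexHull ℝ _ ⟨S, rfl⟩
  have hPle : ∀ y ∈ P, ∀ d, y (v d) ≤ h d := fun y hy d => by
    have : P ⊆ {y : Module.Dual ℝ V | y (v d) ≤ h d} := by
      refine convexHull_min ?_ ?_
      · rintro _ ⟨S, rfl⟩
        exact hxle S d
      · exact convex_halfSpace_le (f := fun y : Module.Dual ℝ V => y (v d))
          ⟨fun _ _ => rfl, fun _ _ => rfl⟩ _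
    exact this hy
  have hval : ∀ (y : Module.Dual ℝ V), ∀ a : D → ℝ, (∀ d ∈ Function.support a, y (v d) = h d) →
      y (Fintype.linearCombination ℝ v a) = a ⬝ᵥ h := fun y a hy => by
    rw [apply_linearCombination]
    refine Finset.sum_congr rfl fun d _ => ?_
    by_cases hd : a d = 0
    · simp [hd]
    · exact congrArg (a d * ·) (hy d hd)
  have hface : ∀ a : D → ℝ, 0 ≤ a → IsNoncrossing cross (Function.support a) →
      face P (Fintype.linearCombination ℝ v a) =
        {y ∈ P | ∀ d ∈ Function.support a, y (v d) = h d} := by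
    intro a ha hnc
    have hle : ∀ y ∈ P, y (Fintype.linearCombination ℝ v a) ≤ a ⬝ᵥ h := fun y hy => by
      rw [apply_linearCombination]
      exact Finset.sum_le_sum fun d _ => mul_le_mul_of_nonneg_left (hPle y hy d) (ha d)
    ext y
    refine ⟨fun hy => ⟨hy.1, ?_⟩, fun hy => ⟨hy.1, fun z hz => ?_⟩⟩
    · have h1 := hy.2 _ (hxP ⟨_, hnc⟩)
      rw [hval _ a (hxS ⟨_, hnc⟩)] at h1
      have h2 := le_antisymm (hle y hy.1) h1
      rw [apply_linearCombination] at h2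
      intro d hd
      have := (Finset.sum_eq_sum_iff_of_le (s := Finset.univ) (f := fun d => a d * y (v d))
        (g := fun d => a d * h d) fun d _ =>
          mul_le_mul_of_nonneg_left (hPle y hy.1 d) (ha d)).1 h2 d (Finset.mem_univ d)
      exact mul_left_cancel₀ hd this
    · rw [hval y a hy.2]
      exact hle z hz
  -- If `w` is in the normal cone, write it as a noncrossing combination `b`. The witness point of
  -- the support of `a` must then be tight on the support of `b`, which strictness confines to the
  -- support of `a`.
  have hcone : ∀ a : D → ℝ, 0 ≤ a → IsNoncrossing cross (Function.support a) →
      normalCone P (face P (Fintype.linearCombination ℝ v a)) =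
        (PointedCone.hull ℝ (v '' Function.support a) : Set V) := by
    intro a ha hnc
    ext w
    rw [SetLike.mem_coe, mem_hull_image_iff]
    constructor
    · intro hw
      obtain ⟨b, hb, hbnc, rfl⟩ := exists_noncrossing_representation hv hh w
      refine ⟨b, hb, fun d hd => ?_, rfl⟩
      by_contra hbd
      have h1 : x ⟨_, hnc⟩ ∈ face P (Fintype.linearCombination ℝ v b) := hw (by
        rw [hface a ha hnc]
        exact ⟨hxP _, hxS ⟨_, hnc⟩⟩)
      rw [hface b hb hbnc] at h1
      exact (hxlt ⟨_, hnc⟩ d hd).ne (h1.2 d hbd)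
    · rintro ⟨b, hb, hbs, rfl⟩
      have hsub : Function.support b ⊆ Function.support a := fun d hd => by
        by_contra hda
        exact hd (hbs d hda)
      change face P _ ⊆ face P _
      rw [hface a ha hnc, hface b hb (hnc.mono hsub)]
      exact fun y hy => ⟨hy.1, fun d hd => hy.2 d (hsub hd)⟩
  refine ⟨P, ⟨_, Set.finite_range x, rfl⟩, ?_⟩
  ext C
  constructor
  · rintro ⟨F, ⟨-, u, rfl⟩, rfl⟩
    obtain ⟨a, ha, hnc, rfl⟩ := exists_noncrossing_representation hv hh u
    exact ⟨_, hnc, hcone a ha hnc⟩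
  · rintro ⟨S, hS, rfl⟩
    have hsupp : Function.support (S.indicator (1 : D → ℝ)) = S := by
      simp [Set.support_indicator, Function.support_one]
    have h0 : 0 ≤ S.indicator (1 : D → ℝ) := Set.indicator_nonneg fun _ _ => zero_le_one
    have hnc : IsNoncrossing cross (Function.support (S.indicator (1 : D → ℝ))) := hsupp.symm ▸ hS
    refine ⟨face P (Fintype.linearCombination ℝ v (S.indicator 1)), ⟨⟨x ⟨S, hS⟩, ?_⟩, _, rfl⟩, ?_⟩
    · rw [hface _ h0 hnc, hsupp]
      exact ⟨hxP _, hxS ⟨S, hS⟩⟩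
    · rw [hcone _ h0 hnc, hsupp]

end ExchangeFans

/-! ### Faces and normal cones -/

section NormalFans

variable {V : Type*} [AddCommGroup V] [Module ℝ V]

theorem IsPolytope.face_nonempty {P : Set (Module.Dual ℝ V)} (hP : IsPolytope P)
    (hne : P.Nonempty) (u : V) : (face P u).Nonempty := by
  obtain ⟨s, hs, rfl⟩ := hP
  obtain ⟨x, hx, hmax⟩ := hs.exists_maximalFor (fun x : Module.Dual ℝ V => x u) s
    (convexHull_nonempty_iff.1 hne)
  refine ⟨x, subset_convexHull ℝ _ hx, fun y hy => ?_⟩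
  have : convexHull ℝ s ⊆ {y : Module.Dual ℝ V | y u ≤ x u} := by
    refine convexHull_min (fun z hz => ?_) ?_
    · exact (le_total (z u) (x u)).elim id fun h => hmax hz h
    · exact convex_halfSpace_le (f := fun y : Module.Dual ℝ V => y u)
        ⟨fun _ _ => rfl, fun _ _ => rfl⟩ _
  exact this hy

theorem normalCone_anti (P : Set (Module.Dual ℝ V)) {F G : Set (Module.Dual ℝ V)} (h : F ⊆ G) :
    normalCone P G ⊆ normalCone P F :=
  fun _ hu => h.trans hu

theorem mem_normalCone_face (P : Set (Module.Dual ℝ V)) (u : V) : u ∈ normalCone P (face P u) :=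
  Set.Subset.rfl

theorem face_zero (P : Set (Module.Dual ℝ V)) : face P (0 : V) = P := by
  ext x
  simp [face]

theorem smul_mem_normalCone {P F : Set (Module.Dual ℝ V)} {u : V} (hu : u ∈ normalCone P F)
    {t : ℝ} (ht : 0 ≤ t) : t • u ∈ normalCone P F := fun x hx =>
  ⟨(hu hx).1, fun y hy => by
    rw [map_smul, map_smul]
    exact mul_le_mul_of_nonneg_left ((hu hx).2 y hy) ht⟩

theorem subset_of_normalCone_subset {P F : Set (Module.Dual ℝ V)} {u : V}
    (h : normalCone P (face P u) ⊆ normalCone P F) : F ⊆ face P u :=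
  h (mem_normalCone_face P u)

end NormalFans

/-! ### Facets of a polytope and isomorphisms of fans, read off the rays -/

section FanFamilies

variable {D V : Type*} [AddCommGroup V] [Module ℝ V]

theorem mem_hull_singleton_image_iff (v : D → V) (d : D) (u : V) :
    u ∈ PointedCone.hull ℝ (v '' {d}) ↔ ∃ t : ℝ, 0 ≤ t ∧ t • v d = u := by
  rw [Set.image_singleton]
  constructor
  · intro h
    obtain ⟨t, rfl⟩ := Submodule.mem_span_singleton.1 h
    exact ⟨t, t.2, rfl⟩
  · rintro ⟨t, ht, rfl⟩
    exact Submodule.mem_span_singleton.2 ⟨⟨t, ht⟩, rfl⟩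

variable [Fintype D] {v : D → V} {cross : D → D → Prop}

theorem isNoncrossing_singleton (hv : IsFanFamily v cross) (d : D) :
    IsNoncrossing cross {d} := by
  rintro _ rfl _ rfl
  exact hv.irrefl _

/-- Uniqueness of coefficients compares the representation inside the cone with the one given by `d`
alone. This is how cones recover the sets that span them. -/
theorem IsFanFamily.mem_of_smul_mem_hull (hv : IsFanFamily v cross) {S : Set D}
    (hS : IsNoncrossing cross S) {d : D} {t : ℝ} (ht : 0 < t)
    (h : t • v d ∈ PointedCone.hull ℝ (v '' S)) : d ∈ S := by
  classical
  obtain ⟨a, ha, haS, hav⟩ := (mem_hull_image_iff v S _).1 h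
  have hsupp : Function.support a ⊆ S := fun e he => by
    by_contra heS
    exact he (haS e heS)
  have := hv.unique a (Pi.single d t) ha (Pi.single_nonneg.2 ht.le) (hS.mono hsupp)
    ((isNoncrossing_singleton hv d).mono Pi.support_single_subset)
    (by rw [hav, Fintype.linearCombination_apply_single])
  refine hsupp ?_
  rw [this]
  simpa using ht.ne'

theorem IsFanFamily.mem_of_mem_hull (hv : IsFanFamily v cross) {S : Set D}
    (hS : IsNoncrossing cross S) {d : D} (h : v d ∈ PointedCone.hull ℝ (v '' S)) : d ∈ S :=
  hv.mem_of_smul_mem_hull hS one_pos (by rwa [one_smul])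

theorem IsFanFamily.ne_zero (hv : IsFanFamily v cross) (d : D) : v d ≠ 0 := fun h => by
  have : d ∈ (∅ : Set D) := hv.mem_of_mem_hull (fun _ h => h.elim) (by rw [h]; exact zero_mem _)
  exact this

theorem IsFanFamily.eq_of_smul_eq (hv : IsFanFamily v cross) {d e : D} {t r : ℝ} (ht : 0 < t)
    (hr : 0 ≤ r) (h : t • v d = r • v e) : d = e :=
  hv.mem_of_smul_mem_hull (isNoncrossing_singleton hv e) ht
    ((mem_hull_singleton_image_iff v e _).2 ⟨r, hr, h.symm⟩)

/-- If the normal fan of a polytope is spanned by a family of vectors, then these are the normal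
vectors of its facets. -/
theorem IsFanFamily.bijOn_facets (hv : IsFanFamily v cross) {P : Set (Module.Dual ℝ V)}
    (hP : IsPolytope P) (hfan : normalFan P = noncrossingFan v cross) :
    Set.BijOn (face P) (Set.range v) (facets P) := by
  have hempty : (PointedCone.hull ℝ (v '' (∅ : Set D)) : Set V) ∈ normalFan P := by
    rw [hfan]
    exact ⟨∅, fun _ h => h.elim, rfl⟩
  have hne : P.Nonempty := by
    obtain ⟨F, ⟨⟨x, hx⟩, u, rfl⟩, -⟩ := hempty
    exact ⟨x, hx.1⟩
  have hmem : ∀ u, face P u ∈ faces P := fun u => ⟨hP.face_nonempty hne u, u, rfl⟩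
  have hPzero : normalCone P P = ({0} : Set V) := by
    obtain ⟨F, ⟨-, u, rfl⟩, hF⟩ := hempty
    refine Set.Subset.antisymm ?_ ?_
    · refine (normalCone_anti P (fun x hx => hx.1 : face P u ⊆ P)).trans ?_
      rw [hF]
      simp
    · rintro _ rfl
      change P ⊆ face P 0
      rw [face_zero]
  -- The ray belongs to the fan, hence is the normal cone of some face `F`. As it contains `v d`,
  -- that face lies in `face P (v d)`, whose normal cone is therefore no larger than the ray.
  have hray : ∀ d, normalCone P (face P (v d)) = (PointedCone.hull ℝ (v '' {d}) : Set V) := by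
    intro d
    have h1 : (PointedCone.hull ℝ (v '' {d}) : Set V) ∈ normalFan P := by
      rw [hfan]
      exact ⟨_, isNoncrossing_singleton hv d, rfl⟩
    obtain ⟨F, hF, hFd⟩ := h1
    refine Set.Subset.antisymm ?_ ?_
    · rw [← hFd]
      refine normalCone_anti P ?_
      have : v d ∈ normalCone P F := by
        rw [hFd]
        exact (mem_hull_singleton_image_iff v d _).2 ⟨1, zero_le_one, one_smul _ _⟩
      exact this
    · intro u hu
      obtain ⟨t, ht, rfl⟩ := (mem_hull_singleton_image_iff v d u).1 hu
      exact smul_mem_normalCone (mem_normalCone_face P _) ht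
  have hproper : ∀ u : V, u ≠ 0 → face P u ≠ P := fun u hu h => by
    have := mem_normalCone_face P u
    rw [h, hPzero] at this
    exact hu this
  -- The normal cone of a proper face is not `{0}`, so it is spanned by a nonempty set. Every proper
  -- face is thus contained in some `face P (v d)`.
  have hcone : ∀ G ∈ faces P, G ≠ P → ∃ d, v d ∈ normalCone P G := by
    intro G hG hGP
    have h1 : normalCone P G ∈ normalFan P := ⟨G, hG, rfl⟩
    rw [hfan] at h1
    obtain ⟨S, hS, hGS⟩ := h1
    rcases S.eq_empty_or_nonempty with rfl | ⟨d, hd⟩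
    · exfalso
      obtain ⟨-, u, rfl⟩ := hG
      refine hGP (Set.Subset.antisymm (fun x hx => hx.1) ?_)
      refine subset_of_normalCone_subset ?_
      rw [hGS, hPzero]
      simp
    · refine ⟨d, ?_⟩
      rw [hGS]
      exact Submodule.subset_span ⟨d, hd, rfl⟩
  have hfacet : ∀ d, face P (v d) ∈ facets P := by
    intro d
    refine ⟨⟨hmem _, hproper _ (hv.ne_zero d)⟩, ?_⟩
    rintro G ⟨hG, hGP⟩ hle
    obtain ⟨e, he⟩ := hcone G hG hGP
    have h1 : v e ∈ normalCone P (face P (v d)) := normalCone_anti P hle he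
    rw [hray] at h1
    have h2 : e = d := hv.mem_of_mem_hull (isNoncrossing_singleton hv d) h1
    rw [← h2]
    exact he
  refine ⟨?_, ?_, ?_⟩
  · rintro _ ⟨d, rfl⟩
    exact hfacet d
  · rintro _ ⟨d, rfl⟩ _ ⟨e, rfl⟩ hde
    have h1 := mem_normalCone_face P (v d)
    rw [hde, hray] at h1
    rw [show d = e from hv.mem_of_mem_hull (isNoncrossing_singleton hv e) h1]
  · intro F hF
    obtain ⟨d, hd⟩ := hcone F hF.1.1 hF.1.2
    refine ⟨v d, ⟨d, rfl⟩, ?_⟩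
    have hF' : Maximal (fun G => G ∈ faces P ∧ G ≠ P) F := hF
    exact (hF'.eq_of_subset (hfacet d).1 hd).symm

variable {D' W : Type*} [Fintype D'] [AddCommGroup W] [Module ℝ W] {w : D' → W}
  {cross' : D' → D' → Prop}

theorem isNoncrossing_pair (hv : IsFanFamily v cross) (hsymm : ∀ d e, cross d e → cross e d)
    {d e : D} (h : ¬ cross d e) : IsNoncrossing cross {d, e} := by
  rintro a (rfl | rfl) b (rfl | rfl)
  exacts [hv.irrefl _, h, fun h' => h (hsymm _ _ h'), hv.irrefl _]

/-- A linear isomorphism of fans permutes the rays, and it respects crossings. -/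
theorem exists_map_of_image_noncrossingFan (hv : IsFanFamily v cross) (hw : IsFanFamily w cross')
    (hsymm : ∀ d e, cross d e → cross e d) (hsymm' : ∀ d e, cross' d e → cross' e d)
    (f : V ≃ₗ[ℝ] W)
    (hf : (fun C : Set V => f '' C) '' noncrossingFan v cross = noncrossingFan w cross') :
    ∃ (π : D → D') (c : D → ℝ), (∀ d, 0 < c d) ∧ (∀ d, f (v d) = c d • w (π d)) ∧
      ∀ d e, cross' (π d) (π e) ↔ cross d e := by
  have hfan : ∀ S, IsNoncrossing cross S → ∃ S', IsNoncrossing cross' S' ∧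
      f '' (PointedCone.hull ℝ (v '' S) : Set V) = (PointedCone.hull ℝ (w '' S') : Set W) := by
    intro S hS
    have : f '' (PointedCone.hull ℝ (v '' S) : Set V) ∈ noncrossingFan w cross' := by
      rw [← hf]
      exact ⟨_, ⟨S, hS, rfl⟩, rfl⟩
    exact this
  have hray : ∀ d, ∃ e, ∃ c : ℝ, 0 < c ∧ f (v d) = c • w e := by
    intro d
    obtain ⟨S', hS', hfd⟩ := hfan {d} (isNoncrossing_singleton hv d)
    have h1 : f (v d) ∈ (PointedCone.hull ℝ (w '' S') : Set W) := by
      rw [← hfd]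
      exact ⟨v d, (mem_hull_singleton_image_iff v d _).2 ⟨1, zero_le_one, one_smul _ _⟩, rfl⟩
    rcases S'.eq_empty_or_nonempty with rfl | ⟨e, he⟩
    · exfalso
      refine hv.ne_zero d (f.map_eq_zero_iff.1 ?_)
      simpa using h1
    · have h2 : w e ∈ f '' (PointedCone.hull ℝ (v '' {d}) : Set V) := by
        rw [hfd]
        exact Submodule.subset_span ⟨e, he, rfl⟩
      obtain ⟨u, hu, hue⟩ := h2
      obtain ⟨t, ht, rfl⟩ := (mem_hull_singleton_image_iff v d u).1 hu
      rw [map_smul] at hue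
      have ht0 : t ≠ 0 := by
        rintro rfl
        exact hw.ne_zero e (by rw [← hue, zero_smul])
      exact ⟨e, t⁻¹, inv_pos.2 (lt_of_le_of_ne ht ht0.symm), by
        rw [← hue, inv_smul_smul₀ ht0]⟩
  choose π c hc hfv using hray
  -- Two elements do not cross if and only if their rays lie in a common cone of the fan, a property
  -- preserved by `f` in both directions.
  refine ⟨π, c, hc, hfv, fun d e => not_iff_not.1 ⟨fun h => ?_, fun h => ?_⟩⟩
  · have h1 : (PointedCone.hull ℝ (w '' {π d, π e}) : Set W) ∈
        (fun C : Set V => f '' C) '' noncrossingFan v cross := by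
      rw [hf]
      exact ⟨_, isNoncrossing_pair hw hsymm' h, rfl⟩
    obtain ⟨_, ⟨S, hS, rfl⟩, hSw⟩ := h1
    have hmem : ∀ a, π a ∈ ({π d, π e} : Set D') → a ∈ S := by
      intro a ha
      have h2 : f (v a) ∈ f '' (PointedCone.hull ℝ (v '' S) : Set V) := by
        change f (v a) ∈ (fun C : Set V => f '' C) _
        rw [hSw, hfv]
        exact Submodule.smul_mem _ (⟨c a, (hc a).le⟩ : {c : ℝ // 0 ≤ c})
          (Submodule.subset_span ⟨_, ha, rfl⟩)
      exact hv.mem_of_mem_hull hS (f.injective.mem_set_image.1 h2)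
    exact hS d (hmem d (by simp)) e (hmem e (by simp))
  · obtain ⟨S', hS', hfd⟩ := hfan {d, e} (isNoncrossing_pair hv hsymm h)
    have hmem : ∀ a ∈ ({d, e} : Set D), π a ∈ S' := by
      intro a ha
      have h2 : f (v a) ∈ (PointedCone.hull ℝ (w '' S') : Set W) := by
        rw [← hfd]
        exact ⟨v a, Submodule.subset_span ⟨a, ha, rfl⟩, rfl⟩
      rw [hfv] at h2
      exact hw.mem_of_smul_mem_hull hS' (hc a) h2
    exact hS' _ (hmem d (by simp)) _ (hmem e (by simp))

end FanFamilies

/-! ### Combinatorial model: almost positive roots and their crossings -/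

section RootIndices

/-- Indices of the almost positive roots: the intervals `[i, j]` index the sums
`α i + ⋯ + α j`, and the numbers `k` index the vectors `-α k`. -/
abbrev RootIndex (n : ℕ) : Type := {p : Fin n × Fin n // p.1 ≤ p.2} ⊕ Fin n

/-- The intervals `[i, j]` and `[k, l]` with `i < k` are incompatible with respect to the signs `s`,
where `s k` is the sign of the gap between `k - 1` and `k`. -/
def IntervalCross (s : ℕ → ℤˣ) (i j k l : ℕ) : Prop :=
  i < k ∧ ((j < l ∧ k ≤ j + 1 ∧ s k = s (j + 1)) ∨ (l < j ∧ s k ≠ s (l + 1)))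

/-- The incompatibility relation on almost positive roots determined by the signs `s`. -/
def RootCross {n : ℕ} (s : ℕ → ℤˣ) : RootIndex n → RootIndex n → Prop
  | .inl p, .inl q => IntervalCross s p.1.1 p.1.2 q.1.1 q.1.2 ∨
      IntervalCross s q.1.1 q.1.2 p.1.1 p.1.2
  | .inl p, .inr k => p.1.1 ≤ k ∧ k ≤ p.1.2
  | .inr k, .inl p => p.1.1 ≤ k ∧ k ≤ p.1.2
  | .inr _, .inr _ => False

theorem RootCross.symm {n : ℕ} {s : ℕ → ℤˣ} (d e : RootIndex n) (h : RootCross s d e) :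
    RootCross s e d := by
  rcases d with p | k <;> rcases e with q | l
  exacts [h.elim Or.inr Or.inl, h, h, h]

theorem RootCross.irrefl {n : ℕ} (s : ℕ → ℤˣ) (d : RootIndex n) : ¬ RootCross s d d := by
  rcases d with p | k
  · rintro (h | h) <;> exact lt_irrefl _ h.1
  · exact id

variable {V : Type*} [AddCommGroup V] {n : ℕ}

/-- The almost positive root with a given index. -/
def rootVector (α : Fin n → V) : RootIndex n → V
  | .inl p => ∑ k ∈ Finset.Icc p.1.1 p.1.2, α k
  | .inr k => -α k

/-- The sum of the first `m` vectors of a family. -/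
def initialSum (α : Fin n → V) (m : ℕ) : V :=
  ∑ k ∈ Finset.univ.filter (fun k : Fin n => k.val < m), α k

theorem sum_Icc_eq_initialSum_sub (α : Fin n → V) {i j : Fin n} (hij : i ≤ j) :
    ∑ k ∈ Finset.Icc i j, α k = initialSum α (j + 1) - initialSum α i := by
  unfold initialSum
  have hij' : i.val ≤ j.val := hij
  rw [← Finset.sum_sdiff_eq_sub]
  · refine Finset.sum_congr ?_ fun _ _ => rfl
    ext k
    simp only [Finset.mem_Icc, Finset.mem_sdiff, Finset.mem_filter, Finset.mem_univ, true_and,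
      Fin.le_def]
    omega
  · intro k
    simp only [Finset.mem_filter, Finset.mem_univ, true_and]
    omega

theorem rootVector_inl (α : Fin n → V) (p : {p : Fin n × Fin n // p.1 ≤ p.2}) :
    rootVector α (.inl p) = initialSum α (p.1.2 + 1) - initialSum α p.1.1 :=
  sum_Icc_eq_initialSum_sub α p.2

theorem rootVector_inr (α : Fin n → V) (k : Fin n) :
    rootVector α (.inr k) = initialSum α k - initialSum α (k + 1) := by
  have := sum_Icc_eq_initialSum_sub α (le_refl k)
  rw [Finset.Icc_self, Finset.sum_singleton] at this
  rw [rootVector, this, neg_sub]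

variable [Module ℝ V]

theorem repr_rootVector_inl (b : Module.Basis (Fin n) ℝ V) (p : {p : Fin n × Fin n // p.1 ≤ p.2})
    (k : Fin n) :
    b.repr (rootVector b (.inl p)) k = if p.1.1 ≤ k ∧ k ≤ p.1.2 then 1 else 0 := by
  simp [rootVector, Finsupp.single_apply, Finset.mem_Icc]

theorem repr_rootVector_inr (b : Module.Basis (Fin n) ℝ V) (l k : Fin n) :
    b.repr (rootVector b (.inr l)) k = if l = k then -1 else 0 := by
  simp only [rootVector, map_neg, Module.Basis.repr_self, Finsupp.neg_apply, Finsupp.single_apply]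
  split_ifs <;> simp

end RootIndices

/-! ### An explicit exchange height -/

section Height

/-- A height function on the almost positive roots with the exchange property. -/
noncomputable def rootHeight {n : ℕ} (s : ℕ → ℤˣ) : RootIndex n → ℝ
  | .inl p => 4 - (((s p.1.1 : ℤ) : ℝ) * 2 ^ p.1.1.val) * (((s (p.1.2 + 1) : ℤ) : ℝ) / 2 ^ p.1.2.val)
  | .inr _ => 10

theorem rootHeight_inl_bounds {n : ℕ} (s : ℕ → ℤˣ) (p : {p : Fin n × Fin n // p.1 ≤ p.2}) :
    3 ≤ rootHeight s (.inl p) ∧ rootHeight s (.inl p) ≤ 5 := by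
  have h1 : (2 : ℝ) ^ p.1.1.val / 2 ^ p.1.2.val ≤ 1 := by
    rw [div_le_one (by positivity)]
    exact pow_le_pow_right₀ one_le_two p.2
  have h2 : (0 : ℝ) < 2 ^ p.1.1.val / 2 ^ p.1.2.val := by positivity
  have h3 : rootHeight s (.inl p) = 4 - ((s p.1.1 : ℤ) : ℝ) * ((s (p.1.2 + 1) : ℤ) : ℝ) *
      (2 ^ p.1.1.val / 2 ^ p.1.2.val) := by
    rw [rootHeight]
    ring
  rw [h3]
  rcases Int.units_eq_one_or (s p.1.1) with h4 | h4 <;>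
    rcases Int.units_eq_one_or (s (p.1.2 + 1)) with h5 | h5 <;> rw [h4, h5] <;> push_cast <;>
    constructor <;> linarith

/-- The larger power of two dominates, so the sign of the difference is `s k`. -/
theorem sign_mul_pow_sub_pos (s : ℕ → ℤˣ) {i k : ℕ} (h : i < k) :
    0 < ((s k : ℤ) : ℝ) * (((s k : ℤ) : ℝ) * 2 ^ k - ((s i : ℤ) : ℝ) * 2 ^ i) := by
  have h1 : (2 : ℝ) ^ i < 2 ^ k := pow_lt_pow_right₀ one_lt_two h
  have h2 : (0 : ℝ) < 2 ^ i := by positivity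
  rcases Int.units_eq_one_or (s k) with h4 | h4 <;>
    rcases Int.units_eq_one_or (s i) with h5 | h5 <;> rw [h4, h5] <;> push_cast <;> linarith

theorem sign_mul_div_pow_sub_pos (s : ℕ → ℤˣ) {j l : ℕ} (h : j < l) :
    0 < ((s (j + 1) : ℤ) : ℝ) *
      (((s (j + 1) : ℤ) : ℝ) / 2 ^ j - ((s (l + 1) : ℤ) : ℝ) / 2 ^ l) := by
  have h1 : (1 : ℝ) / 2 ^ l < 1 / 2 ^ j :=
    one_div_lt_one_div_of_lt (by positivity) (pow_lt_pow_right₀ one_lt_two h)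
  have h2 : (0 : ℝ) < 1 / 2 ^ l := by positivity
  rw [div_eq_mul_one_div _ ((2 : ℝ) ^ j), div_eq_mul_one_div _ ((2 : ℝ) ^ l)]
  rcases Int.units_eq_one_or (s (j + 1)) with h4 | h4 <;>
    rcases Int.units_eq_one_or (s (l + 1)) with h5 | h5 <;> rw [h4, h5] <;> push_cast <;> linarith

/-- Overlapping or nested intervals are exchanged for `[i, l]` and `[k, j]`. With `x i = s i * 2 ^
i` and `y j = s (j + 1) / 2 ^ j`, the height of `[i, j]` is `4 - x i * y j`, so the cost drops by
`(x k - x i) * (y j - y l)`. The first factor has the sign `s k`; the second has the sign `s (j +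
1)` if `j < l` and `-s (l + 1)` if `l < j`. Crossing says exactly that the two factors have equal
signs. Adjacent intervals merge into one, which is cheaper since all these heights lie between `3`
and `5`. -/
theorem exchange_of_intervalCross {V : Type*} [AddCommGroup V] [Module ℝ V] {n : ℕ} (α : Fin n → V)
    (s : ℕ → ℤˣ) (p q : {p : Fin n × Fin n // p.1 ≤ p.2})
    (h : IntervalCross s p.1.1 p.1.2 q.1.1 q.1.2) :
    ∃ m : RootIndex n → ℝ, 0 ≤ m ∧ Fintype.linearCombination ℝ (rootVector α) m =
      rootVector α (.inl p) + rootVector α (.inl q) ∧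
      m ⬝ᵥ rootHeight s < rootHeight s (.inl p) + rootHeight s (.inl q) := by
  obtain ⟨⟨i, j⟩, hij⟩ := p
  obtain ⟨⟨k, l⟩, hkl⟩ := q
  obtain ⟨hik, hcase⟩ := h
  dsimp only at hij hkl hik hcase
  have hil : i ≤ l := hik.le.trans hkl
  have hsingle : ∀ d : RootIndex n, (0 : RootIndex n → ℝ) ≤ Pi.single d 1 := fun d =>
    Pi.single_nonneg.2 zero_le_one
  by_cases hkj : k ≤ j
  · refine ⟨Pi.single (.inl ⟨(i, l), hil⟩) 1 + Pi.single (.inl ⟨(k, j), hkj⟩) 1,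
      add_nonneg (hsingle _) (hsingle _), ?_, ?_⟩
    · simp only [map_add, Fintype.linearCombination_apply_single, one_smul, rootVector_inl]
      abel
    · simp only [add_dotProduct, single_dotProduct, one_mul, rootHeight]
      have h1 := sign_mul_pow_sub_pos s hik
      rcases hcase with ⟨hjl, -, hs⟩ | ⟨hlj, hs⟩
      · have h2 := sign_mul_div_pow_sub_pos s hjl
        rw [← hs] at h2 ⊢
        rcases Int.units_eq_one_or (s k) with h4 | h4 <;> rw [h4] at h1 h2 ⊢ <;>
          push_cast at h1 h2 ⊢ <;> nlinarith [mul_pos h1 h2]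
      · have h2 := sign_mul_div_pow_sub_pos s hlj
        have hs' : s (l + 1) = -s k := by
          rcases Int.units_eq_one_or (s k) with h4 | h4 <;>
            rcases Int.units_eq_one_or (s (l + 1)) with h5 | h5 <;> simp_all
        rw [hs'] at h2 ⊢
        rcases Int.units_eq_one_or (s k) with h4 | h4 <;> rw [h4] at h1 h2 ⊢ <;>
          push_cast at h1 h2 ⊢ <;> nlinarith [mul_pos h1 h2]
  · have hkj' : k.val = j.val + 1 := by
      have : j.val < k.val := not_le.1 hkj
      have : k.val ≤ l.val := hkl
      omega
    refine ⟨Pi.single (.inl ⟨(i, l), hil⟩) 1, hsingle _, ?_, ?_⟩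
    · simp only [Fintype.linearCombination_apply_single, one_smul, rootVector_inl, hkj']
      abel
    · simp only [single_dotProduct, one_mul]
      have h1 := (rootHeight_inl_bounds s ⟨(i, l), hil⟩).2
      have h2 := (rootHeight_inl_bounds s ⟨(i, j), hij⟩).1
      have h3 := (rootHeight_inl_bounds s ⟨(k, l), hkl⟩).1
      linarith

/-- Removing `α k` from an interval leaves at most two intervals, of total height at most `10`; the
pair replaced costs at least `3 + 10`. -/
theorem exchange_of_mem_Icc {V : Type*} [AddCommGroup V] [Module ℝ V] {n : ℕ} (α : Fin n → V)
    (s : ℕ → ℤˣ) (p : {p : Fin n × Fin n // p.1 ≤ p.2}) (k : Fin n)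
    (h : p.1.1 ≤ k ∧ k ≤ p.1.2) :
    ∃ m : RootIndex n → ℝ, 0 ≤ m ∧ Fintype.linearCombination ℝ (rootVector α) m =
      rootVector α (.inl p) + rootVector α (.inr k) ∧
      m ⬝ᵥ rootHeight s < rootHeight s (.inl p) + rootHeight s (.inr k) := by
  obtain ⟨⟨i, j⟩, hij⟩ := p
  obtain ⟨hik, hkj⟩ := h
  dsimp only at hij hik hkj
  have hleft : ∃ m : RootIndex n → ℝ, 0 ≤ m ∧ Fintype.linearCombination ℝ (rootVector α) m =
      initialSum α k - initialSum α i ∧ m ⬝ᵥ rootHeight s ≤ 5 := by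
    by_cases hi : i = k
    · exact ⟨0, le_rfl, by simp [hi], by simp⟩
    · have hlt : i.val < k.val := lt_of_le_of_ne hik (Fin.val_ne_of_ne hi)
      have hle : i ≤ (⟨k.val - 1, by omega⟩ : Fin n) := by
        rw [Fin.le_def]; dsimp only; omega
      refine ⟨Pi.single (.inl ⟨(i, ⟨k.val - 1, by omega⟩), hle⟩) 1,
        Pi.single_nonneg.2 zero_le_one, ?_, ?_⟩
      · simp only [Fintype.linearCombination_apply_single, one_smul, rootVector_inl]
        rw [show k.val - 1 + 1 = k.val by omega]
      · simp only [single_dotProduct, one_mul]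
        exact (rootHeight_inl_bounds s _).2
  have hright : ∃ m : RootIndex n → ℝ, 0 ≤ m ∧ Fintype.linearCombination ℝ (rootVector α) m =
      initialSum α (j + 1) - initialSum α (k + 1) ∧ m ⬝ᵥ rootHeight s ≤ 5 := by
    by_cases hi : k = j
    · exact ⟨0, le_rfl, by simp [hi], by simp⟩
    · have hlt : k.val < j.val := lt_of_le_of_ne hkj (Fin.val_ne_of_ne hi)
      have hle : (⟨k.val + 1, by omega⟩ : Fin n) ≤ j := by
        rw [Fin.le_def]; dsimp only; omega
      refine ⟨Pi.single (.inl ⟨(⟨k.val + 1, by omega⟩, j), hle⟩) 1,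
        Pi.single_nonneg.2 zero_le_one, ?_, ?_⟩
      · simp only [Fintype.linearCombination_apply_single, one_smul, rootVector_inl]
      · simp only [single_dotProduct, one_mul]
        exact (rootHeight_inl_bounds s _).2
  obtain ⟨m₁, h1, h2, h3⟩ := hleft
  obtain ⟨m₂, h4, h5, h6⟩ := hright
  refine ⟨m₁ + m₂, add_nonneg h1 h4, ?_, ?_⟩
  · rw [map_add, h2, h5, rootVector_inl, rootVector_inr]
    abel
  · rw [add_dotProduct]
    have h7 := (rootHeight_inl_bounds s ⟨(i, j), hij⟩).1
    have h8 : rootHeight s (.inr k : RootIndex n) = 10 := rfl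
    linarith

theorem isExchangeHeight_rootHeight {V : Type*} [AddCommGroup V] [Module ℝ V] {n : ℕ}
    (α : Fin n → V) (s : ℕ → ℤˣ) :
    IsExchangeHeight (rootVector α) (RootCross s) (rootHeight s) where
  pos d := by
    rcases d with p | k
    · linarith [(rootHeight_inl_bounds s p).1]
    · norm_num [rootHeight]
  exchange d e h := by
    rcases d with p | k <;> rcases e with q | l
    · rcases h with h | h
      · exact exchange_of_intervalCross α s p q h
      · obtain ⟨m, h1, h2, h3⟩ := exchange_of_intervalCross α s q p h
        exact ⟨m, h1, by rw [h2, add_comm], by linarith⟩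
    · exact exchange_of_mem_Icc α s p l h
    · obtain ⟨m, h1, h2, h3⟩ := exchange_of_mem_Icc α s q k h
      exact ⟨m, h1, by rw [h2, add_comm], by linarith⟩
    · exact h.elim

end Height

/-! ### Uniqueness of noncrossing combinations -/

section Uniqueness

/-- One step of the recovery of a noncrossing family of intervals from its coordinates. -/
theorem coeff_ending_eq_of_tails_eq {n : ℕ} {s : ℕ → ℤˣ} {a b : ℕ → ℕ → ℝ} (ha : ∀ i j, 0 ≤ a i j)
    (hb : ∀ i j, 0 ≤ b i j)
    (hna : ∀ i j k l, i ≤ j → k ≤ l → j < n → l < n → a i j ≠ 0 → a k l ≠ 0 →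
      ¬ IntervalCross s i j k l)
    (hnb : ∀ i j k l, i ≤ j → k ≤ l → j < n → l < n → b i j ≠ 0 → b k l ≠ 0 →
      ¬ IntervalCross s i j k l)
    (hab : ∀ k < n, ∑ i ∈ Finset.range (k + 1), ∑ l ∈ Finset.Ico k n, a i l =
      ∑ i ∈ Finset.range (k + 1), ∑ l ∈ Finset.Ico k n, b i l)
    {j : ℕ} (hj : j < n)
    (hA : ∀ i ≤ j, ∑ l ∈ Finset.Ico j n, a i l = ∑ l ∈ Finset.Ico j n, b i l) :
    ∀ i ≤ j, a i j = b i j := by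
  rcases Nat.lt_or_ge (j + 1) n with hj1 | hj1
  swap
  · intro i hi
    have := hA i hi
    rwa [show n = j + 1 by omega, Nat.Ico_succ_singleton, Finset.sum_singleton,
      Finset.sum_singleton] at this
  have hsplit : ∀ (c : ℕ → ℕ → ℝ) i, ∑ l ∈ Finset.Ico j n, c i l =
      c i j + ∑ l ∈ Finset.Ico (j + 1) n, c i l := fun c i =>
    Finset.sum_eq_sum_Ico_succ_bot hj _
  -- Balance between consecutive coordinates: passing from `j` to `j + 1` loses the intervals ending
  -- at `j` and gains those starting at `j + 1`.
  have htot : ∀ c : ℕ → ℕ → ℝ,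
      ∑ i ∈ Finset.range (j + 1 + 1), ∑ l ∈ Finset.Ico (j + 1) n, c i l +
        ∑ i ∈ Finset.range (j + 1), c i j =
      ∑ i ∈ Finset.range (j + 1), ∑ l ∈ Finset.Ico j n, c i l +
        ∑ l ∈ Finset.Ico (j + 1) n, c (j + 1) l := by
    intro c
    rw [Finset.sum_range_succ _ (j + 1), Finset.sum_congr rfl fun i _ => hsplit c i,
      Finset.sum_add_distrib]
    ring
  have hzero : ∀ c : ℕ → ℕ → ℝ, (∀ i j, 0 ≤ c i j) →
      (∀ i j k l, i ≤ j → k ≤ l → j < n → l < n → c i j ≠ 0 → c k l ≠ 0 →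
        ¬ IntervalCross s i j k l) →
      ∑ i ∈ Finset.range (j + 1), c i j = 0 ∨ ∑ l ∈ Finset.Ico (j + 1) n, c (j + 1) l = 0 := by
    intro c _ hnc
    by_contra! hne
    obtain ⟨i, hi, hi0⟩ := Finset.exists_ne_zero_of_sum_ne_zero hne.1
    obtain ⟨l, hl, hl0⟩ := Finset.exists_ne_zero_of_sum_ne_zero hne.2
    rw [Finset.mem_range] at hi
    rw [Finset.mem_Ico] at hl
    exact hnc i j (j + 1) l (by omega) hl.1 hj hl.2 hi0 hl0
      ⟨hi, Or.inl ⟨hl.1, le_rfl, rfl⟩⟩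
  -- An interval ending at `j` crosses every interval starting at `j + 1`, so one of the two totals
  -- vanishes. Both are then the positive and negative parts of a known difference of coordinates.
  have hsum : ∑ i ∈ Finset.range (j + 1), a i j = ∑ i ∈ Finset.range (j + 1), b i j := by
    have h1 := htot a
    have h2 := htot b
    rw [hab _ hj1, hab _ hj] at h1
    have h3 : 0 ≤ ∑ i ∈ Finset.range (j + 1), a i j := Finset.sum_nonneg fun i _ => ha i j
    have h4 : 0 ≤ ∑ i ∈ Finset.range (j + 1), b i j := Finset.sum_nonneg fun i _ => hb i j
    have h5 : 0 ≤ ∑ l ∈ Finset.Ico (j + 1) n, a (j + 1) l := Finset.sum_nonneg fun l _ => ha _ l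
    have h6 : 0 ≤ ∑ l ∈ Finset.Ico (j + 1) n, b (j + 1) l := Finset.sum_nonneg fun l _ => hb _ l
    rcases hzero a ha hna with h7 | h7 <;> rcases hzero b hb hnb with h8 | h8 <;> linarith
  have hpos : ∀ (c : ℕ → ℕ → ℝ) i, 0 < ∑ l ∈ Finset.Ico (j + 1) n, c i l →
      ∃ l, j < l ∧ l < n ∧ c i l ≠ 0 := fun c i h => by
    obtain ⟨l, hl, hl0⟩ := Finset.exists_ne_zero_of_sum_ne_zero h.ne'
    rw [Finset.mem_Ico] at hl
    exact ⟨l, hl.1, hl.2, hl0⟩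
  -- With equal tails, opposite deviations force `a` to use some `[i, l]` and `[k, j]`, and `b` to
  -- use `[i, j]` and some `[k, l']`, with `l, l' > j`. For `i < k`, one of these pairs crosses,
  -- according to whether `s k = s (j + 1)`. So all deviations have one sign, and the equal sums
  -- make them zero.
  have hexcl : ∀ i ≤ j, ∀ k ≤ j, ¬ (a i j < b i j ∧ b k j < a k j) := by
    rintro i hi k hk ⟨h1, h2⟩
    have h3 : 0 < ∑ l ∈ Finset.Ico (j + 1) n, a i l := by
      have h4 := hA i hi
      rw [hsplit, hsplit] at h4
      have h5 : 0 ≤ ∑ l ∈ Finset.Ico (j + 1) n, b i l := Finset.sum_nonneg fun l _ => hb _ l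
      linarith
    have h4 : 0 < ∑ l ∈ Finset.Ico (j + 1) n, b k l := by
      have h4 := hA k hk
      rw [hsplit, hsplit] at h4
      have h5 : 0 ≤ ∑ l ∈ Finset.Ico (j + 1) n, a k l := Finset.sum_nonneg fun l _ => ha _ l
      linarith
    obtain ⟨l, hl, hln, hl0⟩ := hpos a i h3
    obtain ⟨l', hl', hln', hl0'⟩ := hpos b k h4
    have hak : a k j ≠ 0 := ((hb k j).trans_lt h2).ne'
    have hbi : b i j ≠ 0 := ((ha i j).trans_lt h1).ne'
    rcases lt_trichotomy i k with hik | rfl | hik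
    · have h5 := hna i l k j (by omega) hk hln hj hl0 hak
      have h6 := hnb i j k l' hi (by omega) hj hln' hbi hl0'
      by_cases hs : s k = s (j + 1)
      · exact h6 ⟨hik, Or.inl ⟨hl', by omega, hs⟩⟩
      · exact h5 ⟨hik, Or.inr ⟨hl, hs⟩⟩
    · linarith
    · have h5 := hna k j i l hk (by omega) hj hln hak hl0
      have h6 := hnb k l' i j (by omega) hi hln' hj hl0' hbi
      by_cases hs : s i = s (j + 1)
      · exact h5 ⟨hik, Or.inl ⟨hl, by omega, hs⟩⟩
      · exact h6 ⟨hik, Or.inr ⟨hl', hs⟩⟩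
  have hmem : ∀ i ≤ j, i ∈ Finset.range (j + 1) := fun i hi => Finset.mem_range.2 (by omega)
  by_cases hex : ∃ i ≤ j, a i j < b i j
  · obtain ⟨i, hi, hlt⟩ := hex
    have hle : ∀ k ∈ Finset.range (j + 1), a k j ≤ b k j := fun k hk => by
      by_contra hk'
      exact hexcl i hi k (by rw [Finset.mem_range] at hk; omega) ⟨hlt, not_le.1 hk'⟩
    exact fun k hk => (Finset.sum_eq_sum_iff_of_le hle).1 hsum k (hmem k hk)
  · push Not at hex
    have hle : ∀ k ∈ Finset.range (j + 1), b k j ≤ a k j := fun k hk =>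
      hex k (by rw [Finset.mem_range] at hk; omega)
    exact fun k hk => ((Finset.sum_eq_sum_iff_of_le hle).1 hsum.symm k (hmem k hk)).symm

/-- A nonnegative noncrossing family of intervals is determined by its coordinates. -/
theorem interval_coeff_unique {n : ℕ} {s : ℕ → ℤˣ} {a b : ℕ → ℕ → ℝ} (ha : ∀ i j, 0 ≤ a i j)
    (hb : ∀ i j, 0 ≤ b i j)
    (hna : ∀ i j k l, i ≤ j → k ≤ l → j < n → l < n → a i j ≠ 0 → a k l ≠ 0 →
      ¬ IntervalCross s i j k l)
    (hnb : ∀ i j k l, i ≤ j → k ≤ l → j < n → l < n → b i j ≠ 0 → b k l ≠ 0 →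
      ¬ IntervalCross s i j k l)
    (hab : ∀ k < n, ∑ i ∈ Finset.range (k + 1), ∑ l ∈ Finset.Ico k n, a i l =
      ∑ i ∈ Finset.range (k + 1), ∑ l ∈ Finset.Ico k n, b i l) :
    ∀ j < n, ∀ i ≤ j, a i j = b i j := by
  have hA : ∀ j < n, ∀ i ≤ j,
      ∑ l ∈ Finset.Ico j n, a i l = ∑ l ∈ Finset.Ico j n, b i l := by
    intro j
    induction j with
    | zero =>
      intro h0 i hi
      have := hab 0 h0
      simp only [zero_add, Finset.sum_range_one] at this
      rwa [Nat.le_zero.1 hi]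
    | succ j ih =>
      intro hj
      have hA := ih (by omega)
      have heq := coeff_ending_eq_of_tails_eq ha hb hna hnb hab (by omega) hA
      have hold : ∀ i ≤ j, ∑ l ∈ Finset.Ico (j + 1) n, a i l =
          ∑ l ∈ Finset.Ico (j + 1) n, b i l := by
        intro i hi
        have h1 := hA i hi
        rw [Finset.sum_eq_sum_Ico_succ_bot (show j < n by omega) (a i),
          Finset.sum_eq_sum_Ico_succ_bot (show j < n by omega) (b i), heq i hi] at h1
        exact add_left_cancel h1
      intro i hi
      rcases Nat.lt_or_ge j i with h | h
      · obtain rfl : i = j + 1 := by omega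
        have h1 := hab (j + 1) hj
        rw [Finset.sum_range_succ, Finset.sum_range_succ _ (j + 1),
          Finset.sum_congr rfl fun i hi => hold i (by rw [Finset.mem_range] at hi; omega)] at h1
        exact add_left_cancel h1
      · exact hold i h
  exact fun j hj => coeff_ending_eq_of_tails_eq ha hb hna hnb hab hj (hA j hj)

variable {V : Type*} [AddCommGroup V] [Module ℝ V] {n : ℕ}

/-- The coefficients of the intervals, extended by zero. -/
noncomputable def intervalCoeff (a : RootIndex n → ℝ) (i j : ℕ) : ℝ :=
  if h : i ≤ j ∧ j < n then a (.inl ⟨(⟨i, h.1.trans_lt h.2⟩, ⟨j, h.2⟩), h.1⟩) else 0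

theorem intervalCoeff_val (a : RootIndex n → ℝ) (p : {p : Fin n × Fin n // p.1 ≤ p.2}) :
    intervalCoeff a p.1.1 p.1.2 = a (.inl p) :=
  dif_pos ⟨p.2, p.1.2.2⟩

theorem repr_linearCombination_rootVector (b : Module.Basis (Fin n) ℝ V) (a : RootIndex n → ℝ)
    (k : Fin n) :
    b.repr (Fintype.linearCombination ℝ (rootVector b) a) k =
      ∑ i ∈ Finset.range (k + 1), ∑ l ∈ Finset.Ico k.val n, intervalCoeff a i l - a (.inr k) := by
  rw [Fintype.linearCombination_apply, map_sum, Finsupp.finsetSum_apply, Fintype.sum_sum_type]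
  simp only [map_smul, Finsupp.smul_apply, repr_rootVector_inl, repr_rootVector_inr, smul_eq_mul,
    mul_ite, mul_one, mul_zero, mul_neg]
  rw [Finset.sum_ite_eq' Finset.univ k, if_pos (Finset.mem_univ k), sub_eq_add_neg]
  congr 1
  rw [← Finset.sum_filter, ← Finset.sum_product']
  refine Finset.sum_bij (fun p _ => (p.1.1.val, p.1.2.val)) ?_ ?_ ?_ ?_
  · intro p hp
    simp only [Finset.mem_filter, Finset.mem_univ, true_and, Fin.le_def] at hp
    simp only [Finset.mem_product, Finset.mem_range, Finset.mem_Ico]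
    omega
  · rintro p - q - hpq
    simp only [Prod.mk.injEq] at hpq
    exact Subtype.ext (Prod.ext (Fin.ext hpq.1) (Fin.ext hpq.2))
  · rintro ⟨i, l⟩ h
    simp only [Finset.mem_product, Finset.mem_range, Finset.mem_Ico] at h
    refine ⟨⟨(⟨i, by omega⟩, ⟨l, h.2.2⟩), ?_⟩, ?_, rfl⟩
    · rw [Fin.le_def]; dsimp only; omega
    · simp only [Finset.mem_filter, Finset.mem_univ, true_and, Fin.le_def]
      omega
  · intro p _
    exact (intervalCoeff_val a p).symm

theorem isFanFamily_rootVector (b : Module.Basis (Fin n) ℝ V) (s : ℕ → ℤˣ) :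
    IsFanFamily (rootVector b) (RootCross (n := n) s) where
  irrefl := RootCross.irrefl s
  spans u := by
    have hmem : u ∈ PointedCone.hull ℝ (rootVector b '' Set.univ) := by
      rw [← b.sum_repr u]
      refine Submodule.sum_mem _ fun k _ => ?_
      rcases le_total 0 (b.repr u k) with h | h
      · have : b k ∈ PointedCone.hull ℝ (rootVector b '' Set.univ) :=
          Submodule.subset_span ⟨.inl ⟨(k, k), le_rfl⟩, Set.mem_univ _, by simp [rootVector]⟩
        exact Submodule.smul_mem _ (⟨_, h⟩ : {c : ℝ // 0 ≤ c}) this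
      · have : -b k ∈ PointedCone.hull ℝ (rootVector b '' Set.univ) :=
          Submodule.subset_span ⟨.inr k, Set.mem_univ _, rfl⟩
        have h1 := Submodule.smul_mem _ (⟨_, neg_nonneg.2 h⟩ : {c : ℝ // 0 ≤ c}) this
        rw [← neg_smul_neg]
        exact h1
    obtain ⟨a, ha, -, hu⟩ := (mem_hull_image_iff _ _ _).1 hmem
    exact ⟨a, ha, hu⟩
  unique a c ha hc hna hnc hac := by
    have hnn : ∀ a : RootIndex n → ℝ, 0 ≤ a → ∀ i j, 0 ≤ intervalCoeff a i j := by
      intro a ha i j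
      unfold intervalCoeff
      split_ifs
      exacts [ha _, le_rfl]
    have hnc' : ∀ a : RootIndex n → ℝ, IsNoncrossing (RootCross s) (Function.support a) →
        ∀ i j k l, i ≤ j → k ≤ l → j < n → l < n → intervalCoeff a i j ≠ 0 →
          intervalCoeff a k l ≠ 0 → ¬ IntervalCross s i j k l := by
      intro a hna i j k l hij hkl hj hl h1 h2 h3
      rw [intervalCoeff, dif_pos ⟨hij, hj⟩] at h1
      rw [intervalCoeff, dif_pos ⟨hkl, hl⟩] at h2
      exact hna _ h1 _ h2 (Or.inl h3)
    have hdisj : ∀ a : RootIndex n → ℝ, IsNoncrossing (RootCross s) (Function.support a) →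
        ∀ k : Fin n, a (.inr k) ≠ 0 →
          ∑ i ∈ Finset.range (k + 1), ∑ l ∈ Finset.Ico k.val n, intervalCoeff a i l = 0 := by
      intro a hna k hk
      refine Finset.sum_eq_zero fun i hi => Finset.sum_eq_zero fun l hl => ?_
      rw [Finset.mem_range] at hi
      rw [Finset.mem_Ico] at hl
      by_contra hil
      rw [intervalCoeff, dif_pos ⟨by omega, hl.2⟩] at hil
      refine hna _ hk _ hil ?_
      change _ ≤ k ∧ k ≤ _
      simp only [Fin.le_def]
      omega
    have hcoord : ∀ k : Fin n,
        ∑ i ∈ Finset.range (k + 1), ∑ l ∈ Finset.Ico k.val n, intervalCoeff a i l =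
          ∑ i ∈ Finset.range (k + 1), ∑ l ∈ Finset.Ico k.val n, intervalCoeff c i l ∧
        a (.inr k) = c (.inr k) := by
      intro k
      have h1 := congrArg (fun u => b.repr u k) hac
      simp only [repr_linearCombination_rootVector] at h1
      have h2 : 0 ≤ ∑ i ∈ Finset.range (k + 1), ∑ l ∈ Finset.Ico k.val n, intervalCoeff a i l :=
        Finset.sum_nonneg fun i _ => Finset.sum_nonneg fun l _ => hnn a ha i l
      have h3 : 0 ≤ ∑ i ∈ Finset.range (k + 1), ∑ l ∈ Finset.Ico k.val n, intervalCoeff c i l :=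
        Finset.sum_nonneg fun i _ => Finset.sum_nonneg fun l _ => hnn c hc i l
      have h4 : 0 ≤ a (.inr k) := ha _
      have h5 : 0 ≤ c (.inr k) := hc _
      -- The intervals containing `k` and the vector `-α k` never occur together, so their
      -- contributions are the positive and negative parts of the `k`-th coordinate.
      by_cases h6 : a (.inr k) = 0 <;> by_cases h7 : c (.inr k) = 0
      · constructor <;> linarith
      · have := hdisj c hnc k h7
        constructor <;> linarith
      · have := hdisj a hna k h6
        constructor <;> linarith
      · have := hdisj a hna k h6
        have := hdisj c hnc k h7
        constructor <;> linarith
    have hint := interval_coeff_unique (n := n) (s := s) (hnn a ha) (hnn c hc) (hnc' a hna)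
      (hnc' c hnc) fun k hk => (hcoord ⟨k, hk⟩).1
    funext d
    rcases d with p | k
    · have := hint p.1.2 p.1.2.2 p.1.1 p.2
      rwa [intervalCoeff_val, intervalCoeff_val] at this
    · exact (hcoord k).2

end Uniqueness

/-! ### Sweeps over the polygon and the crossings of their chords -/

section Sweep

/-- The left endpoint of the `k`-th chord of a sweep over the polygon. The chords start at
`(0, n + 2)`, and one endpoint moves by one in each step: the left one if `s k = 1` (or `k = 0`),
and the right one otherwise. -/
def leftEnd (s : ℕ → ℤˣ) : ℕ → ℕ
  | 0 => 0
  | k + 1 => leftEnd s k + if k = 0 ∨ s k = 1 then 1 else 0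

theorem leftEnd_succ_of_pos (s : ℕ → ℤˣ) {k : ℕ} (h : k = 0 ∨ s k = 1) :
    leftEnd s (k + 1) = leftEnd s k + 1 := by
  rw [leftEnd, if_pos h]

theorem leftEnd_succ_of_neg (s : ℕ → ℤˣ) {k : ℕ} (h : ¬ (k = 0 ∨ s k = 1)) :
    leftEnd s (k + 1) = leftEnd s k := by
  rw [leftEnd, if_neg h, add_zero]

theorem leftEnd_one (s : ℕ → ℤˣ) : leftEnd s 1 = 1 := rfl

theorem leftEnd_bounds (s : ℕ → ℤˣ) {i k : ℕ} (h : i ≤ k) :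
    leftEnd s i ≤ leftEnd s k ∧ leftEnd s k ≤ leftEnd s i + (k - i) := by
  induction k, h using Nat.le_induction with
  | base => simp
  | succ k hik ih =>
    by_cases hk : k = 0 ∨ s k = 1
    · rw [leftEnd_succ_of_pos s hk]; omega
    · rw [leftEnd_succ_of_neg s hk]; omega

theorem leftEnd_le (s : ℕ → ℤˣ) (k : ℕ) : leftEnd s k ≤ k := by
  have := (leftEnd_bounds s (Nat.zero_le k)).2
  rw [show leftEnd s 0 = 0 from rfl] at this
  omega

theorem one_le_leftEnd (s : ℕ → ℤˣ) {k : ℕ} (hk : 1 ≤ k) : 1 ≤ leftEnd s k :=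
  (leftEnd_one s).symm.le.trans (leftEnd_bounds s hk).1

/-- The diagonal with the endpoints `a` and `b`. -/
def Diagonal.ofNat {n : ℕ} (a b : ℕ) (h : a + 2 ≤ b ∧ b ≤ n + 2 ∧ ¬ (a = 0 ∧ b = n + 2)) :
    Diagonal n :=
  ⟨(⟨a, by omega⟩, ⟨b, by omega⟩), h.1, h.2.2⟩

theorem crosses_ofNat {n a b c d : ℕ} (h h') :
    Crosses (Diagonal.ofNat (n := n) a b h) (Diagonal.ofNat c d h') ↔
      (a < c ∧ c < b ∧ b < d) ∨ (c < a ∧ a < d ∧ d < b) :=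
  Iff.rfl

/-- The diagonals of the seed triangulation of a sweep. -/
def sweepDiagonal {n : ℕ} (s : ℕ → ℤˣ) (k : Fin n) : Diagonal n :=
  Diagonal.ofNat (leftEnd s (k + 1)) (n + 1 - k + leftEnd s (k + 1)) (by
    have := leftEnd_le s (k + 1)
    have := one_le_leftEnd s (Nat.le_add_left 1 k)
    omega)

/-- The vertex left behind in the `i`-th step of a sweep. -/
def lostVertex (n : ℕ) (s : ℕ → ℤˣ) (i : ℕ) : ℕ :=
  if i = 0 ∨ s i = 1 then leftEnd s i else n + 2 - i + leftEnd s i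

/-- The vertex reached by a sweep after the `j`-th seed diagonal. -/
def gainedVertex (n : ℕ) (s : ℕ → ℤˣ) (j : ℕ) : ℕ :=
  if s (j + 1) = 1 then leftEnd s (j + 2) else n - j + leftEnd s (j + 2)

theorem lostVertex_cases (n : ℕ) (s : ℕ → ℤˣ) (i : ℕ) :
    ((i = 0 ∨ s i = 1) ∧ leftEnd s (i + 1) = leftEnd s i + 1 ∧ lostVertex n s i = leftEnd s i) ∨
    ((i ≠ 0 ∧ s i = -1) ∧ leftEnd s (i + 1) = leftEnd s i ∧
      lostVertex n s i = n + 2 - i + leftEnd s i) := by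
  by_cases h : i = 0 ∨ s i = 1
  · exact Or.inl ⟨h, leftEnd_succ_of_pos s h, if_pos h⟩
  · refine Or.inr ⟨⟨fun h' => h (Or.inl h'), ?_⟩, leftEnd_succ_of_neg s h, if_neg h⟩
    exact (Int.units_eq_one_or _).resolve_left fun h' => h (Or.inr h')

theorem gainedVertex_cases (n : ℕ) (s : ℕ → ℤˣ) (j : ℕ) :
    (s (j + 1) = 1 ∧ leftEnd s (j + 2) = leftEnd s (j + 1) + 1 ∧
      gainedVertex n s j = leftEnd s (j + 2)) ∨
    (s (j + 1) = -1 ∧ leftEnd s (j + 2) = leftEnd s (j + 1) ∧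
      gainedVertex n s j = n - j + leftEnd s (j + 2)) := by
  rcases Int.units_eq_one_or (s (j + 1)) with h | h
  · exact Or.inl ⟨h, leftEnd_succ_of_pos s (Or.inr h), if_pos h⟩
  · have h' : ¬ s (j + 1) = 1 := by rw [h]; decide
    exact Or.inr ⟨h, leftEnd_succ_of_neg s (by simpa using h'), if_neg h'⟩

/-- The diagonal that crosses exactly the seed diagonals of a sweep with index in `[i, j]`. -/
def intervalDiagonal {n : ℕ} (s : ℕ → ℤˣ) (p : {p : Fin n × Fin n // p.1 ≤ p.2}) : Diagonal n :=
  Diagonal.ofNat (min (lostVertex n s p.1.1) (gainedVertex n s p.1.2))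
    (max (lostVertex n s p.1.1) (gainedVertex n s p.1.2)) (by
    obtain ⟨⟨i, j⟩, hij⟩ := p
    have hij' : i.val ≤ j.val := hij
    have h1 := lostVertex_cases n s i
    have h2 := gainedVertex_cases n s j
    have h3 := leftEnd_le s i
    have h4 := leftEnd_bounds s (Nat.succ_le_succ hij')
    have h5 := one_le_leftEnd s (Nat.le_add_left 1 i)
    simp only [Nat.succ_eq_add_one] at h4
    dsimp only
    omega)

/-- The seed diagonal `k` is the chord `k + 1` of the sweep. The lost vertex `i` lies strictly
before the chords from `i + 1` on, and the gained vertex `j` strictly beyond the chords up to `j +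
1`. -/
theorem crosses_intervalDiagonal_sweepDiagonal {n : ℕ} (s : ℕ → ℤˣ)
    (p : {p : Fin n × Fin n // p.1 ≤ p.2}) (k : Fin n) :
    Crosses (intervalDiagonal s p) (sweepDiagonal s k) ↔ p.1.1 ≤ k ∧ k ≤ p.1.2 := by
  obtain ⟨⟨i, j⟩, hij⟩ := p
  have hij' : i.val ≤ j.val := hij
  unfold intervalDiagonal sweepDiagonal
  rw [crosses_ofNat]
  simp only [Fin.le_def]
  have h1 := lostVertex_cases n s i
  have h2 := gainedVertex_cases n s j
  have h3 := leftEnd_le s i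
  have h4 := leftEnd_bounds s (Nat.succ_le_succ hij')
  simp only [Nat.succ_eq_add_one] at h4
  rcases lt_or_ge k.val i.val with hki | hki
  · have h5 := leftEnd_bounds s (show k.val + 1 ≤ i.val by omega)
    have h6 := one_le_leftEnd s (Nat.le_add_left 1 k)
    omega
  · rcases lt_or_ge j.val k.val with hjk | hjk
    · have h5 := leftEnd_bounds s (show j.val + 2 ≤ k.val + 1 by omega)
      omega
    · have h5 := leftEnd_bounds s (show i.val + 1 ≤ k.val + 1 by omega)
      have h6 := leftEnd_bounds s (show k.val + 1 ≤ j.val + 1 by omega)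
      omega

theorem not_crosses_sweepDiagonal {n : ℕ} (s : ℕ → ℤˣ) (k l : Fin n) :
    ¬ Crosses (sweepDiagonal s k) (sweepDiagonal s l) := by
  unfold sweepDiagonal
  rw [crosses_ofNat]
  rcases le_total k.val l.val with h | h
  · have := leftEnd_bounds s (Nat.succ_le_succ h)
    simp only [Nat.succ_eq_add_one] at this
    omega
  · have := leftEnd_bounds s (Nat.succ_le_succ h)
    simp only [Nat.succ_eq_add_one] at this
    omega

theorem sweepDiagonal_injective {n : ℕ} (s : ℕ → ℤˣ) :
    Function.Injective (sweepDiagonal (n := n) s) := by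
  intro k l h
  have h1 := congrArg (fun d : Diagonal n => d.1.1.val) h
  have h2 := congrArg (fun d : Diagonal n => d.1.2.val) h
  simp only [sweepDiagonal, Diagonal.ofNat] at h1 h2
  exact Fin.ext (by omega)

/-- This turns comparisons of signs into linear arithmetic on left endpoints. Index `0` is excluded
because the first step moves the left endpoint whatever `s 0` is. -/
theorem sign_eq_iff_leftEnd (s : ℕ → ℤˣ) {k l : ℕ} (hk : k ≠ 0) (hl : l ≠ 0) :
    s k = s l ↔ leftEnd s (k + 1) - leftEnd s k = leftEnd s (l + 1) - leftEnd s l := by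
  rcases Int.units_eq_one_or (s k) with h1 | h1 <;>
    rcases Int.units_eq_one_or (s l) with h2 | h2 <;> simp [leftEnd, h1, h2, hk, hl]

theorem intervalChord_cases (n : ℕ) (s : ℕ → ℤˣ) {i j : ℕ} (hij : i ≤ j) (hj : j < n) :
    (leftEnd s (i + 1) = leftEnd s i + 1 ∧
      min (lostVertex n s i) (gainedVertex n s j) = leftEnd s i ∧
      max (lostVertex n s i) (gainedVertex n s j) = gainedVertex n s j) ∨
    (leftEnd s (i + 1) = leftEnd s i ∧
      min (lostVertex n s i) (gainedVertex n s j) = gainedVertex n s j ∧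
      max (lostVertex n s i) (gainedVertex n s j) = n + 2 - i + leftEnd s i) := by
  have h1 := (lostVertex_cases n s i).imp And.right And.right
  have h2 := (gainedVertex_cases n s j).imp And.right And.right
  have h3 := leftEnd_le s i
  have h4 := leftEnd_bounds s (Nat.succ_le_succ hij)
  simp only [Nat.succ_eq_add_one] at h4
  omega

/-- The position of each chord depends only on which side loses a vertex at its start and which side
gains one at its end. After splitting by these sides and by the relative position of the intervals,
monotonicity of `leftEnd` decides every case. -/
theorem intervalChord_cross_iff (n : ℕ) (s : ℕ → ℤˣ) {i j k l a b c d : ℕ} (hik : i < k)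
    (hij : i ≤ j) (hkl : k ≤ l) (hj : j < n) (hl : l < n)
    (ha : a = min (lostVertex n s i) (gainedVertex n s j))
    (hb : b = max (lostVertex n s i) (gainedVertex n s j))
    (hc : c = min (lostVertex n s k) (gainedVertex n s l))
    (hd : d = max (lostVertex n s k) (gainedVertex n s l)) :
    (a < c ∧ c < b ∧ b < d) ∨ (c < a ∧ a < d ∧ d < b) ↔ IntervalCross s i j k l := by
  have hI := intervalChord_cases n s hij hj
  have hK := intervalChord_cases n s hkl hl
  rw [← ha, ← hb] at hI
  rw [← hc, ← hd] at hK
  clear ha hb hc hd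
  have hJ := (gainedVertex_cases n s j).imp And.right And.right
  have hL := (gainedVertex_cases n s l).imp And.right And.right
  have b1 := leftEnd_le s i
  have b2 := leftEnd_bounds s (show i + 1 ≤ k from hik)
  unfold IntervalCross
  rw [sign_eq_iff_leftEnd s (show k ≠ 0 by omega) (Nat.succ_ne_zero j), Ne,
    sign_eq_iff_leftEnd s (show k ≠ 0 by omega) (Nat.succ_ne_zero l)]
  simp only [Nat.succ_eq_add_one, add_assoc, one_add_one_eq_two]
  generalize gainedVertex n s j = u at *
  generalize gainedVertex n s l = w at *
  rcases lt_trichotomy j l with hjl | rfl | hjl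
  · have b4 := leftEnd_bounds s (show j + 2 ≤ l + 1 by omega)
    rcases lt_trichotomy (j + 1) k with hjk | hjk | hjk
    · have b5 := leftEnd_bounds s (show i + 1 ≤ j + 1 by omega)
      have b6 := leftEnd_bounds s (show j + 2 ≤ k by omega)
      have b7 := leftEnd_bounds s (show k + 1 ≤ l + 1 by omega)
      rw [iff_false_right (by omega)]
      rcases hJ with ⟨hJ, rfl⟩ | ⟨hJ, rfl⟩ <;> rcases hL with ⟨hL, rfl⟩ | ⟨hL, rfl⟩ <;>
        rcases hI with ⟨hI, rfl, rfl⟩ | ⟨hI, rfl, rfl⟩ <;>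
        rcases hK with ⟨hK, rfl, rfl⟩ | ⟨hK, rfl, rfl⟩ <;> omega
    · have e1 : leftEnd s k = leftEnd s (j + 1) := by rw [hjk]
      have e2 : leftEnd s (k + 1) = leftEnd s (j + 2) := by rw [← hjk]
      rw [iff_true_right (by omega)]
      rcases hJ with ⟨hJ, rfl⟩ | ⟨hJ, rfl⟩ <;> rcases hL with ⟨hL, rfl⟩ | ⟨hL, rfl⟩ <;>
        rcases hI with ⟨hI, rfl, rfl⟩ | ⟨hI, rfl, rfl⟩ <;>
        rcases hK with ⟨hK, rfl, rfl⟩ | ⟨hK, rfl, rfl⟩ <;> omega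
    · have b5 := leftEnd_bounds s (show k + 1 ≤ j + 1 by omega)
      rcases hJ with ⟨hJ, rfl⟩ | ⟨hJ, rfl⟩ <;> rcases hL with ⟨hL, rfl⟩ | ⟨hL, rfl⟩ <;>
        rcases hI with ⟨hI, rfl, rfl⟩ | ⟨hI, rfl, rfl⟩ <;>
        rcases hK with ⟨hK, rfl, rfl⟩ | ⟨hK, rfl, rfl⟩ <;> omega
  · have b5 := leftEnd_bounds s (show k + 1 ≤ j + 1 by omega)
    rw [iff_false_right (by omega)]
    omega
  · have b4 := leftEnd_bounds s (show l + 2 ≤ j + 1 by omega)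
    have b5 := leftEnd_bounds s (show k + 1 ≤ l + 1 by omega)
    rcases hJ with ⟨hJ, rfl⟩ | ⟨hJ, rfl⟩ <;> rcases hL with ⟨hL, rfl⟩ | ⟨hL, rfl⟩ <;>
        rcases hI with ⟨hI, rfl, rfl⟩ | ⟨hI, rfl, rfl⟩ <;>
        rcases hK with ⟨hK, rfl, rfl⟩ | ⟨hK, rfl, rfl⟩ <;> omega

theorem crosses_intervalDiagonal_of_lt {n : ℕ} (s : ℕ → ℤˣ)
    (p q : {p : Fin n × Fin n // p.1 ≤ p.2}) (h : p.1.1 < q.1.1) :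
    Crosses (intervalDiagonal s p) (intervalDiagonal s q) ↔
      IntervalCross s p.1.1 p.1.2 q.1.1 q.1.2 :=
  intervalChord_cross_iff n s h p.2 q.2 p.1.2.2 q.1.2.2 rfl rfl rfl rfl

end Sweep

/-! ### Indexing diagonals by almost positive roots -/

section Models

variable {n : ℕ}

/-- The signs `s` describe the seed diagonals `δ`: the diagonals of the polygon can be indexed by
almost positive roots so that the crossings are given by `RootCross s`. -/
def HasRootIndexing (s : ℕ → ℤˣ) (δ : Fin n → Diagonal n) : Prop :=
  ∃ e : RootIndex n ≃ Diagonal n, (∀ d d', Crosses (e d) (e d') ↔ RootCross s d d') ∧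
    ∀ k, e (.inr k) = δ k

theorem Crosses.symm {d e : Diagonal n} (h : Crosses d e) : Crosses e d :=
  Or.symm h

/-- Diagonals at vertex `0` are matched with the `-α k`, the others with intervals. The inequality
suffices: with an injection in the other direction it gives a bijection. -/
theorem card_diagonal_le (n : ℕ) : Fintype.card (Diagonal n) ≤ Fintype.card (RootIndex n) := by
  let f : Diagonal n → RootIndex n := fun d =>
    if h : d.1.1.val = 0 then .inr ⟨d.1.2.val - 2, by
      have := d.2
      have := d.1.2.2
      omega⟩
    else .inl ⟨(⟨d.1.1.val - 1, by
      have := d.2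
      have := d.1.2.2
      omega⟩, ⟨d.1.2.val - 3, by
      have := d.2
      have := d.1.2.2
      omega⟩), by
      have := d.2
      rw [Fin.le_def]
      dsimp only
      omega⟩
  refine Fintype.card_le_of_injective f fun d e hde => ?_
  have hd := d.2
  have he := e.2
  simp only [f] at hde
  split_ifs at hde with h1 h2 h2
  · simp only [Sum.inr.injEq, Fin.mk.injEq] at hde
    refine Subtype.ext (Prod.ext (Fin.ext ?_) (Fin.ext ?_)) <;> omega
  · simp only [Sum.inl.injEq, Subtype.mk.injEq, Prod.mk.injEq, Fin.mk.injEq] at hde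
    refine Subtype.ext (Prod.ext (Fin.ext ?_) (Fin.ext ?_)) <;> omega

theorem crosses_intervalDiagonal (s : ℕ → ℤˣ) (p q : {p : Fin n × Fin n // p.1 ≤ p.2}) :
    Crosses (intervalDiagonal s p) (intervalDiagonal s q) ↔ RootCross s (.inl p) (.inl q) := by
  have h0 : ∀ p q : {p : Fin n × Fin n // p.1 ≤ p.2}, p.1.1 < q.1.1 →
      ¬ IntervalCross s q.1.1 q.1.2 p.1.1 p.1.2 := fun p q h h' => lt_asymm h'.1 h
  rcases lt_trichotomy p.1.1 q.1.1 with h | h | h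
  · rw [crosses_intervalDiagonal_of_lt s p q h]
    exact ⟨Or.inl, fun h' => h'.resolve_right (h0 p q h)⟩
  · have h1 : ¬ RootCross s (.inl p) (.inl q) := by
      rintro (h' | h')
      · exact h'.1.ne (congrArg Fin.val h)
      · exact h'.1.ne (congrArg Fin.val h.symm)
    refine iff_of_false ?_ h1
    obtain ⟨⟨i, j⟩, hij⟩ := p
    obtain ⟨⟨k, l⟩, hkl⟩ := q
    obtain rfl : i = k := h
    have h2 := intervalChord_cases n s hij j.2
    have h3 := intervalChord_cases n s hkl l.2
    unfold intervalDiagonal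
    rw [crosses_ofNat]
    dsimp only
    omega
  · constructor
    · intro h'
      exact Or.inr ((crosses_intervalDiagonal_of_lt s q p h).1 h'.symm)
    · rintro (h' | h')
      · exact (h0 q p h h').elim
      · exact ((crosses_intervalDiagonal_of_lt s q p h).2 h').symm

/-- The seed diagonals of a sweep are described by the signs of the sweep. -/
theorem hasRootIndexing_sweepDiagonal (s : ℕ → ℤˣ) :
    HasRootIndexing s (sweepDiagonal (n := n) s) := by
  let f : RootIndex n → Diagonal n := Sum.elim (intervalDiagonal s) (sweepDiagonal s)
  have hcross : ∀ d d', Crosses (f d) (f d') ↔ RootCross s d d' := by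
    intro d d'
    rcases d with p | k <;> rcases d' with q | l
    · exact crosses_intervalDiagonal s p q
    · exact crosses_intervalDiagonal_sweepDiagonal s p l
    · exact ⟨fun h => (crosses_intervalDiagonal_sweepDiagonal s q k).1 h.symm,
        fun h => ((crosses_intervalDiagonal_sweepDiagonal s q k).2 h).symm⟩
    · exact iff_of_false (not_crosses_sweepDiagonal s k l) id
  have hinl : ∀ p : {p : Fin n × Fin n // p.1 ≤ p.2}, ∀ k,
      intervalDiagonal s p ≠ sweepDiagonal s k := fun p k h =>
    not_crosses_sweepDiagonal s k p.1.1 (by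
      rw [← h, crosses_intervalDiagonal_sweepDiagonal]
      exact ⟨le_rfl, p.2⟩)
  have hinj : Function.Injective f := by
    rintro (p | k) (q | l) h
    · have h1 : ∀ k, (p.1.1 ≤ k ∧ k ≤ p.1.2) ↔ (q.1.1 ≤ k ∧ k ≤ q.1.2) := fun k => by
        rw [← crosses_intervalDiagonal_sweepDiagonal s p k,
          ← crosses_intervalDiagonal_sweepDiagonal s q k]
        exact Iff.of_eq (congrArg (fun d => Crosses d (sweepDiagonal s k)) h)
      have h2 := (h1 p.1.1).1 ⟨le_rfl, p.2⟩
      have h3 := (h1 p.1.2).1 ⟨p.2, le_rfl⟩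
      have h4 := (h1 q.1.1).2 ⟨le_rfl, q.2⟩
      have h5 := (h1 q.1.2).2 ⟨q.2, le_rfl⟩
      exact congrArg Sum.inl (Subtype.ext (Prod.ext (le_antisymm h4.1 h2.1)
        (le_antisymm h3.2 h5.2)))
    · exact (hinl p l h).elim
    · exact (hinl q k h.symm).elim
    · exact congrArg Sum.inr (sweepDiagonal_injective s h)
  have hbij : Function.Bijective f := (Fintype.bijective_iff_injective_and_card f).2
    ⟨hinj, le_antisymm (Fintype.card_le_of_injective f hinj) (card_diagonal_le n)⟩
  exact ⟨Equiv.ofBijective f hbij, hcross, fun _ => rfl⟩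

variable {V : Type*} [AddCommGroup V]

theorem diagonalVector_eq_rootVector {s : ℕ → ℤˣ} {δ : Fin n → Diagonal n}
    {e : RootIndex n ≃ Diagonal n} (he : ∀ d d', Crosses (e d) (e d') ↔ RootCross s d d')
    (heδ : ∀ k, e (.inr k) = δ k) (α : Fin n → V) (d : RootIndex n) :
    diagonalVector δ α (e d) = rootVector α d := by
  have hcross : ∀ k, Crosses (e d) (δ k) ↔ RootCross s d (.inr k) := fun k => by rw [← heδ, he]
  have heq : ∀ k, e d = δ k ↔ d = .inr k := fun k => by rw [← heδ, e.injective.eq_iff]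
  classical
  unfold diagonalVector
  rw [Finset.sum_congr rfl fun k _ => if_congr (heq k) rfl (if_congr (hcross k) rfl rfl)]
  rcases d with p | k
  · simp only [reduceCtorEq, if_false, rootVector]
    rw [← Finset.sum_filter]
    refine Finset.sum_congr ?_ fun _ _ => rfl
    ext k
    rw [Finset.mem_filter, Finset.mem_Icc]
    exact ⟨And.right, fun h => ⟨Finset.mem_univ k, h⟩⟩
  · simp [RootCross, rootVector]

variable [Module ℝ V]

/-- Subsets of triangulations are the same as noncrossing sets, since every noncrossing set extends
to a maximal one. -/
theorem seedFan_eq_noncrossingFan {s : ℕ → ℤˣ} {δ : Fin n → Diagonal n}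
    (h : HasRootIndexing s δ) (α : Fin n → V) :
    seedFan δ α = noncrossingFan (rootVector α) (RootCross s) := by
  classical
  obtain ⟨e, he, heδ⟩ := h
  have himg : ∀ S : Set (RootIndex n), diagonalVector δ α '' (e '' S) = rootVector α '' S := by
    intro S
    rw [Set.image_image]
    exact Set.image_congr fun d _ => diagonalVector_eq_rootVector he heδ α d
  ext C
  constructor
  · rintro ⟨T, hT, S, hST, rfl⟩
    refine ⟨e ⁻¹' S, fun d hd d' hd' => ?_, ?_⟩
    · rw [← he]
      exact hT.1 _ (hST hd) _ (hST hd')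
    · rw [← himg, Set.image_preimage_eq _ e.surjective]
  · rintro ⟨S, hS, rfl⟩
    obtain ⟨T, hle, hT⟩ := Finite.exists_le_maximal
      (p := fun S : Finset (Diagonal n) => ∀ d ∈ S, ∀ e ∈ S, ¬ Crosses d e)
      (a := (e '' S).toFinset) (by
        intro d hd d' hd'
        obtain ⟨a, ha, rfl⟩ := Set.mem_toFinset.1 hd
        obtain ⟨b, hb, rfl⟩ := Set.mem_toFinset.1 hd'
        rw [he]
        exact hS a ha b hb)
    refine ⟨T, hT, (e '' S).toFinset, hle, ?_⟩
    rw [Set.coe_toFinset, himg]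

/-- The positive and negative parts of a linear relation are two noncrossing combinations of equal
value. They coincide, so both vanish. -/
theorem IsFanFamily.linearIndependent {D : Type*} [Fintype D] {v : D → V}
    {cross : D → D → Prop} (hv : IsFanFamily v cross) {S : Set D} (hS : IsNoncrossing cross S) :
    LinearIndependent ℝ fun d : S => v d := by
  classical
  change LinearIndepOn ℝ v S
  rw [linearIndepOn_iff']
  intro t g hts hg d hd
  let g' : D → ℝ := fun d => if d ∈ t then g d else 0
  have hsum : Fintype.linearCombination ℝ v g' = 0 := by
    rw [Fintype.linearCombination_apply, ← hg]
    simp [g', Finset.sum_ite_mem]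
  have hsupp : ∀ φ : ℝ → ℝ, φ 0 = 0 → IsNoncrossing cross (Function.support fun d => φ (g' d)) :=
    fun φ hφ => hS.mono fun d hd => by
      by_contra hdS
      exact hd (by simp only [g']; rw [if_neg fun h => hdS (hts (Finset.mem_coe.2 h)), hφ])
  have hparts : g' = (fun d => max (g' d) 0) - fun d => max (-g' d) 0 := by
    funext d
    change g' d = max (g' d) 0 - max (-g' d) 0
    rcases le_total (g' d) 0 with h | h
    · rw [max_eq_right h, max_eq_left (by linarith)]; ring
    · rw [max_eq_left h, max_eq_right (by linarith)]; ring
  have heq := hv.unique (fun d => max (g' d) 0) (fun d => max (-g' d) 0)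
    (fun d => le_max_right _ _) (fun d => le_max_right _ _)
    (hsupp (fun x => max x 0) (by simp)) (hsupp (fun x => max (-x) 0) (by simp)) (by
      rw [← sub_eq_zero, ← map_sub, ← hparts, hsum])
  rw [heq, sub_self] at hparts
  have := congrFun hparts d
  simpa [g', hd] using this

/-- At most `n` diagonals of the `(n + 3)`-gon are pairwise noncrossing. -/
theorem card_le_of_noncrossing {T : Finset (Diagonal n)}
    (hT : ∀ d ∈ T, ∀ e ∈ T, ¬ Crosses d e) : T.card ≤ n := by
  classical
  -- Any sweep serves here: noncrossing diagonals become linearly independent vectors in `ℝ ^ n`.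
  obtain ⟨e, he, -⟩ := hasRootIndexing_sweepDiagonal (n := n) fun _ => 1
  have hv := isFanFamily_rootVector (Pi.basisFun ℝ (Fin n)) fun _ => 1
  have hS : IsNoncrossing (RootCross fun _ => 1) (e ⁻¹' (T : Set (Diagonal n))) := by
    intro d hd d' hd'
    rw [← he]
    exact hT _ hd _ hd'
  have h1 := (hv.linearIndependent hS).fintype_card_le_finrank
  rw [Module.finrank_fin_fun] at h1
  refine le_trans (le_of_eq ?_) h1
  rw [← Fintype.card_coe]
  exact Fintype.card_congr (e.symm.subtypeEquiv fun d => by simp)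

end Models

/-! ### Strips of triangles and their rotation into sweeps -/

section Rotation

variable {n : ℕ}

theorem val_add_one_cases (a : Fin (n + 3)) :
    (a.val = n + 2 ∧ (a + 1).val = 0) ∨ (a.val < n + 2 ∧ (a + 1).val = a.val + 1) := by
  have h := Fin.val_add_one a
  have h2 := a.2
  by_cases ha : a = Fin.last (n + 2)
  · rw [if_pos ha] at h
    exact Or.inl ⟨by rw [ha]; rfl, h⟩
  · rw [if_neg ha] at h
    have : a.val ≠ n + 2 := fun h' => ha (Fin.ext h')
    exact Or.inr ⟨by omega, h⟩

/-- The diagonal `d` joins the vertices `a` and `b`. -/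
def HasEnds (d : Diagonal n) (a b : Fin (n + 3)) : Prop :=
  (d.1.1 = a ∧ d.1.2 = b) ∨ (d.1.1 = b ∧ d.1.2 = a)

theorem HasEnds.symm {d : Diagonal n} {a b : Fin (n + 3)} (h : HasEnds d a b) : HasEnds d b a :=
  Or.symm h

/-- The diagonal obtained by a rotation of the polygon by one step. -/
def rotateDiagonal (d : Diagonal n) : Diagonal n :=
  if h : d.1.2.val = n + 2 then
    Diagonal.ofNat 0 (d.1.1 + 1) (by have := d.2; omega)
  else
    Diagonal.ofNat (d.1.1 + 1) (d.1.2 + 1) (by have := d.2; have := d.1.2.2; omega)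

theorem rotateDiagonal_cases (d : Diagonal n) :
    (d.1.2.val = n + 2 ∧ (rotateDiagonal d).1.1.val = 0 ∧
      (rotateDiagonal d).1.2.val = d.1.1.val + 1) ∨
    (d.1.2.val < n + 2 ∧ (rotateDiagonal d).1.1.val = d.1.1.val + 1 ∧
      (rotateDiagonal d).1.2.val = d.1.2.val + 1) := by
  unfold rotateDiagonal
  split_ifs with h
  · exact Or.inl ⟨h, rfl, rfl⟩
  · exact Or.inr ⟨by have := d.1.2.2; omega, rfl, rfl⟩

theorem crosses_rotateDiagonal (d e : Diagonal n) :
    Crosses (rotateDiagonal d) (rotateDiagonal e) ↔ Crosses d e := by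
  unfold Crosses
  simp only [Fin.lt_def]
  have h1 := rotateDiagonal_cases d
  have h2 := rotateDiagonal_cases e
  have h3 := d.2
  have h4 := e.2
  omega

theorem rotateDiagonal_injective : Function.Injective (rotateDiagonal (n := n)) := by
  intro d e h
  have h1 := rotateDiagonal_cases d
  have h2 := rotateDiagonal_cases e
  rw [h] at h1
  have h3 := d.2
  have h4 := e.2
  refine Subtype.ext (Prod.ext (Fin.ext ?_) (Fin.ext ?_)) <;> omega

theorem HasEnds.rotate {d : Diagonal n} {a b : Fin (n + 3)} (h : HasEnds d a b) :
    HasEnds (rotateDiagonal d) (a + 1) (b + 1) := by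
  unfold HasEnds at h ⊢
  simp only [Fin.ext_iff] at h ⊢
  have h1 := rotateDiagonal_cases d
  have h2 := val_add_one_cases a
  have h3 := val_add_one_cases b
  have h4 := d.2
  omega

theorem HasRootIndexing.of_rotate {s : ℕ → ℤˣ} {δ : Fin n → Diagonal n}
    (h : HasRootIndexing s (rotateDiagonal ∘ δ)) : HasRootIndexing s δ := by
  obtain ⟨e, he, heδ⟩ := h
  let r : Diagonal n ≃ Diagonal n :=
    Equiv.ofBijective rotateDiagonal (Finite.injective_iff_bijective.1 rotateDiagonal_injective)
  have hr : ∀ d, rotateDiagonal (r.symm d) = d := r.apply_symm_apply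
  refine ⟨e.trans r.symm, fun d d' => ?_, fun k => ?_⟩
  · rw [← he, ← crosses_rotateDiagonal]
    simp only [Equiv.trans_apply, hr]
  · rw [Equiv.trans_apply, heδ, Equiv.symm_apply_eq]
    rfl

/-- The pairwise noncrossing diagonals `δ` form a strip of triangles with the apex `o` of the first
one: each diagonal arises from the preceding one by moving an endpoint along a side. -/
structure IsStrip (δ : Fin n → Diagonal n) (o : Fin (n + 3)) : Prop where
  injective : Function.Injective δ
  noncrossing : ∀ i j, ¬ Crosses (δ i) (δ j)
  apex : ∀ h : 0 < n, ∃ a, HasEnds (δ ⟨0, h⟩) a (o + 1) ∧ a + 1 = o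
  step : ∀ i (h : i + 1 < n), ∃ a b c, HasEnds (δ ⟨i, by omega⟩) a b ∧ HasEnds (δ ⟨i + 1, h⟩) a c ∧
    (c = b + 1 ∨ b = c + 1)

theorem IsStrip.rotate {δ : Fin n → Diagonal n} {o : Fin (n + 3)} (h : IsStrip δ o) :
    IsStrip (rotateDiagonal ∘ δ) (o + 1) where
  injective := rotateDiagonal_injective.comp h.injective
  noncrossing i j := by
    simp only [Function.comp_apply, crosses_rotateDiagonal]
    exact h.noncrossing i j
  apex hn := by
    obtain ⟨a, ha, hao⟩ := h.apex hn
    exact ⟨a + 1, ha.rotate, by rw [hao]⟩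
  step i hi := by
    obtain ⟨a, b, c, h1, h2, h3⟩ := h.step i hi
    exact ⟨a + 1, b + 1, c + 1, h1.rotate, h2.rotate,
      h3.imp (fun h => by rw [h]) fun h => by rw [h]⟩

/-- The chord shrinks or grows at either end, or the moved endpoint passes between the vertices `0`
and `n + 2`; in the last two cases the order of the endpoints changes. -/
theorem moved_chord_cases {d d' : Diagonal n} {a b c : Fin (n + 3)} (hab : HasEnds d a b)
    (hac : HasEnds d' a c) (hbc : c = b + 1 ∨ b = c + 1) :
    (d'.1.1.val = d.1.1.val + 1 ∧ d'.1.2.val = d.1.2.val) ∨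
    (d'.1.1.val = d.1.1.val ∧ d'.1.2.val + 1 = d.1.2.val) ∨
    (d'.1.1.val + 1 = d.1.1.val ∧ d'.1.2.val = d.1.2.val) ∨
    (d'.1.1.val = d.1.1.val ∧ d'.1.2.val = d.1.2.val + 1) ∨
    (d.1.1.val = 0 ∧ d'.1.1.val = d.1.2.val ∧ d'.1.2.val = n + 2) ∨
    (d.1.2.val = n + 2 ∧ d'.1.1.val = 0 ∧ d'.1.2.val = d.1.1.val) := by
  have hbc' : ((b.val = n + 2 ∧ c.val = 0) ∨ (b.val < n + 2 ∧ c.val = b.val + 1)) ∨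
      ((c.val = n + 2 ∧ b.val = 0) ∨ (c.val < n + 2 ∧ b.val = c.val + 1)) := by
    rcases hbc with h | h
    · rw [h]
      exact Or.inl (val_add_one_cases b)
    · rw [h]
      exact Or.inr (val_add_one_cases c)
  clear hbc
  have h1 := d.2
  have h2 := d'.2
  have h3 := d.1.2.2
  have h4 := d'.1.2.2
  rcases hab with ⟨rfl, rfl⟩ | ⟨rfl, rfl⟩ <;> rcases hac with ⟨h5, rfl⟩ | ⟨rfl, h5⟩ <;>
    rw [Fin.ext_iff] at h5 <;> omega

/-- A strip that has begun to shrink keeps shrinking: growing back at the same end returns to `d₀`,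
while growing at the other end or passing the vertex `0` crosses `d₀`. -/
theorem moved_chord_forward {d₀ d₁ d₂ : Diagonal n} {a b c : Fin (n + 3)} (hab : HasEnds d₁ a b)
    (hac : HasEnds d₂ a c) (hbc : c = b + 1 ∨ b = c + 1) (hne : d₀ ≠ d₂) (hcr : ¬ Crosses d₀ d₂)
    (hpos : 1 ≤ d₀.1.1.val)
    (h : (d₁.1.1.val = d₀.1.1.val + 1 ∧ d₁.1.2.val = d₀.1.2.val) ∨
      (d₁.1.1.val = d₀.1.1.val ∧ d₁.1.2.val + 1 = d₀.1.2.val)) :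
    (d₂.1.1.val = d₁.1.1.val + 1 ∧ d₂.1.2.val = d₁.1.2.val) ∨
      (d₂.1.1.val = d₁.1.1.val ∧ d₂.1.2.val + 1 = d₁.1.2.val) := by
  have hstep := moved_chord_cases hab hac hbc
  have hne' : ¬ (d₀.1.1.val = d₂.1.1.val ∧ d₀.1.2.val = d₂.1.2.val) := fun h' =>
    hne (Subtype.ext (Prod.ext (Fin.ext h'.1) (Fin.ext h'.2)))
  have h1 := d₂.2
  have h2 := d₁.1.2.2
  have h3 := d₁.2
  have h4 := d₀.1.2.2
  unfold Crosses at hcr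
  simp only [Fin.lt_def] at hcr
  rcases hstep with hs | hs | hs | hs | hs | hs <;> rcases h with h | h <;> omega

/-- A strip with apex `0` consists of the seed diagonals of a sweep. -/
theorem IsStrip.eq_sweepDiagonal {δ : Fin n → Diagonal n} (h : IsStrip δ 0) :
    ∃ s : ℕ → ℤˣ, δ = sweepDiagonal s := by
  have hfirst : ∀ hn : 0 < n, (δ ⟨0, hn⟩).1.1.val = 1 ∧ (δ ⟨0, hn⟩).1.2.val = n + 2 := by
    intro hn
    obtain ⟨a, ha, ha0⟩ := h.apex hn
    have h1 := val_add_one_cases a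
    rw [ha0] at h1
    have h2 := val_add_one_cases (0 : Fin (n + 3))
    simp only [Fin.val_zero] at h1 h2
    unfold HasEnds at ha
    simp only [Fin.ext_iff] at ha
    have h3 := (δ ⟨0, hn⟩).2
    omega
  have hpos : ∀ k (hk : k < n), 1 ≤ (δ ⟨k, hk⟩).1.1.val ∧ ∀ hk' : k + 1 < n,
      ((δ ⟨k + 1, hk'⟩).1.1.val = (δ ⟨k, hk⟩).1.1.val + 1 ∧
        (δ ⟨k + 1, hk'⟩).1.2.val = (δ ⟨k, hk⟩).1.2.val) ∨
      ((δ ⟨k + 1, hk'⟩).1.1.val = (δ ⟨k, hk⟩).1.1.val ∧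
        (δ ⟨k + 1, hk'⟩).1.2.val + 1 = (δ ⟨k, hk⟩).1.2.val) := by
    intro k
    induction k with
    | zero =>
      intro hk
      have h0 := hfirst hk
      refine ⟨h0.1.ge, fun hk' => ?_⟩
      obtain ⟨a, b, c, hab, hac, hbc⟩ := h.step 0 hk'
      have h1 := moved_chord_cases hab hac hbc
      have h2 := (δ ⟨0 + 1, hk'⟩).2
      have h3 := (δ ⟨0 + 1, hk'⟩).1.2.2
      omega
    | succ k ih =>
      intro hk
      have ih' := ih (by omega)
      have h1 := ih'.2 hk
      refine ⟨by have := ih'.1; omega, fun hk' => ?_⟩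
      obtain ⟨a, b, c, hab, hac, hbc⟩ := h.step (k + 1) hk'
      refine moved_chord_forward hab hac hbc ?_
        (h.noncrossing ⟨k, by omega⟩ ⟨k + 1 + 1, hk'⟩) ih'.1 h1
      intro h'
      have := congrArg Fin.val (h.injective h')
      dsimp only at this
      omega
  let x : ℕ → ℕ := fun k => if hk : k < n then (δ ⟨k, hk⟩).1.1.val else 0
  have hx : ∀ k (hk : k < n), x k = (δ ⟨k, hk⟩).1.1.val := fun k hk => dif_pos hk
  -- The sign at `k` belongs to the step from `δ (k - 1)` to `δ k`, which are the chords `k` and `k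
  -- + 1` of the sweep.
  let s : ℕ → ℤˣ := fun k => if x k = x (k - 1) + 1 then 1 else -1
  have main : ∀ k (hk : k < n), (δ ⟨k, hk⟩).1.1.val = leftEnd s (k + 1) ∧
      (δ ⟨k, hk⟩).1.2.val = n + 1 - k + leftEnd s (k + 1) := by
    intro k
    induction k with
    | zero =>
      intro hk
      have h0 := hfirst hk
      rw [zero_add, leftEnd_one]
      omega
    | succ k ih =>
      intro hk
      have ih' := ih (by omega)
      have hl : (x (k + 1) = x k + 1 ∧ leftEnd s (k + 1 + 1) = leftEnd s (k + 1) + 1) ∨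
          (x (k + 1) ≠ x k + 1 ∧ leftEnd s (k + 1 + 1) = leftEnd s (k + 1)) := by
        by_cases hx1 : x (k + 1) = x k + 1
        · exact Or.inl ⟨hx1, leftEnd_succ_of_pos s (Or.inr (if_pos hx1))⟩
        · refine Or.inr ⟨hx1, leftEnd_succ_of_neg s ?_⟩
          have : s (k + 1) = -1 := if_neg hx1
          simp [this]
      rw [hx k (by omega), hx (k + 1) hk] at hl
      have h1 := (hpos k (by omega)).2 hk
      omega
  refine ⟨s, funext fun k => Subtype.ext (Prod.ext (Fin.ext ?_) (Fin.ext ?_))⟩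
  · exact (main k k.2).1
  · exact (main k k.2).2

/-- Rotating until the apex reaches `0` gives a sweep. Rotations preserve crossings, so the indexing
can be pulled back. -/
theorem IsStrip.exists_hasRootIndexing {δ : Fin n → Diagonal n} {o : Fin (n + 3)}
    (h : IsStrip δ o) : ∃ s, HasRootIndexing s δ := by
  obtain ⟨m, hm⟩ : ∃ m, o.val + m = n + 3 := ⟨n + 3 - o.val, by have := o.2; omega⟩
  induction m generalizing o δ with
  | zero => have := o.2; omega
  | succ m ih =>
    rcases val_add_one_cases o with ⟨-, h2⟩ | ⟨-, h2⟩
    · have h3 := h.rotate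
      rw [show o + 1 = 0 from Fin.ext h2] at h3
      obtain ⟨s, hs⟩ := h3.eq_sweepDiagonal
      refine ⟨s, HasRootIndexing.of_rotate ?_⟩
      rw [hs]
      exact hasRootIndexing_sweepDiagonal s
    · obtain ⟨s, hs⟩ := ih h.rotate (by omega)
      exact ⟨s, hs.of_rotate⟩

end Rotation

/-! ### Path triangulations are strips -/

section PathTriangulations

variable {n : ℕ} {T : Finset (Diagonal n)} {δ : Fin n → Diagonal n}

theorem hasEnds_self (d : Diagonal n) : HasEnds d d.1.1 d.1.2 := Or.inl ⟨rfl, rfl⟩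

theorem HasEnds.unique {d e : Diagonal n} {a b : Fin (n + 3)} (hd : HasEnds d a b)
    (he : HasEnds e a b) : d = e := by
  have h1 : d.1.1 < d.1.2 := Fin.lt_def.2 (by have := d.2; omega)
  have h2 : e.1.1 < e.1.2 := Fin.lt_def.2 (by have := e.2; omega)
  rcases hd with ⟨rfl, rfl⟩ | ⟨rfl, rfl⟩ <;> rcases he with ⟨h3, h4⟩ | ⟨h3, h4⟩
  · exact Subtype.ext (Prod.ext h3.symm h4.symm)
  · rw [h3, h4] at h2; exact (lt_asymm h1 h2).elim
  · rw [h3, h4] at h2; exact (lt_asymm h1 h2).elim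
  · exact Subtype.ext (Prod.ext h3.symm h4.symm)

theorem HasEnds.isEdgeOf {d : Diagonal n} {a b : Fin (n + 3)} (h : HasEnds d a b)
    {t : Finset (Fin (n + 3))} (ha : a ∈ t) (hb : b ∈ t) : IsEdgeOf d t := by
  rcases h with ⟨rfl, rfl⟩ | ⟨rfl, rfl⟩
  exacts [⟨ha, hb⟩, ⟨hb, ha⟩]

theorem IsTriangle.edge_cases {t : Finset (Fin (n + 3))} (ht : IsTriangle T t)
    {a b : Fin (n + 3)} (ha : a ∈ t) (hb : b ∈ t) (hab : a ≠ b) :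
    (b = a + 1 ∨ a = b + 1) ∨ ∃ d ∈ T, HasEnds d a b := by
  wlog hlt : a < b generalizing a b
  · exact (this hb ha hab.symm (lt_of_le_of_ne (not_lt.1 hlt) hab.symm)).imp Or.symm
      fun ⟨d, hd, h⟩ => ⟨d, hd, h.symm⟩
  rcases ht.2 a ha b hb hlt with (h | h) | ⟨d, hd, h⟩
  · refine Or.inl (Or.inl (Fin.ext ?_))
    have := val_add_one_cases a
    have := b.2
    omega
  · refine Or.inl (Or.inr (Fin.ext ?_))
    have := val_add_one_cases b
    omega
  · exact Or.inr ⟨d, hd, Or.inl ⟨congrArg Prod.fst h, congrArg Prod.snd h⟩⟩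

theorem exists_third_vertex {t : Finset (Fin (n + 3))} (ht : t.card = 3) {a b : Fin (n + 3)}
    (ha : a ∈ t) (hb : b ∈ t) (hab : a ≠ b) : ∃ c ∈ t, c ≠ a ∧ c ≠ b ∧ ∀ x ∈ t,
      x = a ∨ x = b ∨ x = c := by
  have h1 : ((t.erase a).erase b).card = 1 := by
    rw [Finset.card_erase_of_mem (Finset.mem_erase.2 ⟨hab.symm, hb⟩), Finset.card_erase_of_mem ha,
      ht]
  obtain ⟨c, hc⟩ := Finset.card_eq_one.1 h1
  have hc' : ∀ x, (x ≠ b ∧ x ≠ a ∧ x ∈ t) ↔ x = c := fun x => by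
    rw [← Finset.mem_singleton, ← hc, Finset.mem_erase, Finset.mem_erase]
  have h2 := (hc' c).2 rfl
  refine ⟨c, h2.2.2, h2.2.1, h2.1, fun x hx => ?_⟩
  by_cases hxa : x = a
  · exact Or.inl hxa
  · by_cases hxb : x = b
    · exact Or.inr (Or.inl hxb)
    · exact Or.inr (Or.inr ((hc' x).1 ⟨hxb, hxa, hx⟩))

/-- The triangles of a path triangulation with a given edge `δ j`. -/
theorem eq_castSucc_or_succ_of_isEdgeOf
    {φ : SimpleGraph.pathGraph (n + 1) ≃g dualTree T}
    (hφ : ∀ i : Fin n, δ i ∈ T ∧ IsEdgeOf (δ i) (φ i.castSucc).1 ∧ IsEdgeOf (δ i) (φ i.succ).1)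
    {i : Fin (n + 1)} {j : Fin n} (h : IsEdgeOf (δ j) (φ i).1) : i = j.castSucc ∨ i = j.succ := by
  by_contra! hne
  have h1 : (dualTree T).Adj (φ i) (φ j.castSucc) :=
    ⟨fun h' => hne.1 (φ.injective h'), δ j, (hφ j).1, h, (hφ j).2.1⟩
  have h2 : (dualTree T).Adj (φ i) (φ j.succ) :=
    ⟨fun h' => hne.2 (φ.injective h'), δ j, (hφ j).1, h, (hφ j).2.2⟩
  rw [φ.map_adj_iff, SimpleGraph.pathGraph_adj] at h1 h2
  simp only [Fin.val_castSucc, Fin.val_succ] at h1 h2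
  omega

/-- The diagonals of a path triangulation form a strip. -/
theorem IsPathNumbering.exists_isStrip (h : IsPathNumbering T δ) : ∃ o, IsStrip δ o := by
  classical
  obtain ⟨hT, φ, hφ⟩ := h
  have hinj : Function.Injective δ := by
    intro i j hij
    have h1 := (hφ i).2.1
    have h2 := (hφ i).2.2
    rw [hij] at h1 h2
    have h3 := eq_castSucc_or_succ_of_isEdgeOf hφ h1
    have h4 := eq_castSucc_or_succ_of_isEdgeOf hφ h2
    simp only [Fin.ext_iff, Fin.val_castSucc, Fin.val_succ] at h3 h4
    exact Fin.ext (by omega)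
  -- The `n` distinct diagonals `δ j` exhaust `T`, because no noncrossing set has more than `n`
  -- elements.
  have hTδ : ∀ d ∈ T, ∃ j, d = δ j := by
    have h1 : Finset.univ.image δ = T := by
      refine Finset.eq_of_subset_of_card_le ?_ ?_
      · intro d hd
        obtain ⟨i, -, rfl⟩ := Finset.mem_image.1 hd
        exact (hφ i).1
      · rw [Finset.card_image_of_injective _ hinj, Finset.card_univ, Fintype.card_fin]
        exact card_le_of_noncrossing hT.1
    intro d hd
    rw [← h1] at hd
    obtain ⟨j, -, rfl⟩ := Finset.mem_image.1 hd
    exact ⟨j, rfl⟩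
  have hne : ∀ d : Diagonal n, d.1.1 ≠ d.1.2 := fun d h => by
    have := d.2
    rw [h] at this
    omega
  -- The `i`-th triangle has no diagonals of `T` as edges besides its one or two path neighbours in
  -- `δ`; all its other edges are sides of the polygon.
  have hedge : ∀ i a b, a ∈ (φ i).1 → b ∈ (φ i).1 → a ≠ b →
      (∀ j : Fin n, (i = j.castSucc ∨ i = j.succ) → ¬ HasEnds (δ j) a b) →
      (b = a + 1 ∨ a = b + 1) := by
    intro i a b ha hb hab hj
    refine ((φ i).2.edge_cases ha hb hab).resolve_right ?_
    rintro ⟨d, hd, hdab⟩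
    obtain ⟨j, rfl⟩ := hTδ d hd
    exact hj j (eq_castSucc_or_succ_of_isEdgeOf hφ (hdab.isEdgeOf ha hb)) hdab
  have hstep : ∀ i (h : i + 1 < n), ∃ a b c, HasEnds (δ ⟨i, by omega⟩) a b ∧
      HasEnds (δ ⟨i + 1, h⟩) a c ∧ (c = b + 1 ∨ b = c + 1) := by
    intro i hi
    set i₀ : Fin n := ⟨i, by omega⟩ with hi₀
    set i₁ : Fin n := ⟨i + 1, hi⟩ with hi₁
    have h01 : i₀.succ = i₁.castSucc := rfl
    have hd : δ i₀ ≠ δ i₁ := fun h => by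
      have := congrArg Fin.val (hinj h)
      simp [hi₀, hi₁] at this
    have e0 := (hφ i₀).2.2
    have e1 := (hφ i₁).2.1
    rw [← h01] at e1
    have key : ∀ a b, HasEnds (δ i₀) a b → ∀ c ∈ (φ i₀.succ).1, c ≠ a → c ≠ b →
        HasEnds (δ i₁) a c → ∃ a b c, HasEnds (δ i₀) a b ∧ HasEnds (δ i₁) a c ∧
          (c = b + 1 ∨ b = c + 1) := by
      intro a b hab c hc hca hcb hac
      have hb : b ∈ (φ i₀.succ).1 := by
        rcases hab with ⟨-, rfl⟩ | ⟨rfl, -⟩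
        exacts [e0.2, e0.1]
      refine ⟨a, b, c, hab, hac, hedge _ b c hb hc hcb.symm fun j hj hjbc => ?_⟩
      have hj' : j = i₀ ∨ j = i₁ := by
        simp only [Fin.ext_iff, Fin.val_castSucc, Fin.val_succ, hi₀, hi₁] at hj ⊢
        omega
      have hab' : a ≠ b := by
        rcases hab with ⟨rfl, rfl⟩ | ⟨rfl, rfl⟩
        exacts [hne _, (hne _).symm]
      rcases hj' with rfl | rfl
      · rcases hab with ⟨rfl, rfl⟩ | ⟨rfl, rfl⟩ <;> rcases hjbc with ⟨h1, h2⟩ | ⟨h1, h2⟩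
        exacts [hab' h1, hca h1.symm, hca h2.symm, hab' h2]
      · rcases hac with ⟨rfl, rfl⟩ | ⟨rfl, rfl⟩ <;> rcases hjbc with ⟨h1, h2⟩ | ⟨h1, h2⟩
        exacts [hab' h1, hca h1.symm, hca h2.symm, hab' h2]
    obtain ⟨c, hc, hc1, hc2, hall⟩ := exists_third_vertex (φ i₀.succ).2.1 e0.1 e0.2 (hne _)
    have hends := hasEnds_self (δ i₁)
    have hself := hasEnds_self (δ i₀)
    have hnot : ¬ HasEnds (δ i₁) (δ i₀).1.1 (δ i₀).1.2 := fun h => hd (hself.unique h)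
    have hne1 := hne (δ i₁)
    have h1 := hall _ e1.1
    have h2 := hall _ e1.2
    generalize (δ i₁).1.1 = p at *
    generalize (δ i₁).1.2 = q at *
    rcases h1 with rfl | rfl | rfl <;> rcases h2 with rfl | rfl | rfl
    · exact (hne1 rfl).elim
    · exact (hnot hends).elim
    · exact key _ _ hself _ hc hc1 hc2 hends
    · exact (hnot hends.symm).elim
    · exact (hne1 rfl).elim
    · exact key _ _ hself.symm _ hc hc2 hc1 hends
    · exact key _ _ hself _ hc hc1 hc2 hends.symm
    · exact key _ _ hself.symm _ hc hc2 hc1 hends.symm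
    · exact (hne1 rfl).elim
  -- The first triangle has two sides of the polygon as edges. They meet at the apex, the vertex
  -- opposite to `δ 0`.
  have hapex : ∃ o, ∀ h : 0 < n, ∃ a, HasEnds (δ ⟨0, h⟩) a (o + 1) ∧ a + 1 = o := by
    rcases Nat.eq_zero_or_pos n with h0 | h0
    · exact ⟨0, fun h => by omega⟩
    set i₀ : Fin n := ⟨0, h0⟩ with hi₀
    have e0 := (hφ i₀).2.1
    obtain ⟨c, hc, hc1, hc2, -⟩ := exists_third_vertex (φ i₀.castSucc).2.1 e0.1 e0.2 (hne _)
    have hself := hasEnds_self (δ i₀)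
    have hne0 := hne (δ i₀)
    have hside : ∀ a, a ∈ (φ i₀.castSucc).1 → a ≠ c → (c = a + 1 ∨ a = c + 1) := by
      intro a ha hac
      refine hedge _ a c ha hc hac fun j hj hjac => ?_
      have hj' : j = i₀ := by
        simp only [Fin.ext_iff, Fin.val_castSucc, Fin.val_succ, hi₀] at hj ⊢
        omega
      subst hj'
      rcases hjac with ⟨-, h⟩ | ⟨h, -⟩
      exacts [hc2 h.symm, hc1 h.symm]
    have s1 := hside _ e0.1 hc1.symm
    have s2 := hside _ e0.2 hc2.symm
    refine ⟨c, fun _ => ?_⟩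
    rcases s1 with s1 | s1 <;> rcases s2 with s2 | s2
    · exact (hne0 (add_right_cancel (s1.symm.trans s2))).elim
    · exact ⟨_, by rw [← s2]; exact hself, s1.symm⟩
    · exact ⟨_, by rw [← s1]; exact hself.symm, s2.symm⟩
    · exact (hne0 (s1.trans s2.symm)).elim
  obtain ⟨o, ho⟩ := hapex
  exact ⟨o, hinj, fun i j => hT.1 _ (hφ i).1 _ (hφ j).1, ho, hstep⟩

theorem IsPathNumbering.exists_hasRootIndexing (h : IsPathNumbering T δ) :
    ∃ s, HasRootIndexing s δ := by
  obtain ⟨o, ho⟩ := h.exists_isStrip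
  exact ho.exists_hasRootIndexing

end PathTriangulations

/-! ### Every sweep yields a path triangulation -/

section SweepTriangulation

variable {n : ℕ}

/-- The triangulation of a sweep. -/
def sweepTriangulation (n : ℕ) (s : ℕ → ℤˣ) : Finset (Diagonal n) :=
  Finset.univ.image (sweepDiagonal s)

theorem sweepDiagonal_mem (s : ℕ → ℤˣ) (k : Fin n) : sweepDiagonal s k ∈ sweepTriangulation n s :=
  Finset.mem_image_of_mem _ (Finset.mem_univ k)

/-- The triangle between the `k`-th and the `(k + 1)`-st chord of a sweep. -/
def sweepTriangle (n : ℕ) (s : ℕ → ℤˣ) (k : ℕ) : Finset (Fin (n + 3)) :=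
  Finset.univ.filter fun w => (leftEnd s k ≤ w.val ∧ w.val ≤ n + 2 - k + leftEnd s k) ∧
    (w.val ≤ leftEnd s (k + 1) ∨ n + 1 - k + leftEnd s (k + 1) ≤ w.val)

theorem mem_sweepTriangle {s : ℕ → ℤˣ} {k : ℕ} {w : Fin (n + 3)} :
    w ∈ sweepTriangle n s k ↔
      (leftEnd s k ≤ w.val ∧ w.val ≤ n + 2 - k + leftEnd s k) ∧
        (w.val ≤ leftEnd s (k + 1) ∨ n + 1 - k + leftEnd s (k + 1) ≤ w.val) := by
  simp [sweepTriangle]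

theorem isTriangulation_sweepTriangulation (s : ℕ → ℤˣ) :
    IsTriangulation (sweepTriangulation n s) := by
  refine ⟨?_, fun S hS hle d hd => ?_⟩
  · intro d hd d' hd'
    obtain ⟨k, -, rfl⟩ := Finset.mem_image.1 hd
    obtain ⟨l, -, rfl⟩ := Finset.mem_image.1 hd'
    exact not_crosses_sweepDiagonal s k l
  · obtain ⟨e, he, heδ⟩ := hasRootIndexing_sweepDiagonal (n := n) s
    obtain ⟨p | k, rfl⟩ := e.surjective d
    · refine (hS _ hd _ (hle (sweepDiagonal_mem s p.1.1)) ?_).elim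
      rw [← heδ, he]
      exact ⟨le_rfl, p.2⟩
    · rw [heδ]
      exact sweepDiagonal_mem s k

/-- The chords `1, …, n` are the seed diagonals, while the initial chord `0` and the final chord `n
+ 1` are sides of the polygon. -/
theorem sweepChord_edge (s : ℕ → ℤˣ) {k : ℕ} (hk : k ≤ n + 1) {a b : Fin (n + 3)}
    (ha : a.val = leftEnd s k) (hb : b.val = n + 2 - k + leftEnd s k) :
    (a.val + 1 = b.val ∨ (a.val = 0 ∧ b.val = n + 2)) ∨
      ∃ d ∈ sweepTriangulation n s, d.1 = (a, b) := by
  rcases k with _ | k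
  · have : leftEnd s 0 = 0 := rfl
    exact Or.inl (Or.inr (by omega))
  · rcases Nat.lt_or_ge k n with h | h
    · refine Or.inr ⟨sweepDiagonal s ⟨k, h⟩, sweepDiagonal_mem s _, Prod.ext ?_ ?_⟩
      · exact Fin.ext ha.symm
      · refine Fin.ext (Eq.trans ?_ hb.symm)
        change n + 1 - k + leftEnd s (k + 1) = _
        omega
    · exact Or.inl (Or.inl (by omega))

theorem leftEnd_succ_cases (s : ℕ → ℤˣ) (k : ℕ) :
    leftEnd s (k + 1) = leftEnd s k + 1 ∨ leftEnd s (k + 1) = leftEnd s k := by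
  have := leftEnd_bounds s (Nat.le_succ k)
  simp only [Nat.succ_eq_add_one] at this
  omega

theorem isTriangle_sweepTriangle (s : ℕ → ℤˣ) {k : ℕ} (hk : k ≤ n) :
    IsTriangle (sweepTriangulation n s) (sweepTriangle n s k) := by
  have hle := leftEnd_le s k
  have hcases := leftEnd_succ_cases s k
  constructor
  · let m : ℕ := if leftEnd s (k + 1) = leftEnd s k then n + 1 - k + leftEnd s k
      else leftEnd s k + 1
    have hm : (leftEnd s (k + 1) = leftEnd s k ∧ m = n + 1 - k + leftEnd s k) ∨
        (leftEnd s (k + 1) = leftEnd s k + 1 ∧ m = leftEnd s k + 1) := by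
      rcases hcases with h | h
      · exact Or.inr ⟨h, if_neg (by omega)⟩
      · exact Or.inl ⟨h, if_pos h⟩
    clear_value m
    refine Finset.card_eq_three.2 ⟨⟨leftEnd s k, by omega⟩, ⟨m, by omega⟩,
      ⟨n + 2 - k + leftEnd s k, by omega⟩, ?_, ?_, ?_, ?_⟩
    · rw [Ne, Fin.mk.injEq]; omega
    · rw [Ne, Fin.mk.injEq]; omega
    · rw [Ne, Fin.mk.injEq]; omega
    · ext w
      rw [mem_sweepTriangle]
      simp only [Finset.mem_insert, Finset.mem_singleton, Fin.ext_iff]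
      omega
  · intro a ha b hb hab
    rw [mem_sweepTriangle] at ha hb
    rw [Fin.lt_def] at hab
    by_cases h1 : a.val = leftEnd s k ∧ b.val = n + 2 - k + leftEnd s k
    · exact sweepChord_edge s (by omega) h1.1 h1.2
    · by_cases h2 : a.val = leftEnd s (k + 1) ∧ b.val = n + 2 - (k + 1) + leftEnd s (k + 1)
      · exact sweepChord_edge s (by omega) h2.1 h2.2
      · exact Or.inl (Or.inl (by omega))

theorem isEdgeOf_sweepTriangle_iff (s : ℕ → ℤˣ) (m : Fin n) {k : ℕ} (hk : k ≤ n) :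
    IsEdgeOf (sweepDiagonal s m) (sweepTriangle n s k) ↔ k = m.val ∨ k = m.val + 1 := by
  unfold IsEdgeOf
  rw [mem_sweepTriangle, mem_sweepTriangle]
  change ((_ ≤ leftEnd s (m + 1) ∧ leftEnd s (m + 1) ≤ _) ∧
      (leftEnd s (m + 1) ≤ _ ∨ _ ≤ leftEnd s (m + 1))) ∧
    ((_ ≤ n + 1 - m.val + leftEnd s (m + 1) ∧ n + 1 - m.val + leftEnd s (m + 1) ≤ _) ∧
      (n + 1 - m.val + leftEnd s (m + 1) ≤ _ ∨ _ ≤ n + 1 - m.val + leftEnd s (m + 1))) ↔ _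
  have hm := m.2
  rcases lt_trichotomy k m.val with h | rfl | h
  · have h1 := leftEnd_bounds s (show k + 1 ≤ m.val + 1 by omega)
    omega
  · have h1 := leftEnd_succ_cases s m
    omega
  · rcases Nat.lt_or_ge (m.val + 1) k with h' | h'
    · have h1 := leftEnd_bounds s h'.le
      omega
    · obtain rfl : k = m.val + 1 := by omega
      have h1 := leftEnd_succ_cases s (m.val + 1)
      omega

theorem sweepTriangle_injective (s : ℕ → ℤˣ) {i j : ℕ} (hi : i ≤ n) (hj : j ≤ n)
    (h : sweepTriangle n s i = sweepTriangle n s j) : i = j := by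
  wlog hij : i < j generalizing i j
  · by_contra hne
    exact hne (this hj hi h.symm (by omega)).symm
  have hle := leftEnd_le s i
  have h1 := leftEnd_bounds s hij.le
  have h2 := leftEnd_succ_cases s i
  have ha : (⟨leftEnd s i, by omega⟩ : Fin (n + 3)) ∈ sweepTriangle n s i := by
    rw [mem_sweepTriangle]
    dsimp only
    omega
  have hb : (⟨n + 2 - i + leftEnd s i, by omega⟩ : Fin (n + 3)) ∈ sweepTriangle n s i := by
    rw [mem_sweepTriangle]
    dsimp only
    omega
  rw [h, mem_sweepTriangle] at ha hb
  dsimp only at ha hb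
  omega

theorem IsTriangle.eq_sweepTriangle {s : ℕ → ℤˣ} {t : Finset (Fin (n + 3))}
    (ht : IsTriangle (sweepTriangulation n s) t) : ∃ k ≤ n, t = sweepTriangle n s k := by
  classical
  -- Take the first `k` such that no vertex of `t` lies strictly beyond the chord `k + 1`; `k = n`
  -- always qualifies, since that chord is a side. If `k > 0`, some vertex lies beyond the chord
  -- `k`, and a vertex strictly before it would give an edge of `t` crossing that chord. So `t` lies
  -- between the two chords.
  have hex : ∃ k, k ≤ n ∧ ∀ w ∈ t, w.val ≤ leftEnd s (k + 1) ∨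
      n + 1 - k + leftEnd s (k + 1) ≤ w.val := ⟨n, le_rfl, fun w _ => by omega⟩
  obtain ⟨hk, hkt⟩ := Nat.find_spec hex
  set k := Nat.find hex with hkdef
  have hmin : ∀ m, m < k → ¬ (m ≤ n ∧ ∀ w ∈ t, w.val ≤ leftEnd s (m + 1) ∨
      n + 1 - m + leftEnd s (m + 1) ≤ w.val) := fun m hm => Nat.find_min hex hm
  clear_value k
  refine ⟨k, hk, Finset.eq_of_subset_of_card_le (fun w hw => ?_) ?_⟩
  · rw [mem_sweepTriangle]
    refine ⟨?_, hkt w hw⟩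
    rcases k with _ | k
    · have : leftEnd s 0 = 0 := rfl
      have := w.2
      omega
    · have h1 := hmin k (Nat.lt_succ_self k)
      push Not at h1
      obtain ⟨w₀, hw₀, hlo, hhi⟩ := h1 (by omega)
      have hle := leftEnd_le s (k + 1)
      by_contra hout
      have hww : w ≠ w₀ := by
        rintro rfl
        omega
      have hside : ¬ (w₀ = w + 1 ∨ w = w₀ + 1) := by
        rintro (h | h)
        · have := val_add_one_cases w
          rw [← h] at this
          omega
        · have := val_add_one_cases w₀
          rw [← h] at this
          omega
      obtain ⟨d, hd, hends⟩ := (ht.edge_cases hw hw₀ hww).resolve_left hside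
      obtain ⟨j, -, rfl⟩ := Finset.mem_image.1 hd
      refine not_crosses_sweepDiagonal s j ⟨k, by omega⟩ ?_
      have hd2 := (sweepDiagonal s j).2
      have e1 : (sweepDiagonal s (⟨k, by omega⟩ : Fin n)).1.1.val = leftEnd s (k + 1) := rfl
      have e2 : (sweepDiagonal s (⟨k, by omega⟩ : Fin n)).1.2.val =
        n + 1 - k + leftEnd s (k + 1) := rfl
      unfold Crosses
      simp only [Fin.lt_def, e1, e2]
      rcases hends with ⟨rfl, rfl⟩ | ⟨rfl, rfl⟩ <;> omega
  · rw [ht.1, (isTriangle_sweepTriangle s hk).1]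

/-- The seed diagonals of a sweep are the diagonals of a path triangulation, in the order of the
dual path. -/
theorem isPathNumbering_sweepDiagonal (s : ℕ → ℤˣ) :
    IsPathNumbering (sweepTriangulation n s) (sweepDiagonal s) := by
  let f : Fin (n + 1) → {t : Finset (Fin (n + 3)) // IsTriangle (sweepTriangulation n s) t} :=
    fun k => ⟨sweepTriangle n s k, isTriangle_sweepTriangle s (Nat.lt_succ_iff.1 k.2)⟩
  have hf : Function.Bijective f := by
    constructor
    · intro i j h
      exact Fin.ext (sweepTriangle_injective s (Nat.lt_succ_iff.1 i.2) (Nat.lt_succ_iff.1 j.2)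
        (congrArg Subtype.val h))
    · rintro ⟨t, ht⟩
      obtain ⟨k, hk, rfl⟩ := ht.eq_sweepTriangle
      exact ⟨⟨k, Nat.lt_succ_iff.2 hk⟩, rfl⟩
  have hadj : ∀ i j : Fin (n + 1), (dualTree (sweepTriangulation n s)).Adj (f i) (f j) ↔
      (SimpleGraph.pathGraph (n + 1)).Adj i j := by
    intro i j
    rw [SimpleGraph.pathGraph_adj]
    constructor
    · rintro ⟨hne, d, hd, h1, h2⟩
      obtain ⟨m, -, rfl⟩ := Finset.mem_image.1 hd
      have h3 := (isEdgeOf_sweepTriangle_iff s m (Nat.lt_succ_iff.1 i.2)).1 h1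
      have h4 := (isEdgeOf_sweepTriangle_iff s m (Nat.lt_succ_iff.1 j.2)).1 h2
      have h5 : i.val ≠ j.val := fun h => hne (congrArg f (Fin.ext h))
      omega
    · intro h
      refine ⟨fun h' => ?_, ?_⟩
      · have := congrArg Fin.val (hf.1 h')
        omega
      · refine ⟨sweepDiagonal s ⟨min i.val j.val, by omega⟩, sweepDiagonal_mem s _, ?_, ?_⟩
        · refine (isEdgeOf_sweepTriangle_iff s _ (Nat.lt_succ_iff.1 i.2)).2 ?_
          dsimp only
          omega
        · refine (isEdgeOf_sweepTriangle_iff s _ (Nat.lt_succ_iff.1 j.2)).2 ?_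
          dsimp only
          omega
  refine ⟨isTriangulation_sweepTriangulation s,
    ⟨Equiv.ofBijective f hf, fun {i j} => hadj i j⟩, fun i => ⟨sweepDiagonal_mem s i, ?_, ?_⟩⟩
  · exact (isEdgeOf_sweepTriangle_iff s i (Nat.le_of_lt i.2)).2 (Or.inl rfl)
  · exact (isEdgeOf_sweepTriangle_iff s i i.2).2 (Or.inr rfl)

end SweepTriangulation

/-! ### The root system of type A and the first assertion -/

section RootSystems

variable {n : ℕ}

/-- The sum of the coordinates from the position `q` on. -/
def tailSum (q : Fin (n + 1)) : rootSpace n →ₗ[ℝ] ℝ :=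
  (∑ m ∈ Finset.Ici q, LinearMap.proj m) ∘ₗ (rootSpace n).subtype

theorem tailSum_apply (q : Fin (n + 1)) (x : rootSpace n) :
    tailSum q x = ∑ m ∈ Finset.Ici q, x.1 m := by
  simp [tailSum]

/-- The tail sums at the positions `1, …, n` are dual to the simple roots, which gives linear
independence and detects positive roots. -/
theorem tailSum_simpleRoot (q : Fin (n + 1)) (l : Fin n) :
    tailSum q (simpleRoot n l) = if q = l.succ then 1 else 0 := by
  rw [tailSum_apply]
  simp only [simpleRoot, Pi.sub_apply, Finset.sum_sub_distrib, Finset.sum_pi_single',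
    Finset.mem_Ici, Fin.le_def, Fin.ext_iff, Fin.val_succ, Fin.val_castSucc]
  split_ifs <;> first | omega | norm_num

theorem linearIndependent_simpleRoot (n : ℕ) : LinearIndependent ℝ (simpleRoot n) := by
  rw [Fintype.linearIndependent_iff]
  intro g hg k
  have := congrArg (tailSum k.succ) hg
  simpa [tailSum_simpleRoot] using this

theorem finrank_rootSpace (n : ℕ) : Module.finrank ℝ (rootSpace n) = n := by
  let f : Module.Dual ℝ (Fin (n + 1) → ℝ) := ∑ m, LinearMap.proj m
  have hf : ∀ x, f x = ∑ m, x m := fun x => by simp [f, LinearMap.sum_apply]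
  have hker : rootSpace n = LinearMap.ker f := by
    ext x
    rw [LinearMap.mem_ker, hf]
    rfl
  have hne : f ≠ 0 := fun h => by
    have := congrArg (fun g => g (Pi.single 0 1)) h
    simp [hf, Finset.sum_pi_single'] at this
  have := Module.Dual.finrank_ker_add_one_of_ne_zero hne
  rw [← hker, Module.finrank_fin_fun] at this
  omega

/-- The simple roots form a basis. -/
noncomputable def simpleRootBasis (n : ℕ) : Module.Basis (Fin n) ℝ (rootSpace n) :=
  basisOfLinearIndependentOfCardEqFinrank' _ (linearIndependent_simpleRoot n)
    (by rw [finrank_rootSpace, Fintype.card_fin])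

theorem coe_simpleRootBasis (n : ℕ) : ⇑(simpleRootBasis n) = simpleRoot n :=
  coe_basisOfLinearIndependentOfCardEqFinrank' _ _ _

theorem initialSum_simpleRoot {m : ℕ} (hm : m < n + 1) :
    (initialSum (simpleRoot n) m).1 = Pi.single ⟨m, hm⟩ 1 - Pi.single 0 1 := by
  induction m with
  | zero =>
    have : (⟨0, hm⟩ : Fin (n + 1)) = 0 := rfl
    simp [initialSum, this]
  | succ m ih =>
    have h1 := sum_Icc_eq_initialSum_sub (simpleRoot n) (le_refl (⟨m, by omega⟩ : Fin n))
    rw [Finset.Icc_self, Finset.sum_singleton, eq_sub_iff_add_eq] at h1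
    dsimp only at h1
    rw [← h1]
    change (simpleRoot n ⟨m, by omega⟩).1 + (initialSum (simpleRoot n) m).1 = _
    rw [ih (by omega)]
    change (Pi.single (⟨m + 1, _⟩ : Fin (n + 1)) (1 : ℝ) : Fin (n + 1) → ℝ) - Pi.single ⟨m, _⟩ 1 +
      (Pi.single ⟨m, _⟩ 1 - Pi.single 0 1) = _
    abel

theorem rootVector_simpleRoot_inl (p : {p : Fin n × Fin n // p.1 ≤ p.2}) :
    (rootVector (simpleRoot n) (.inl p)).1 =
      Pi.single p.1.2.succ 1 - Pi.single p.1.1.castSucc 1 := by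
  rw [rootVector_inl]
  change (initialSum (simpleRoot n) (p.1.2 + 1)).1 - (initialSum (simpleRoot n) p.1.1).1 = _
  rw [initialSum_simpleRoot (by omega), initialSum_simpleRoot (by omega)]
  change (Pi.single p.1.2.succ (1 : ℝ) : Fin (n + 1) → ℝ) - Pi.single 0 1 -
    (Pi.single p.1.1.castSucc 1 - Pi.single 0 1) = _
  abel

theorem range_rootVector_simpleRoot (n : ℕ) :
    Set.range (rootVector (simpleRoot n)) = almostPositiveRoots n := by
  refine Set.Subset.antisymm ?_ ?_
  · rintro _ ⟨p | k, rfl⟩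
    · refine Or.inl ⟨⟨p.1.2.succ, p.1.1.castSucc, ?_, rootVector_simpleRoot_inl p⟩, ?_⟩
      · have : p.1.1.val ≤ p.1.2.val := p.2
        rw [Ne, Fin.ext_iff, Fin.val_succ, Fin.val_castSucc]
        omega
      · exact AddSubmonoid.sum_mem _ fun k _ => AddSubmonoid.subset_closure ⟨k, rfl⟩
    · exact Or.inr ⟨k, rfl⟩
  · rintro β (⟨⟨i, j, hij, hβ⟩, hcl⟩ | ⟨k, rfl⟩)
    · have hnn : ∀ q, 0 ≤ tailSum q β := by
        intro q
        refine AddSubmonoid.closure_induction (motive := fun x _ => 0 ≤ tailSum q x) ?_ ?_ ?_ hcl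
        · rintro _ ⟨l, rfl⟩
          rw [tailSum_simpleRoot]
          split_ifs <;> norm_num
        · simp
        · intro x y _ _ hx hy
          rw [map_add]
          exact add_nonneg hx hy
      -- Tail sums are nonnegative on sums of simple roots, but the tail sum of `e_i - e_j` at `j`
      -- is `-1` if `i < j`.
      have hji : j < i := by
        by_contra hlt
        have h1 := hnn j
        rw [tailSum_apply, hβ] at h1
        simp only [Pi.sub_apply, Finset.sum_sub_distrib, Finset.sum_pi_single', Finset.mem_Ici,
          le_refl, if_true] at h1
        rw [if_neg fun h => hij (le_antisymm (not_lt.1 hlt) h)] at h1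
        norm_num at h1
      have hji' : j.val < i.val := hji
      refine ⟨.inl ⟨(⟨j, by omega⟩, ⟨i.val - 1, by omega⟩), ?_⟩, Subtype.ext ?_⟩
      · rw [Fin.le_def]
        dsimp only
        omega
      · rw [rootVector_simpleRoot_inl, hβ]
        congr 2
        exact Fin.ext (by rw [Fin.val_succ]; dsimp only; omega)
    · exact ⟨.inr k, rfl⟩

theorem isFanFamily_simpleRoot (n : ℕ) (s : ℕ → ℤˣ) :
    IsFanFamily (rootVector (simpleRoot n)) (RootCross s) := by
  rw [← coe_simpleRootBasis]
  exact isFanFamily_rootVector _ s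

theorem exists_isSeedAssociahedron {s : ℕ → ℤˣ} {δ : Fin n → Diagonal n}
    (h : HasRootIndexing s δ) :
    ∃ P : Set (Module.Dual ℝ (rootSpace n)), IsSeedAssociahedron δ (simpleRoot n) P := by
  obtain ⟨P, hP, hfan⟩ := exists_polytope_normalFan (isFanFamily_simpleRoot n s)
    (isExchangeHeight_rootHeight (simpleRoot n) s)
  exact ⟨P, hP, hfan.trans (seedFan_eq_noncrossingFan h _).symm⟩

theorem range_diagonalVector {s : ℕ → ℤˣ} {δ : Fin n → Diagonal n} (h : HasRootIndexing s δ) :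
    Set.range (diagonalVector δ (simpleRoot n)) = almostPositiveRoots n := by
  obtain ⟨e, he, heδ⟩ := h
  rw [← range_rootVector_simpleRoot, ← e.surjective.range_comp]
  exact congrArg Set.range (funext fun d => diagonalVector_eq_rootVector he heδ _ d)

theorem bijOn_face_almostPositiveRoots {s : ℕ → ℤˣ} {δ : Fin n → Diagonal n}
    (h : HasRootIndexing s δ) {P : Set (Module.Dual ℝ (rootSpace n))}
    (hP : IsSeedAssociahedron δ (simpleRoot n) P) :
    Set.BijOn (face P) (almostPositiveRoots n) (facets P) := by
  rw [← range_rootVector_simpleRoot]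
  exact (isFanFamily_simpleRoot n s).bijOn_facets hP.1
    (hP.2.trans (seedFan_eq_noncrossingFan h _))

end RootSystems

/-! ### Sign change and reversal as isomorphisms of fans -/

section Symmetries

variable {n : ℕ}

/-- Crossing only tests equality of signs at positions from `1` to `n - 1`. Hence a global sign
change has no effect, and neither do the values outside this range. -/
theorem intervalCross_congr {s s' : ℕ → ℤˣ}
    (h : ∀ k l, 1 ≤ k → k < n → 1 ≤ l → l < n → (s k = s l ↔ s' k = s' l)) {i j k l : ℕ}
    (hj : j < n) (hkl : k ≤ l) (hl : l < n) :
    IntervalCross s i j k l ↔ IntervalCross s' i j k l := by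
  unfold IntervalCross
  refine and_congr_right fun hik => or_congr ?_ ?_
  · exact and_congr_right fun hjl => and_congr_right fun _ =>
      h k (j + 1) (by omega) (by omega) (by omega) (by omega)
  · exact and_congr_right fun hlj =>
      not_congr (h k (l + 1) (by omega) (by omega) (by omega) (by omega))

theorem rootCross_congr {s s' : ℕ → ℤˣ}
    (h : ∀ k l, 1 ≤ k → k < n → 1 ≤ l → l < n → (s k = s l ↔ s' k = s' l)) (d e : RootIndex n) :
    RootCross s d e ↔ RootCross s' d e := by
  rcases d with p | k <;> rcases e with q | l
  · exact or_congr (intervalCross_congr h p.1.2.2 q.2 q.1.2.2)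
      (intervalCross_congr h q.1.2.2 p.2 p.1.2.2)
  · exact Iff.rfl
  · exact Iff.rfl
  · exact Iff.rfl

/-- The involution of the almost positive roots that exchanges `α i` and `α (n - 1 - i)`. -/
def RootIndex.rev : RootIndex n → RootIndex n
  | .inl p => .inl ⟨(Fin.rev p.1.2, Fin.rev p.1.1), Fin.rev_le_rev.2 p.2⟩
  | .inr k => .inr (Fin.rev k)

theorem RootIndex.rev_involutive : Function.Involutive (RootIndex.rev (n := n)) := by
  rintro (p | k) <;> simp [RootIndex.rev]

/-- Reversal swaps the order of two overlapping or adjacent intervals but keeps the outer of two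
nested intervals first, whence the disjunction. -/
theorem intervalCross_rev {s s' : ℕ → ℤˣ} (h : ∀ m, 1 ≤ m → m < n → s' m = s (n - m))
    {i j k l : ℕ} (hij : i ≤ j) (hj : j < n) (hkl : k ≤ l) (hl : l < n)
    (hc : IntervalCross s' i j k l) :
    IntervalCross s (n - (j + 1)) (n - (i + 1)) (n - (l + 1)) (n - (k + 1)) ∨
      IntervalCross s (n - (l + 1)) (n - (k + 1)) (n - (j + 1)) (n - (i + 1)) := by
  obtain ⟨hik, ⟨hjl, hkj, hs⟩ | ⟨hlj, hs⟩⟩ := hc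
  · refine Or.inr ⟨by omega, Or.inl ⟨by omega, by omega, ?_⟩⟩
    rw [h k (by omega) (by omega), h (j + 1) (by omega) (by omega)] at hs
    rw [← hs]
    congr 1
    omega
  · refine Or.inl ⟨by omega, Or.inr ⟨by omega, ?_⟩⟩
    rw [h k (by omega) (by omega), h (l + 1) (by omega) (by omega)] at hs
    rw [show n - (k + 1) + 1 = n - k by omega]
    exact hs.symm

theorem rootCross_rev_of {s s' : ℕ → ℤˣ} (h : ∀ m, 1 ≤ m → m < n → s' m = s (n - m))
    {d e : RootIndex n} (hc : RootCross s' d e) : RootCross s d.rev e.rev := by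
  rcases d with p | k <;> rcases e with q | l
  · rcases hc with hc | hc
    · have := intervalCross_rev h p.2 p.1.2.2 q.2 q.1.2.2 hc
      simpa only [RootCross, RootIndex.rev, Fin.val_rev] using this
    · have := intervalCross_rev h q.2 q.1.2.2 p.2 p.1.2.2 hc
      simpa only [RootCross, RootIndex.rev, Fin.val_rev] using this.symm
  · exact ⟨Fin.rev_le_rev.2 hc.2, Fin.rev_le_rev.2 hc.1⟩
  · exact ⟨Fin.rev_le_rev.2 hc.2, Fin.rev_le_rev.2 hc.1⟩
  · exact hc

theorem rootCross_rev {s s' : ℕ → ℤˣ} (h : ∀ m, 1 ≤ m → m < n → s' m = s (n - m))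
    (d e : RootIndex n) : RootCross s d.rev e.rev ↔ RootCross s' d e := by
  refine ⟨fun hc => ?_, rootCross_rev_of h⟩
  have h' : ∀ m, 1 ≤ m → m < n → s m = s' (n - m) := fun m hm hmn => by
    rw [h (n - m) (by omega) (by omega)]
    congr 1
    omega
  have := rootCross_rev_of h' hc
  rwa [RootIndex.rev_involutive, RootIndex.rev_involutive] at this

variable {V : Type*} [AddCommGroup V] [Module ℝ V]

theorem image_noncrossingFan {D D' W : Type*} [AddCommGroup W] [Module ℝ W] {v : D → V} {w : D' → W}
    {cross : D → D → Prop} {cross' : D' → D' → Prop} (f : V ≃ₗ[ℝ] W) (σ : D ≃ D')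
    (hf : ∀ d, f (v d) = w (σ d)) (hσ : ∀ d e, cross' (σ d) (σ e) ↔ cross d e) :
    (fun C : Set V => f '' C) '' noncrossingFan v cross = noncrossingFan w cross' := by
  have himg : ∀ S : Set D, f '' (PointedCone.hull ℝ (v '' S) : Set V) =
      (PointedCone.hull ℝ (w '' (σ '' S)) : Set W) := by
    intro S
    have h1 : w '' (σ '' S) = (f : V →ₗ[ℝ] W) '' (v '' S) := by
      rw [Set.image_image, Set.image_image]
      exact Set.image_congr fun d _ => (hf d).symm
    rw [h1]
    have h2 := PointedCone.coe_map (PointedCone.hull ℝ (v '' S)) (f : V →ₗ[ℝ] W)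
    rw [PointedCone.map, PointedCone.hull, Submodule.map_span] at h2
    exact h2.symm
  ext C
  constructor
  · rintro ⟨_, ⟨S, hS, rfl⟩, rfl⟩
    refine ⟨σ '' S, ?_, himg S⟩
    rintro _ ⟨d, hd, rfl⟩ _ ⟨e, he, rfl⟩
    rw [hσ]
    exact hS d hd e he
  · rintro ⟨S, hS, rfl⟩
    refine ⟨_, ⟨σ ⁻¹' S, fun d hd e he => ?_, rfl⟩, ?_⟩
    · rw [← hσ]
      exact hS _ hd _ he
    · change f '' _ = _
      rw [himg, Set.image_preimage_eq _ σ.surjective]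

theorem noncrossingFan_congr {D : Type*} {v : D → V} {cross cross' : D → D → Prop}
    (h : ∀ d e, cross d e ↔ cross' d e) : noncrossingFan v cross = noncrossingFan v cross' := by
  rw [show cross = cross' from funext fun d => funext fun e => propext (h d e)]

theorem map_rootVector_rev (b : Module.Basis (Fin n) ℝ V) (d : RootIndex n) :
    b.equiv b Fin.revPerm (rootVector b d) = rootVector b d.rev := by
  rcases d with p | k
  · simp only [rootVector, RootIndex.rev, map_sum, Module.Basis.equiv_apply, Fin.revPerm_apply]
    refine Finset.sum_bij' (fun k _ => Fin.rev k) (fun k _ => Fin.rev k) ?_ ?_ ?_ ?_ ?_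
    · intro k hk
      rw [Finset.mem_Icc] at hk ⊢
      exact ⟨Fin.rev_le_rev.2 hk.2, Fin.rev_le_rev.2 hk.1⟩
    · intro k hk
      rw [Finset.mem_Icc] at hk ⊢
      exact ⟨Fin.le_rev_iff.1 hk.2, Fin.rev_le_iff.1 hk.1⟩
    · simp
    · simp
    · simp
  · simp [rootVector, RootIndex.rev]

/-- The linear isomorphism `α i ↦ α (n - 1 - i)` reverses the signs of a fan. -/
theorem image_noncrossingFan_rev (b : Module.Basis (Fin n) ℝ V) {s s' : ℕ → ℤˣ}
    (h : ∀ m, 1 ≤ m → m < n → s' m = s (n - m)) :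
    (fun C : Set V => b.equiv b Fin.revPerm '' C) '' noncrossingFan (rootVector b) (RootCross s') =
      noncrossingFan (rootVector b) (RootCross (n := n) s) :=
  image_noncrossingFan _ RootIndex.rev_involutive.toPerm (map_rootVector_rev b) (rootCross_rev h)

end Symmetries

/-! ### Isomorphic fans have equivalent signs -/

section Rigidity

variable {n : ℕ} {V : Type*} [AddCommGroup V]

/-- The index of the simple root `α i`. -/
def RootIndex.simple (i : Fin n) : RootIndex n := .inl ⟨(i, i), le_rfl⟩

theorem rootVector_simple (α : Fin n → V) (i : Fin n) : rootVector α (.simple i) = α i := by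
  simp [rootVector, RootIndex.simple]

variable [Module ℝ V]

theorem rootCross_simple_iff {s : ℕ → ℤˣ} {i j : Fin n} :
    RootCross s (.simple i) (.simple j) ↔ i.val + 1 = j.val ∨ j.val + 1 = i.val := by
  simp only [RootCross, RootIndex.simple, IntervalCross]
  constructor
  · rintro (⟨h1, ⟨h2, h3, -⟩ | ⟨h2, -⟩⟩ | ⟨h1, ⟨h2, h3, -⟩ | ⟨h2, -⟩⟩) <;> omega
  · rintro (h | h)
    · exact Or.inl ⟨by omega, Or.inl ⟨by omega, by omega, by rw [h]⟩⟩
    · exact Or.inr ⟨by omega, Or.inl ⟨by omega, by omega, by rw [h]⟩⟩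

/-- Comparing coordinates, an interval vector can only be opposite to a vector `-α k`, and then both
of its endpoints equal `k`. -/
theorem eq_simple_of_opposite (b : Module.Basis (Fin n) ℝ V) {d e : RootIndex n} {t r : ℝ}
    (ht : 0 < t) (hr : 0 < r) (h : t • rootVector b d = -(r • rootVector b e)) :
    ∃ k, (d = .simple k ∧ e = .inr k) ∨ (d = .inr k ∧ e = .simple k) := by
  have hc : ∀ x, t * b.repr (rootVector b d) x = -(r * b.repr (rootVector b e) x) := fun x => by
    have := congrArg (fun u => b.repr u x) h
    simpa using this
  rcases d with p | k <;> rcases e with q | l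
  · have h1 := hc p.1.1
    rw [repr_rootVector_inl, repr_rootVector_inl, if_pos ⟨le_rfl, p.2⟩] at h1
    split_ifs at h1 <;> linarith
  · have h1 := hc p.1.1
    have h2 := hc p.1.2
    rw [repr_rootVector_inl, repr_rootVector_inr, if_pos ⟨le_rfl, p.2⟩] at h1
    rw [repr_rootVector_inl, repr_rootVector_inr, if_pos ⟨p.2, le_rfl⟩] at h2
    split_ifs at h1 with h3 <;> split_ifs at h2 with h4 <;> try linarith
    refine ⟨l, Or.inl ⟨congrArg Sum.inl (Subtype.ext (Prod.ext h3.symm h4.symm)), rfl⟩⟩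
  · have h1 := hc q.1.1
    have h2 := hc q.1.2
    rw [repr_rootVector_inl, repr_rootVector_inr,
      if_pos (⟨le_rfl, q.2⟩ : q.1.1 ≤ q.1.1 ∧ q.1.1 ≤ q.1.2)] at h1
    rw [repr_rootVector_inl, repr_rootVector_inr,
      if_pos (⟨q.2, le_rfl⟩ : q.1.1 ≤ q.1.2 ∧ q.1.2 ≤ q.1.2)] at h2
    split_ifs at h1 with h3 <;> split_ifs at h2 with h4 <;> try linarith
    refine ⟨k, Or.inr ⟨rfl, congrArg Sum.inl (Subtype.ext (Prod.ext h3.symm h4.symm))⟩⟩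
  · have h1 := hc k
    rw [repr_rootVector_inr, repr_rootVector_inr, if_pos rfl] at h1
    split_ifs at h1 <;> linarith

/-- Automorphisms of a path: the first step fixes the direction, injectivity forbids turning back,
and the length leaves no room for a shift. -/
theorem eq_id_or_eq_rev_of_adjacent {σ : Fin n → Fin n} (hσ : Function.Injective σ)
    (hadj : ∀ i j : Fin n, i.val + 1 = j.val →
      (σ i).val + 1 = (σ j).val ∨ (σ j).val + 1 = (σ i).val) :
    (∀ i, σ i = i) ∨ ∀ i, σ i = Fin.rev i := by
  rcases Nat.lt_or_ge 1 n with hn | hn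
  swap
  · refine Or.inl fun i => Fin.ext ?_
    omega
  have hne : ∀ i j : Fin n, i.val ≠ j.val → (σ i).val ≠ (σ j).val := fun i j h h' =>
    h (congrArg Fin.val (hσ (Fin.ext h')))
  rcases hadj ⟨0, by omega⟩ ⟨1, hn⟩ rfl with h0 | h0
  · have hup : ∀ k (hk : k + 1 < n), (σ ⟨k, by omega⟩).val + 1 = (σ ⟨k + 1, hk⟩).val := by
      intro k
      induction k with
      | zero => exact fun _ => h0
      | succ k ih =>
        intro hk
        have h1 := ih (by omega)
        have h2 := hadj ⟨k + 1, by omega⟩ ⟨k + 1 + 1, hk⟩ rfl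
        have h3 := hne ⟨k, by omega⟩ ⟨k + 1 + 1, hk⟩ (by dsimp only; omega)
        omega
    have hlin : ∀ k (hk : k < n), (σ ⟨k, hk⟩).val = (σ ⟨0, by omega⟩).val + k := by
      intro k
      induction k with
      | zero => exact fun _ => rfl
      | succ k ih =>
        intro hk
        have h1 := ih (by omega)
        have h2 := hup k hk
        omega
    refine Or.inl fun i => Fin.ext ?_
    have h1 := hlin i i.2
    have h2 := hlin (n - 1) (by omega)
    have h3 := (σ ⟨n - 1, by omega⟩).2
    change (σ i).val = _ at h1
    omega
  · have hdown : ∀ k (hk : k + 1 < n), (σ ⟨k + 1, hk⟩).val + 1 = (σ ⟨k, by omega⟩).val := by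
      intro k
      induction k with
      | zero => exact fun _ => h0
      | succ k ih =>
        intro hk
        have h1 := ih (by omega)
        have h2 := hadj ⟨k + 1, by omega⟩ ⟨k + 1 + 1, hk⟩ rfl
        have h3 := hne ⟨k, by omega⟩ ⟨k + 1 + 1, hk⟩ (by dsimp only; omega)
        omega
    have hlin : ∀ k (hk : k < n), (σ ⟨k, hk⟩).val + k = (σ ⟨0, by omega⟩).val := by
      intro k
      induction k with
      | zero => exact fun _ => rfl
      | succ k ih =>
        intro hk
        have h1 := ih (by omega)
        have h2 := hdown k hk
        omega
    refine Or.inr fun i => Fin.ext ?_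
    rw [Fin.val_rev]
    have h1 := hlin i i.2
    have h2 := hlin (n - 1) (by omega)
    have h3 := (σ ⟨0, by omega⟩).2
    change (σ i).val + _ = _ at h1
    omega

/-- A linear isomorphism of the fans scales the simple roots, possibly after a reversal. -/
theorem map_basis_of_image_noncrossingFan (hn : 2 ≤ n) (b : Module.Basis (Fin n) ℝ V)
    {s s' : ℕ → ℤˣ} (f : V ≃ₗ[ℝ] V)
    (hf : (fun C : Set V => f '' C) '' noncrossingFan (rootVector b) (RootCross s) =
      noncrossingFan (rootVector b) (RootCross s')) :
    ∃ t : Fin n → ℝ, (∀ i, 0 < t i) ∧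
      ((∀ i, f (b i) = t i • b i) ∨ ∀ i, f (b i) = t i • b (Fin.rev i)) := by
  have hv := isFanFamily_rootVector b s
  have hv' := isFanFamily_rootVector b s'
  obtain ⟨π, c, hc, hπ, hcross⟩ := exists_map_of_image_noncrossingFan hv hv' RootCross.symm
    RootCross.symm f hf
  have hinj : Function.Injective π := by
    intro d e hde
    have h1 := hπ d
    have h2 := hπ e
    rw [hde] at h1
    have h3 : f (c e • rootVector b d) = f (c d • rootVector b e) := by
      rw [map_smul, map_smul, h1, h2, smul_smul, smul_smul, mul_comm]
    exact hv.eq_of_smul_eq (hc e) (hc d).le (f.injective h3)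
  have hopp : ∀ i, ∃ k, (π (.simple i) = .simple k ∧ π (.inr i) = .inr k) ∨
      (π (.simple i) = .inr k ∧ π (.inr i) = .simple k) := by
    intro i
    refine eq_simple_of_opposite b (hc (.simple i)) (hc (.inr i)) ?_
    rw [← hπ, ← hπ, rootVector_simple]
    simp [rootVector]
  choose σ hσ using hopp
  have hnb : ∀ i : Fin n, ∃ j : Fin n, i.val + 1 = j.val ∨ j.val + 1 = i.val := by
    intro i
    by_cases hi : i.val + 1 < n
    · exact ⟨⟨i.val + 1, hi⟩, Or.inl rfl⟩
    · refine ⟨⟨i.val - 1, by omega⟩, Or.inr ?_⟩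
      dsimp only
      omega
  -- Signs cannot be flipped: `α i` crosses a neighbouring simple root, which exists because `n ≥
  -- 2`, whereas `-α k` crosses no other negative and, among simple roots, only its own opposite `α
  -- k`.
  have hpos : ∀ i, π (.simple i) = .simple (σ i) := by
    intro i
    by_contra hne
    have hi : π (.simple i) = .inr (σ i) := ((hσ i).resolve_left fun h => hne h.1).1
    obtain ⟨j, hij⟩ := hnb i
    have h1 := (hcross (.simple i) (.simple j)).2 (rootCross_simple_iff.2 hij)
    rw [hi] at h1
    rcases hσ j with ⟨h2, h3⟩ | ⟨h2, -⟩
    · rw [h2] at h1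
      have h4 : σ j = σ i := le_antisymm h1.1 h1.2
      have h5 : (RootIndex.simple i) = .inr j := hinj (by rw [hi, h3, h4])
      simp [RootIndex.simple] at h5
    · rw [h2] at h1
      exact h1
  have hσinj : Function.Injective σ := by
    intro i j hij
    have h1 : RootIndex.simple i = .simple j := hinj (by rw [hpos, hpos, hij])
    simpa [RootIndex.simple] using h1
  have hmap : ∀ i, f (b i) = c (.simple i) • b (σ i) := fun i => by
    rw [← rootVector_simple b i, hπ, hpos, rootVector_simple]
  refine ⟨fun i => c (.simple i), fun i => hc _, ?_⟩
  refine (eq_id_or_eq_rev_of_adjacent hσinj fun i j hij => ?_).imp (fun h i => ?_) fun h i => ?_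
  · have := (hcross (.simple i) (.simple j)).2 (rootCross_simple_iff.2 (Or.inl hij))
    rwa [hpos, hpos, rootCross_simple_iff] at this
  · rw [hmap, h]
  · rw [hmap, h]

/-- A linear isomorphism of the fans that scales the simple roots preserves the equality of
consecutive signs. -/
theorem consecutive_sign_eq_iff (b : Module.Basis (Fin n) ℝ V)
    {s s' : ℕ → ℤˣ} (f : V ≃ₗ[ℝ] V)
    (hf : (fun C : Set V => f '' C) '' noncrossingFan (rootVector b) (RootCross s) =
      noncrossingFan (rootVector b) (RootCross s'))
    {t : Fin n → ℝ} (ht : ∀ i, 0 < t i) (hft : ∀ i, f (b i) = t i • b i) {g : ℕ} (hg : g + 2 < n) :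
    s (g + 1) = s (g + 2) ↔ s' (g + 1) = s' (g + 2) := by
  obtain ⟨π, c, hc, hπ, hcross⟩ := exists_map_of_image_noncrossingFan (isFanFamily_rootVector b s)
    (isFanFamily_rootVector b s') RootCross.symm RootCross.symm f hf
  let pair : ∀ g, g + 1 < n → RootIndex n := fun g hg =>
    .inl ⟨(⟨g, by omega⟩, ⟨g + 1, hg⟩), by rw [Fin.le_def]; dsimp only; omega⟩
  have hpair : ∀ g hg, rootVector b (pair g hg) = b ⟨g, by omega⟩ + b ⟨g + 1, hg⟩ := by
    intro g hg
    change ∑ k ∈ Finset.Icc (⟨g, by omega⟩ : Fin n) ⟨g + 1, hg⟩, b k = _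
    rw [← Finset.sum_pair (by rw [Ne, Fin.mk.injEq]; omega)]
    refine Finset.sum_congr ?_ fun _ _ => rfl
    ext k
    simp only [Finset.mem_Icc, Finset.mem_insert, Finset.mem_singleton, Fin.le_def, Fin.ext_iff]
    omega
  -- The image of `α g + α (g + 1)` has positive coordinates exactly at `g` and `g + 1`; only one
  -- almost positive root spans such a ray.
  have hfix : ∀ g hg, π (pair g hg) = pair g hg := by
    intro g hg
    have hcoord : ∀ x, t ⟨g, by omega⟩ * (if (⟨g, by omega⟩ : Fin n) = x then 1 else 0) +
        t ⟨g + 1, hg⟩ * (if (⟨g + 1, hg⟩ : Fin n) = x then 1 else 0) =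
        c (pair g hg) * b.repr (rootVector b (π (pair g hg))) x := by
      intro x
      have h1 := congrArg (fun u => b.repr u x) (hπ (pair g hg))
      rw [hpair, map_add, hft, hft] at h1
      simpa [Finsupp.single_apply] using h1
    have hcp := hc (pair g hg)
    have ht1 := ht ⟨g, by omega⟩
    have ht2 := ht ⟨g + 1, hg⟩
    rcases hd : π (pair g hg) with p | k
    · simp only [hd, repr_rootVector_inl] at hcoord
      have hne : (⟨g + 1, hg⟩ : Fin n) ≠ ⟨g, by omega⟩ := by rw [Ne, Fin.mk.injEq]; omega
      have h1 := hcoord ⟨g, by omega⟩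
      have h2 := hcoord ⟨g + 1, hg⟩
      rw [if_pos rfl, if_neg hne] at h1
      rw [if_pos rfl, if_neg hne.symm] at h2
      have h3 := hcoord p.1.1
      have h4 := hcoord p.1.2
      rw [if_pos (⟨le_rfl, p.2⟩ : p.1.1 ≤ p.1.1 ∧ p.1.1 ≤ p.1.2)] at h3
      rw [if_pos (⟨p.2, le_rfl⟩ : p.1.1 ≤ p.1.2 ∧ p.1.2 ≤ p.1.2)] at h4
      have h1' : p.1.1 ≤ ⟨g, by omega⟩ := by
        by_contra hlt
        rw [if_neg fun h => hlt h.1] at h1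
        linarith
      have h2' : ⟨g + 1, hg⟩ ≤ p.1.2 := by
        by_contra hlt
        rw [if_neg fun h => hlt h.2] at h2
        linarith
      have h3' : (⟨g, by omega⟩ : Fin n) = p.1.1 ∨ (⟨g + 1, hg⟩ : Fin n) = p.1.1 := by
        by_contra! hno
        rw [if_neg hno.1, if_neg hno.2] at h3
        linarith
      have h4' : (⟨g, by omega⟩ : Fin n) = p.1.2 ∨ (⟨g + 1, hg⟩ : Fin n) = p.1.2 := by
        by_contra! hno
        rw [if_neg hno.1, if_neg hno.2] at h4
        linarith
      simp only [Fin.le_def, Fin.ext_iff] at h1' h2' h3' h4'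
      refine congrArg Sum.inl (Subtype.ext (Prod.ext (Fin.ext ?_) (Fin.ext ?_)))
      · dsimp only; omega
      · dsimp only; omega
    · have h1 := hcoord k
      rw [hd, repr_rootVector_inr, if_pos rfl] at h1
      have h2 : (0 : ℝ) ≤ if (⟨g, by omega⟩ : Fin n) = k then 1 else 0 := by
        split_ifs <;> norm_num
      have h3 : (0 : ℝ) ≤ if (⟨g + 1, hg⟩ : Fin n) = k then 1 else 0 := by
        split_ifs <;> norm_num
      nlinarith [mul_nonneg ht1.le h2, mul_nonneg ht2.le h3]
  have hcr : ∀ s : ℕ → ℤˣ, RootCross s (pair g (by omega)) (pair (g + 1) (by omega)) ↔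
      s (g + 1) = s (g + 2) := by
    intro s
    change (IntervalCross s g (g + 1) (g + 1) (g + 2) ∨
      IntervalCross s (g + 1) (g + 2) g (g + 1)) ↔ _
    constructor
    · rintro (⟨-, ⟨-, -, h⟩ | ⟨h, -⟩⟩ | ⟨h, -⟩)
      · exact h
      · omega
      · omega
    · intro h
      exact Or.inl ⟨by omega, Or.inl ⟨by omega, by omega, h⟩⟩
  rw [← hcr s, ← hcr s', ← hcross, hfix, hfix]

theorem exists_sign_factor {s s' : ℕ → ℤˣ}
    (h : ∀ g, g + 2 < n → (s (g + 1) = s (g + 2) ↔ s' (g + 1) = s' (g + 2))) :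
    ∃ ε : ℤˣ, ∀ k, 1 ≤ k → k < n → s' k = ε * s k := by
  refine ⟨s' 1 * s 1, fun k hk => ?_⟩
  induction k, hk using Nat.le_induction with
  | base =>
    intro _
    rw [mul_assoc, Int.units_mul_self, mul_one]
  | succ k hk ih =>
    intro hkn
    have h1 := ih (by omega)
    have h2 := h (k - 1) (by omega)
    rw [show k - 1 + 1 = k by omega, show k - 1 + 2 = k + 1 by omega] at h2
    generalize s' 1 * s 1 = ε at *
    rcases Int.units_eq_one_or (s k) with h3 | h3 <;>
      rcases Int.units_eq_one_or (s (k + 1)) with h4 | h4 <;>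
      rcases Int.units_eq_one_or (s' (k + 1)) with h5 | h5 <;>
      rcases Int.units_eq_one_or ε with h6 | h6 <;>
      rw [h3, h6] at h1 <;> rw [h1, h3, h4, h5] at h2 <;> rw [h4, h5, h6] <;> revert h2 <;> decide

/-- Linearly isomorphic fans have the same signs, up to a change of all signs and a reversal. -/
theorem sign_eq_of_image_noncrossingFan (b : Module.Basis (Fin n) ℝ V) {s s' : ℕ → ℤˣ}
    (f : V ≃ₗ[ℝ] V)
    (hf : (fun C : Set V => f '' C) '' noncrossingFan (rootVector b) (RootCross s) =
      noncrossingFan (rootVector b) (RootCross s')) :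
    ∃ ε : ℤˣ, (∀ k, 1 ≤ k → k < n → s' k = ε * s k) ∨
      ∀ k, 1 ≤ k → k < n → s' (n - k) = ε * s k := by
  rcases Nat.lt_or_ge n 2 with hn | hn
  · exact ⟨1, Or.inl fun k h1 h2 => by omega⟩
  obtain ⟨t, ht, h | h⟩ := map_basis_of_image_noncrossingFan hn b f hf
  · obtain ⟨ε, hε⟩ := exists_sign_factor fun g hg => consecutive_sign_eq_iff b f hf ht h hg
    exact ⟨ε, Or.inl hε⟩
  -- Composing with the reversal of the simple roots reduces to the case without reversal, for the
  -- reversed signs.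
  · let r := b.equiv b Fin.revPerm
    have hr := image_noncrossingFan_rev b (s := fun m => s' (n - m)) (s' := s') fun m h1 h2 => by
      congr 1
      omega
    have hfr : (fun C : Set V => (f.trans r) '' C) '' noncrossingFan (rootVector b) (RootCross s) =
        noncrossingFan (rootVector b) (RootCross fun m => s' (n - m)) := by
      rw [← hr, ← hf, Set.image_image]
      refine Set.image_congr fun C _ => ?_
      rw [Set.image_image]
      rfl
    obtain ⟨ε, hε⟩ := exists_sign_factor (s := s) (s' := fun m => s' (n - m)) fun g hg =>
      consecutive_sign_eq_iff b (f.trans r) hfr ht (fun i => by simp [h, r]) hg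
    exact ⟨ε, Or.inr hε⟩

end Rigidity

/-! ### Counting the normal isomorphism classes -/

section Classification

variable {n : ℕ}

/-- The signs of the gaps `1, …, n - 1` given by a sign sequence, extended by `1`. -/
def gapSign (c : Fin (n - 1) → ℤˣ) (k : ℕ) : ℤˣ :=
  if h : 1 ≤ k ∧ k < n then c ⟨k - 1, by omega⟩ else 1

theorem gapSign_succ (c : Fin (n - 1) → ℤˣ) (m : Fin (n - 1)) : gapSign c (m + 1) = c m := by
  rw [gapSign, dif_pos (by omega)]
  rfl

/-- The fan with the signs given by a sign sequence. -/
def signFan (c : Fin (n - 1) → ℤˣ) : Set (Set (rootSpace n)) :=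
  noncrossingFan (rootVector (simpleRoot n)) (RootCross (gapSign c))

theorem exists_signFan_eq (s : ℕ → ℤˣ) : ∃ c : Fin (n - 1) → ℤˣ,
    noncrossingFan (rootVector (simpleRoot n)) (RootCross s) = signFan c := by
  refine ⟨fun m => s (m + 1), noncrossingFan_congr (rootCross_congr fun k l h1 h2 h3 h4 => ?_)⟩
  rw [gapSign, gapSign, dif_pos ⟨h1, h2⟩, dif_pos ⟨h3, h4⟩]
  dsimp only
  rw [Nat.sub_add_cancel h1, Nat.sub_add_cancel h3]

theorem exists_normalFan_eq_signFan (P : PathAssociahedron n) :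
    ∃ c : Fin (n - 1) → ℤˣ, normalFan P.1 = signFan c := by
  obtain ⟨P, T, δ, hδ, hP⟩ := P
  obtain ⟨s, hs⟩ := hδ.exists_hasRootIndexing
  obtain ⟨c, hc⟩ := exists_signFan_eq (n := n) s
  exact ⟨c, by rw [hP.2, seedFan_eq_noncrossingFan hs, hc]⟩

theorem exists_pathAssociahedron (c : Fin (n - 1) → ℤˣ) :
    ∃ P : PathAssociahedron n, normalFan P.1 = signFan c := by
  have hs := hasRootIndexing_sweepDiagonal (n := n) (gapSign c)
  obtain ⟨P, hP⟩ := exists_isSeedAssociahedron hs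
  exact ⟨⟨P, _, _, isPathNumbering_sweepDiagonal _, hP⟩,
    hP.2.trans (seedFan_eq_noncrossingFan hs _)⟩

theorem signFan_neg (c : Fin (n - 1) → ℤˣ) : signFan (-c) = signFan c := by
  refine noncrossingFan_congr (rootCross_congr fun k l h1 h2 h3 h4 => ?_)
  simp only [gapSign, dif_pos (⟨h1, h2⟩ : 1 ≤ k ∧ k < n), dif_pos (⟨h3, h4⟩ : 1 ≤ l ∧ l < n),
    Pi.neg_apply, neg_inj]

theorem exists_image_signFan_rev (c : Fin (n - 1) → ℤˣ) :
    ∃ f : rootSpace n ≃ₗ[ℝ] rootSpace n,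
      (fun C : Set (rootSpace n) => f '' C) '' signFan c = signFan (c ∘ Fin.rev) := by
  have := image_noncrossingFan_rev (simpleRootBasis n) (s := gapSign (c ∘ Fin.rev))
    (s' := gapSign c) fun m h1 h2 => by
      rw [gapSign, gapSign, dif_pos ⟨h1, h2⟩, dif_pos (by omega)]
      change _ = c (Fin.rev _)
      congr 1
      refine Fin.ext ?_
      rw [Fin.val_rev]
      dsimp only
      omega
  rw [coe_simpleRootBasis] at this
  exact ⟨_, this⟩

theorem image_image_refl {V : Type*} [AddCommGroup V] [Module ℝ V] (X : Set (Set V)) :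
    (fun C : Set V => LinearEquiv.refl ℝ V '' C) '' X = X := by
  change (fun C : Set V => id '' C) '' X = X
  simp only [Set.image_id, Set.image_id']

theorem normallyIsomorphic_equivalence (n : ℕ) :
    Equivalence fun P Q : PathAssociahedron n => NormallyIsomorphic P.1 Q.1 where
  refl P := ⟨LinearEquiv.refl ℝ _, image_image_refl _⟩
  symm := by
    rintro P Q ⟨f, hf⟩
    refine ⟨f.symm, ?_⟩
    rw [← hf, Set.image_image]
    simp [Set.image_image]
  trans := by
    rintro P Q R ⟨f, hf⟩ ⟨g, hg⟩
    refine ⟨f.trans g, ?_⟩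
    rw [← hg, ← hf, Set.image_image]
    refine Set.image_congr fun C _ => ?_
    rw [Set.image_image]
    rfl

theorem normallyIsomorphic_of_reflectionOrReversal {c c' : Fin (n - 1) → ℤˣ}
    (h : ReflectionOrReversal c c') {P Q : PathAssociahedron n} (hP : normalFan P.1 = signFan c)
    (hQ : normalFan Q.1 = signFan c') : NormallyIsomorphic P.1 Q.1 := by
  rcases h with rfl | rfl
  · exact ⟨LinearEquiv.refl ℝ _, by rw [hP, hQ, signFan_neg, image_image_refl]⟩
  · obtain ⟨f, hf⟩ := exists_image_signFan_rev c
    exact ⟨f, by rw [hP, hQ, hf]⟩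

theorem mk_eq_mk_of_sign_mul (ε : ℤˣ) (c : Fin (n - 1) → ℤˣ) :
    Quot.mk ReflectionOrReversal (fun m => ε * c m) = Quot.mk ReflectionOrReversal c := by
  rcases Int.units_eq_one_or ε with rfl | rfl
  · simp
  · refine (Quot.sound (r := ReflectionOrReversal) (Or.inl ?_)).symm
    funext m
    simp

/-- Rigidity gives `c'` as `c` or its reversal times a global sign; entry `m` of a sequence sits at
gap `m + 1`, so reversing entries is `k ↦ n - k` on gaps. -/
theorem mk_eq_mk_of_image_signFan {c c' : Fin (n - 1) → ℤˣ} (f : rootSpace n ≃ₗ[ℝ] rootSpace n)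
    (hf : (fun C : Set (rootSpace n) => f '' C) '' signFan c = signFan c') :
    Quot.mk ReflectionOrReversal c = Quot.mk ReflectionOrReversal c' := by
  unfold signFan at hf
  rw [← coe_simpleRootBasis] at hf
  obtain ⟨ε, h | h⟩ := sign_eq_of_image_noncrossingFan _ f hf
  · rw [← mk_eq_mk_of_sign_mul ε c]
    congr 1
    funext m
    rw [← gapSign_succ c, ← gapSign_succ c', h _ (by omega) (by omega)]
  · rw [← mk_eq_mk_of_sign_mul ε c]
    refine (Quot.sound (r := ReflectionOrReversal) (Or.inr ?_)).symm
    funext m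
    have h1 := h (m + 1) (by omega) (by omega)
    rw [gapSign_succ, show n - (m.val + 1) = (Fin.rev m).val + 1 by rw [Fin.val_rev]; omega,
      gapSign_succ] at h1
    exact h1.symm

theorem card_normal_isomorphism_classes (n : ℕ) :
    Nat.card (Quot fun P Q : PathAssociahedron n => NormallyIsomorphic P.1 Q.1) =
      Nat.card (Quot (ReflectionOrReversal (m := n - 1))) := by
  choose P hP using exists_pathAssociahedron (n := n)
  -- The bijection sends a sign sequence to the class of any polytope with its fan. Symmetries make
  -- it well defined, rigidity makes it injective, and the sweep description of path triangulations
  -- makes it surjective.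
  let F : Quot (ReflectionOrReversal (m := n - 1)) →
      Quot fun P Q : PathAssociahedron n => NormallyIsomorphic P.1 Q.1 :=
    Quot.map P fun c c' h => normallyIsomorphic_of_reflectionOrReversal h (hP c) (hP c')
  refine (Nat.card_congr (Equiv.ofBijective F ⟨?_, ?_⟩)).symm
  · rintro ⟨c⟩ ⟨c'⟩ h
    obtain ⟨f, hf⟩ := (normallyIsomorphic_equivalence n).eqvGen_iff.1 (Quot.eqvGen_exact h)
    rw [hP, hP] at hf
    exact mk_eq_mk_of_image_signFan f hf
  · rintro ⟨Q⟩
    obtain ⟨c, hc⟩ := exists_normalFan_eq_signFan Q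
    refine ⟨Quot.mk _ c, Quot.sound ⟨LinearEquiv.refl ℝ _, ?_⟩⟩
    rw [hP, hc, image_image_refl]

end Classification

end SantosAssociahedron

theorem mainTheorem12 (n : ℕ) (hn : 1 ≤ n) :
    (∀ (T : Finset (Diagonal n)) (δ : Fin n → Diagonal n), IsPathNumbering T δ →
      (∃ P : Set (Module.Dual ℝ (rootSpace n)), IsSeedAssociahedron δ (simpleRoot n) P) ∧
      Set.range (diagonalVector δ (simpleRoot n)) = almostPositiveRoots n ∧
      ∀ P : Set (Module.Dual ℝ (rootSpace n)), IsSeedAssociahedron δ (simpleRoot n) P →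
        Set.BijOn (face P) (almostPositiveRoots n) (facets P)) ∧
    Nat.card (Quot fun P Q : PathAssociahedron n => NormallyIsomorphic P.1 Q.1) =
      Nat.card (Quot (ReflectionOrReversal (m := n - 1))) := by
  refine ⟨fun T δ h => ?_, card_normal_isomorphism_classes n⟩
  obtain ⟨s, hs⟩ := h.exists_hasRootIndexing
  exact ⟨exists_isSeedAssociahedron hs, range_diagonalVector hs,
    fun P hP => bijOn_face_almostPositiveRoots hs hP⟩
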